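/- Work over $\mathbb C$, with homogeneous coordinates $X_0,\dots,X_3$ on $\mathbb P^3$; $S_d$ is the space of forms of degree $d$ and $\mathbb P^{44}=\mathbb P(H^0(\Omega^1_{\mathbb P^3}(4)))$ is the projective space of nonzero 1-forms $\sum\omega_i\,dX_i$ with cubic coefficients and $\sum X_i\omega_i=0$. Let $\mathcal O\subset\mathbb P^{44}$ be the orbit under $\operatorname{Aut}\mathbb P^3$ of $$\omega_0=\frac{2g_0\,df_0-3f_0\,dg_0}{X_0},\qquad f_0=X_0^2X_3-X_0X_1X_2+\tfrac13X_1^3,\quad g_0=X_0X_2-\tfrac12X_1^2,$$ and let $E(3)=\overline{\mathcal O}$ be the exceptional component. **The parameter space.** Let $\mathbb F$ be the variety of complete flags $p\in\ell\subset\pi$ in $\mathbb P^3$. Coordinates $x_0,\dots,x_3$ are called adapted to the flag if $\pi=\{x_0=0\}$, $\ell=\{x_0=x_1=0\}$, $p=\{x_0=x_1=x_2=0\}$. A point of $\mathbb Y$ consists of a flag, a class $[g']$ of a quadric $g'=u_1x_0x_1+u_2x_0x_2+u_3x_1^2\notin\langle x_0^2\rangle$ modulo $x_0^2$, a quadric $[g]$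 with $0\ne g\in\langle x_0^2,g'\rangle$, and a cubic $[f]$ with $0\ne f\in x_0^2S_1+\langle 3u_1x_0x_1^2+3u_2x_0x_1x_2+2u_3x_1^3\rangle$ (these conditions do not depend on the adapted coordinates). There is a rational map $\mathbb Y\dashrightarrow\mathbb P^{44}$, $(g,g',f)\mapsto\omega=(3f\,dg-2g\,df)/x_0$. The variety $\mathbb Y_4$ is obtained from $\mathbb Y$ by blowing up successively, with the reduced structure: 1. $C$: the points with $f=l^3$, $g=l^2$, $g'=x_1(2\alpha x_0+\beta x_1)$, where $l=\alpha x_0+\beta x_1\neq0$; this gives $\mathbb Y_1$; 2. the strict transform $E'$ of $E=\{g=x_0^2,\ f=x_0^3\}$; this gives $\mathbb Y_2$; 3. the strict transform of $R\subset\mathbb Y_1$, where $R$ is the closure of the complement of $E'$ in the indeterminacy locus of $\mathbb Y_1\dashrightarrow\mathbb P^{44}$; this gives $\mathbb Y_3$; 4. the indeterminacy locus $L$ of $\mathbb Y_3\dashrightarrow\mathbb P^{44}$. Let $\Phi$ be the maximal regular extension to $\mathbb Y_4$ of the rational map $\mathbb Y_4\to\mathbb Y\dashrightarrow\mathbb P^{44}$,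 i.e. the morphism $\Phi:\mathbb Y_4\to E(3)$ (that $\Phi$ is defined at every point of $\mathbb Y_4$ is not part of the assertion). **Proposition ($\Phi$ is generically injective).** (a) $\Phi$ takes its values in $E(3)$; $\mathcal O$ is open (and dense) in $E(3)$, $\Phi^{-1}(\mathcal O)$ is open and dense in $\mathbb Y_4$, and every $\omega\in\mathcal O$ has exactly one inverse image under $\Phi$. (b) The flag can be recovered from the singular locus: if $y\in\mathbb Y_4$ and $\omega=\Phi(y)\in\mathcal O$, then in suitable coordinates adapted to the flag of $y$ the zero set $\operatorname{Sing}(\omega)\subset\mathbb P^3$ is the union of the conic $x_0=x_2^2-2x_1x_3=0$, the line $x_0=x_1=0$ and the twisted cubic $2x_2^2-3x_1x_3=x_1x_2-3x_0x_3=x_1^2-2x_0x_2=0$; and if also $\Phi(y_1)\in\mathcal O$ and $\operatorname{Sing}(\Phi(y_1))=\operatorname{Sing}(\Phi(y))$, then $y$ and $y_1$ have the same flag. (c) Fix a flag and adapted coordinates. For $$g=b_0x_0^2+b_1x_0x_1+x_0x_2+b_3x_1^2,$$ $$f=(a_0x_0+a_1x_1+a_2x_2+a_3x_3)x_0^2+a_5\left(b_1x_0x_1^2+x_0x_1x_2+\tfrac23b_3x_1^3\right)$$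 with $(a_0,a_1,a_2,a_3,a_5)\ne0$ there is exactly one point $y\in\mathbb Y_4$ over the flag and $([g],[f])$. The form $\omega=(2g\,df-3f\,dg)/x_0$ is a nonzero element of $H^0(\Omega^1_{\mathbb P^3}(4))$, and $\Phi$ is defined at $y$ with $\Phi(y)=[\omega]$. Its coefficient of $dx_3$ is $2a_3x_0g$, and its coefficient of $dx_2$ is $$(2a_2b_0-3a_0)x_0^3+(2a_5b_0+2a_2b_1-3a_1)x_0^2x_1+(-a_5b_1+2a_2b_3)x_0x_1^2-a_2x_0^2x_2-a_5x_0x_1x_2-3a_3x_0^2x_3.$$ Hence $g$ and the coefficients of $f$ can be read off where $a_3\ne0$: if $(g,f)$ and $(\tilde g,\tilde f)$ are two such pairs with $a_3\ne0\ne\tilde a_3$, and the coefficients of $dx_3$ and of $dx_2$ in $\tilde\omega$ are $c$ times those in $\omega$ for one constant $c$, then $\tilde b_i=b_i$ for $i=0,1,3$ and $\tilde a_i=c\,a_i$ for $i=0,1,2,3,5$. -/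

import Mathlib

open MvPolynomial

noncomputable section

namespace ExceptionalFoliation

/-! ### Forms, vector spaces of 1-forms, the exceptional component -/

/-- The polynomial ring `ℂ[X₀, X₁, X₂, X₃]` of `ℙ³`. -/
abbrev S : Type := MvPolynomial (Fin 4) ℂ

/-- The linear form with coefficient vector `a`. -/
def lin (a : Fin 4 → ℂ) : S := ∑ i, C (a i) * X i

/-- `H⁰(Ω¹_{ℙ³}(4))`: the 1-forms `∑ ωᵢ dXᵢ` with cubic coefficients which are killed by the
Euler vector field. A 1-form is stored as the family of its coefficients. -/
def Omega14 : Submodule ℂ (Fin 4 → S) where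
  carrier := {ω | (∀ i, (ω i).IsHomogeneous 3) ∧ ∑ i, X i * ω i = 0}
  add_mem' := by
    rintro v w ⟨hv, hv'⟩ ⟨hw, hw'⟩
    refine ⟨fun i => (hv i).add (hw i), ?_⟩
    simp only [Pi.add_apply, mul_add, Finset.sum_add_distrib, hv', hw', add_zero]
  zero_mem' := ⟨fun _ => isHomogeneous_zero _ _ _, by simp⟩
  smul_mem' := by
    rintro c v ⟨hv, hv'⟩
    refine ⟨fun i => ?_, ?_⟩
    · exact (homogeneousSubmodule (Fin 4) ℂ 3).smul_mem c (hv i)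
    · simp only [Pi.smul_apply, mul_smul_comm, ← Finset.smul_sum, hv', smul_zero]

/-- `ℙ⁴⁴ = ℙ(H⁰(Ω¹_{ℙ³}(4)))`, the space of lines of the 45-dimensional space `Omega14`. -/
abbrev P44 : Type := Projectivization ℂ Omega14

/-- The Zariski topology of `ℙ⁴⁴`: the non-vanishing loci of homogeneous polynomials in the
coefficients of the 1-form are a basis. -/
instance zariskiP44 : TopologicalSpace P44 :=
  TopologicalSpace.generateFrom
    {V | ∃ (F : MvPolynomial (Fin 4 × (Fin 4 →₀ ℕ)) ℂ) (n : ℕ), F.IsHomogeneous n ∧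
      V = {ω : P44 | eval (fun k => coeff k.2 ((ω.rep : Fin 4 → S) k.1)) F ≠ 0}}

/-- `3 f dg - 2 g df`. -/
def pairForm (g f : S) : Fin 4 → S := fun j => 3 * f * pderiv j g - 2 * g * pderiv j f

/-- `ω₀ = (2 g₀ df₀ - 3 f₀ dg₀) / X₀` for `f₀ = X₀²X₃ - X₀X₁X₂ + X₁³/3`, `g₀ = X₀X₂ - X₁²/2`. -/
def omega0 : Fin 4 → S :=
  ![X 1 * X 2 ^ 2 - 2 * X 1 ^ 2 * X 3 + X 0 * X 2 * X 3,
    X 0 * (3 * X 1 * X 3 - 2 * X 2 ^ 2),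
    X 0 * (X 1 * X 2 - 3 * X 0 * X 3),
    X 0 * (2 * X 0 * X 2 - X 1 ^ 2)]

/-- Pull-back of a 1-form under the linear change of coordinates `Xᵢ ↦ ∑ⱼ Aᵢⱼ Xⱼ`. -/
def pullback (A : GL (Fin 4) ℂ) (ω : Fin 4 → S) : Fin 4 → S :=
  fun j => ∑ i, C (A.1 i j) * aeval (fun k => lin (A.1 k)) (ω i)

/-- The orbit of `ω₀` in `ℙ⁴⁴` under `Aut ℙ³ = PGL₄(ℂ)`. -/
def orbit : Set P44 :=
  {ω | ∃ (A : GL (Fin 4) ℂ) (c : ℂ), (ω.rep : Fin 4 → S) = c • pullback A omega0}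

/-- The exceptional component `E(3)`, the Zariski closure of the orbit. -/
def E3 : Set P44 := closure orbit

/-- The singular locus of (the foliation defined by) `ω`: its zeros in `ℙ³`. -/
def singularLocus (ω : P44) : Set (Projectivization ℂ (Fin 4 → ℂ)) :=
  {v | ∀ i, eval v.rep ((ω.rep : Fin 4 → S) i) = 0}

/-! ### Varieties in multigraded homogeneous coordinates, and blow-ups -/

/-- Homogeneous coordinates on the space `𝕐` of flags with a special pair: blocks of coordinates
for the plane `π ∈ ℙ(S₁)`, the line `ℓ ∈ ℙ(Λ²S₁)` (Plücker), the point `p ∈ ℙ³`,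
the quadric `g ∈ ℙ(S₂)`, the pencil `⟨h², g'⟩ ∈ ℙ(Λ²S₂)` (Plücker) and the cubic `f ∈ ℙ(S₃)`. -/
inductive YCoord : Type
  | plane (i : Fin 4)
  | line (i j : Fin 4)
  | point (i : Fin 4)
  | quadric (m : Fin 4 →₀ ℕ)
  | pencil (m n : Fin 4 →₀ ℕ)
  | cubic (m : Fin 4 →₀ ℕ)

/-- Each of the six blocks has its own degree. -/
def YCoord.deg : YCoord → (Fin 6 → ℤ)
  | .plane _ => Pi.single 0 1
  | .line _ _ => Pi.single 1 1
  | .point _ => Pi.single 2 1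
  | .quadric _ => Pi.single 3 1
  | .pencil _ _ => Pi.single 4 1
  | .cubic _ => Pi.single 5 1

/-- A variety (over `𝕐`) presented by multigraded homogeneous coordinates: the coordinates, with
degrees in an abelian group `Deg`, the set `cone` of the coordinate vectors of its points, and the
coordinates that are pulled back from `𝕐`. The points are the orbits in `cone` of the torus
`Hom(Deg, ℂˣ)`. For the standard grading this is the usual presentation of a closed subset of a
(multi)projective space. -/
structure Variety : Type 1 where
  Coord : Type
  Deg : Type
  [grp : AddCommGroup Deg]
  deg : Coord → Deg
  cone : Set (Coord → ℂ)
  base : YCoord → Coord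

attribute [instance] Variety.grp

namespace Variety

/-- Two coordinate vectors represent the same point if they differ by an element of the torus. -/
instance setoid (V : Variety) : Setoid V.cone where
  r x y := ∃ t : Multiplicative V.Deg →* ℂˣ,
    ∀ s, y.1 s = (t (Multiplicative.ofAdd (V.deg s)) : ℂ) * x.1 s
  iseqv :=
    { refl := fun x => ⟨1, fun s => by simp⟩
      symm := by
        rintro x y ⟨t, ht⟩
        exact ⟨t⁻¹, fun s => by simp [ht s]⟩
      trans := by
        rintro x y z ⟨t, ht⟩ ⟨t2, ht2⟩
        exact ⟨t2 * t, fun s => by simp [ht s, ht2 s, mul_assoc]⟩ }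

/-- The points of the variety. -/
def Points (V : Variety) : Type := Quotient V.setoid

/-- Some vector of homogeneous coordinates of a point. -/
def Points.coords {V : Variety} (y : V.Points) : V.Coord → ℂ := (Quotient.out y : V.cone).1

/-- `F` is multihomogeneous of degree `d`. -/
def IsHomog (V : Variety) (F : MvPolynomial V.Coord ℂ) (d : V.Deg) : Prop :=
  IsWeightedHomogeneous V.deg F d

/-- The Zariski topology: the non-vanishing loci of multihomogeneous polynomials in the
coordinates are a basis. -/
instance zariski (V : Variety) : TopologicalSpace V.Points :=
  TopologicalSpace.generateFrom
    {U | ∃ (F : MvPolynomial V.Coord ℂ) (d : V.Deg), V.IsHomog F d ∧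
      U = {y : V.Points | eval y.coords F ≠ 0}}

/-- Zariski closure in `V` of a set of points, given by their coordinate vectors. -/
def zcl (V : Variety) (W : Set (V.Coord → ℂ)) : Set (V.Coord → ℂ) :=
  {x | x ∈ V.cone ∧ ∀ F : MvPolynomial V.Coord ℂ, (∀ w ∈ W, eval w F = 0) → eval x F = 0}

/-- The nonzero multihomogeneous polynomials that vanish on `Z`; they generate the
homogeneous ideal of `Z`. -/
def Eqn (V : Variety) (Z : Set (V.Coord → ℂ)) : Type :=
  {F : MvPolynomial V.Coord ℂ // F ≠ 0 ∧ (∃ d, V.IsHomog F d) ∧ ∀ z ∈ Z, eval z F = 0}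

/-- The blow-up of `V` along (the reduced subvariety) `Z`, that is `Proj` of the Rees algebra
`⊕ Iⁿ Tⁿ` of the ideal `I` of `Z`. There is one new coordinate `F·T` for each multihomogeneous
`F ∈ I`, of degree `(deg F, 1)`; the coordinate vectors are the pairs `(x, y)` with `x` in the
cone of `V`, with `y ≠ 0`, and in the closure of the graph
`{(x, (c·F(x))_F) | x ∈ V \ Z, c ∈ ℂ}`. -/
def blowup (V : Variety) (Z : Set (V.Coord → ℂ)) : Variety where
  Coord := V.Coord ⊕ V.Eqn Z
  Deg := V.Deg × ℤ
  deg := Sum.elim (fun s => (V.deg s, 0)) (fun F => (F.2.2.1.choose, 1))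
  cone := {z | (fun s => z (Sum.inl s)) ∈ V.cone ∧ (∃ F, z (Sum.inr F) ≠ 0) ∧
    ∀ P : MvPolynomial (V.Coord ⊕ V.Eqn Z) ℂ,
      (∀ x ∈ V.cone, x ∉ Z → ∀ c : ℂ,
        eval (Sum.elim x (fun F : V.Eqn Z => c * eval x F.1)) P = 0) → eval z P = 0}
  base := fun k => Sum.inl (V.base k)

/-- The strict transform in the blow-up along `Z` of a subvariety `W`: the closure of the inverse
image of `W \ Z`. -/
def strict (V : Variety) (Z W : Set (V.Coord → ℂ)) : Set ((V.blowup Z).Coord → ℂ) :=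
  (V.blowup Z).zcl
    {z | z ∈ (V.blowup Z).cone ∧ (fun s => z (Sum.inl s)) ∈ W ∧ (fun s => z (Sum.inl s)) ∉ Z}

/-! ### The rational map to `ℙ⁴⁴` -/

section
variable (V : Variety)

/-- The equation `h` of the plane. -/
def planeOf (z : V.Coord → ℂ) : S := lin fun i => z (V.base (.plane i))

/-- The quadric `g`. -/
def quadricOf (z : V.Coord → ℂ) : S :=
  ∑ m ∈ Finset.finsuppAntidiag (Finset.univ : Finset (Fin 4)) 2,
    monomial m (z (V.base (.quadric m)))

/-- The cubic `f`. -/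
def cubicOf (z : V.Coord → ℂ) : S :=
  ∑ m ∈ Finset.finsuppAntidiag (Finset.univ : Finset (Fin 4)) 3,
    monomial m (z (V.base (.cubic m)))

/-- The flag `p ∈ ℓ ⊂ π`, as subspaces of dimension 1, 2, 3 of `ℂ⁴`. -/
def flagOf (z : V.Coord → ℂ) :
    Submodule ℂ (Fin 4 → ℂ) × Submodule ℂ (Fin 4 → ℂ) × Submodule ℂ (Fin 4 → ℂ) :=
  (Submodule.span ℂ {fun i => z (V.base (.point i))},
    LinearMap.ker (Matrix.mulVecLin (Matrix.of fun i j => z (V.base (.line i j)))),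
    LinearMap.ker (Matrix.mulVecLin (Matrix.of fun (_ : Unit) i => z (V.base (.plane i)))))

/-- The value at `z` of a 1-form whose coefficients are polynomials in the coordinates. -/
def formAt (P : Fin 4 → MvPolynomial (Fin 4) (MvPolynomial V.Coord ℂ)) (z : V.Coord → ℂ) :
    Fin 4 → S :=
  fun i => MvPolynomial.map (eval z) (P i)

/-- The rational map `(flag, g, g', f) ↦ (3 f dg - 2 g df) / h` from `V` to `ℙ⁴⁴` is regular at
the point with coordinates `x`, with value `ω`: it is given by a 1-form `P` whose coefficients are
multihomogeneous of one and the same degree in the coordinates, which is proportional to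
`(3 f dg - 2 g df) / h` where the latter is not zero, and `P(x) ≠ 0` spans `ω`. -/
def IsValue (x : V.Coord → ℂ) (ω : P44) : Prop :=
  ∃ (P : Fin 4 → MvPolynomial (Fin 4) (MvPolynomial V.Coord ℂ)) (d : V.Deg),
    (∀ i m, V.IsHomog (coeff m (P i)) d) ∧
    (∀ z ∈ V.cone, pairForm (V.quadricOf z) (V.cubicOf z) ≠ 0 →
      ∃ c : ℂ, ∀ i, V.planeOf z * V.formAt P z i
        = C c * pairForm (V.quadricOf z) (V.cubicOf z) i) ∧
    ∃ c : ℂ, c ≠ 0 ∧ V.formAt P x = c • (ω.rep : Fin 4 → S)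

/-- The indeterminacy locus of the rational map to `ℙ⁴⁴`. -/
def indet : Set (V.Coord → ℂ) := {x | x ∈ V.cone ∧ ¬ ∃ ω, V.IsValue x ω}

/-- The maximal regular extension of the rational map `(flag, g, g', f) ↦ (3 f dg - 2 g df) / h`
to `V`, defined at the points where this map is regular. -/
def toP44 : V.Points →. P44 := fun y => ⟨∃ ω, V.IsValue y.coords ω, fun h => h.choose⟩

end

end Variety

/-! ### The parameter space `𝕐` and its four blow-ups -/

/-- A flag `p ∈ ℓ ⊂ π` with `π = {a = 0}`, `ℓ = {a = b = 0}`, `p = {a = b = c = 0} = [q]`, a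
class `g' = u₀ ab + u₁ ac + u₂ b²` of special quadrics modulo `a²`, a quadric
`g = s₀ a² + s₁ g'`, and a special cubic `f = a² m + t (3u₀ ab² + 3u₁ abc + 2u₂ b³)`. -/
structure YDatum : Type where
  (a b c q : Fin 4 → ℂ)
  u : Fin 3 → ℂ
  s : Fin 2 → ℂ
  m : Fin 4 → ℂ
  t : ℂ
  indep : LinearIndependent ℂ ![a, b, c]
  q_ne : q ≠ 0
  q_mem : a ⬝ᵥ q = 0 ∧ b ⬝ᵥ q = 0 ∧ c ⬝ᵥ q = 0
  u_ne : u ≠ 0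
  s_ne : s ≠ 0
  mt_ne : m ≠ 0 ∨ t ≠ 0

namespace YDatum

variable (D : YDatum)

def g' : S :=
  C (D.u 0) * lin D.a * lin D.b + C (D.u 1) * lin D.a * lin D.c + C (D.u 2) * lin D.b ^ 2

def g : S := C (D.s 0) * lin D.a ^ 2 + C (D.s 1) * D.g'

def f : S :=
  lin D.a ^ 2 * lin D.m + C D.t * (C (3 * D.u 0) * lin D.a * lin D.b ^ 2
    + C (3 * D.u 1) * lin D.a * lin D.b * lin D.c + C (2 * D.u 2) * lin D.b ^ 3)

/-- The homogeneous coordinates of the corresponding point of `𝕐`. -/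
def vec : YCoord → ℂ
  | .plane i => D.a i
  | .line i j => D.a i * D.b j - D.a j * D.b i
  | .point i => D.q i
  | .quadric m => coeff m D.g
  | .pencil m n => coeff m (lin D.a ^ 2) * coeff n D.g' - coeff n (lin D.a ^ 2) * coeff m D.g'
  | .cubic m => coeff m D.f

end YDatum

/-- `𝕐`: the `ℙ⁴`-bundle of special cubics over the blow-up `𝕏'` of the bundle `𝕏` of special
quadrics along the section `g = h²`, over the variety of complete flags. -/
def Y : Variety where
  Coord := YCoord
  Deg := Fin 6 → ℤ
  deg := YCoord.deg
  cone := Set.range YDatum.vec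
  base := id

/-- The first centre: `f = l³`, `g = l²`, `g' = b (2αa + βb)` for `l = αa + βb` vanishing
on `ℓ`. -/
def centreC : Set (Y.Coord → ℂ) :=
  {x | ∃ D : YDatum, x = D.vec ∧ ∃ α β r k : ℂ,
    D.g' = lin D.b * (C (2 * α) * lin D.a + C β * lin D.b) ∧
    D.g = C r * (C α * lin D.a + C β * lin D.b) ^ 2 ∧
    D.f = C k * (C α * lin D.a + C β * lin D.b) ^ 3}

/-- The component `g = h²`, `f = h³`, with `g'` arbitrary, of the indeterminacy locus of `𝕐`. -/
def centreE : Set (Y.Coord → ℂ) :=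
  {x | ∃ D : YDatum, x = D.vec ∧ ∃ r k : ℂ,
    D.g = C r * lin D.a ^ 2 ∧ D.f = C k * lin D.a ^ 3}

/-- The blow-up of `𝕐` along `C`. -/
def Y1 : Variety := Y.blowup centreC

/-- The strict transform of `E`. -/
def centreE1 : Set (Y1.Coord → ℂ) := Y.strict centreC centreE

/-- The ruled surface bundle `R`: the other component of the indeterminacy locus of `𝕐₁`. -/
def centreR1 : Set (Y1.Coord → ℂ) := Y1.zcl (Y1.indet \ centreE1)

/-- The blow-up of `𝕐₁` along the strict transform of `E`. -/
def Y2 : Variety := Y1.blowup centreE1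

/-- The strict transform of `R`. -/
def centreR2 : Set (Y2.Coord → ℂ) := Y1.strict centreE1 centreR1

/-- The blow-up of `𝕐₂` along the strict transform of `R`. -/
def Y3 : Variety := Y2.blowup centreR2

/-- The last centre `L`: the indeterminacy locus that remains on `𝕐₃`. -/
def centreL : Set (Y3.Coord → ℂ) := Y3.indet

/-- The blow-up of `𝕐₃` along `L`. -/
def Y4 : Variety := Y3.blowup centreL

/-- The map `Φ : 𝕐₄ → E(3) ⊂ ℙ⁴⁴`. -/
def Phi : Y4.Points →. P44 := Y4.toP44

/-! ### Coordinates adapted to a flag -/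

/-- The coordinates `x₀, …, x₃` given by the rows of an invertible matrix. -/
def frame (A : GL (Fin 4) ℂ) (i : Fin 4) : S := lin (A.1 i)

/-- The flag `{x₀ = x₁ = x₂ = 0} ∈ {x₀ = x₁ = 0} ⊂ {x₀ = 0}`. -/
def frameFlag (A : GL (Fin 4) ℂ) :
    Submodule ℂ (Fin 4 → ℂ) × Submodule ℂ (Fin 4 → ℂ) × Submodule ℂ (Fin 4 → ℂ) :=
  (LinearMap.ker (Matrix.mulVecLin (Matrix.of ![A.1 0, A.1 1, A.1 2])),
    LinearMap.ker (Matrix.mulVecLin (Matrix.of ![A.1 0, A.1 1])),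
    LinearMap.ker (Matrix.mulVecLin (Matrix.of ![A.1 0])))

/-- The coefficient of `dx_k` when the 1-form `η` is written in the basis `dx₀, …, dx₃`. -/
def dCoeff (A : GL (Fin 4) ℂ) (k : Fin 4) (η : Fin 4 → S) : S :=
  ∑ j, C ((A⁻¹).1 j k) * η j

/-- `g = b₀x₀² + b₁x₀x₁ + x₀x₂ + b₃x₁²`. -/
def chartQuadric (A : GL (Fin 4) ℂ) (b0 b1 b3 : ℂ) : S :=
  C b0 * frame A 0 ^ 2 + C b1 * frame A 0 * frame A 1 + frame A 0 * frame A 2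
    + C b3 * frame A 1 ^ 2

/-- `f = (a₀x₀ + a₁x₁ + a₂x₂ + a₃x₃)x₀² + a₅(b₁x₀x₁² + x₀x₁x₂ + (2/3)b₃x₁³)`. -/
def chartCubic (A : GL (Fin 4) ℂ) (b1 b3 a0 a1 a2 a3 a5 : ℂ) : S :=
  (C a0 * frame A 0 + C a1 * frame A 1 + C a2 * frame A 2 + C a3 * frame A 3) * frame A 0 ^ 2
    + C a5 * (C b1 * frame A 0 * frame A 1 ^ 2 + frame A 0 * frame A 1 * frame A 2
      + C (2 / 3 * b3) * frame A 1 ^ 3)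

/-- `η = (2 g df - 3 f dg) / x₀` for the quadric `g` and the cubic `f` above. -/
def IsChartForm (A : GL (Fin 4) ℂ) (b0 b1 b3 a0 a1 a2 a3 a5 : ℂ) (η : Fin 4 → S) : Prop :=
  ∀ j, frame A 0 * η j =
    - pairForm (chartQuadric A b0 b1 b3) (chartCubic A b1 b3 a0 a1 a2 a3 a5) j

/-- The point `y` of `𝕐₄` lies over the flag, the quadric `g` and the cubic `f` above. -/
def LiesOver (A : GL (Fin 4) ℂ) (b0 b1 b3 a0 a1 a2 a3 a5 : ℂ) (y : Y4.Points) : Prop :=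
  Y4.flagOf y.coords = frameFlag A ∧
  (∃ r : ℂ, Y4.quadricOf y.coords = C r * chartQuadric A b0 b1 b3) ∧
  (∃ r : ℂ, Y4.cubicOf y.coords = C r * chartCubic A b1 b3 a0 a1 a2 a3 a5)

/-- In the coordinates given by `A`: the union of the conic `x₀ = x₂² - 2x₁x₃ = 0`, of the line
`x₀ = x₁ = 0` and of the twisted cubic
`2x₂² - 3x₁x₃ = x₁x₂ - 3x₀x₃ = x₁² - 2x₀x₂ = 0`. -/
def threeCurves (A : GL (Fin 4) ℂ) : Set (Projectivization ℂ (Fin 4 → ℂ)) :=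
  {v | let x : Fin 4 → ℂ := A.1.mulVec v.rep
    (x 0 = 0 ∧ x 2 ^ 2 - 2 * x 1 * x 3 = 0) ∨ (x 0 = 0 ∧ x 1 = 0) ∨
    (2 * x 2 ^ 2 - 3 * x 1 * x 3 = 0 ∧ x 1 * x 2 - 3 * x 0 * x 3 = 0 ∧
      x 1 ^ 2 - 2 * x 0 * x 2 = 0)}

end ExceptionalFoliation

end

noncomputable section

namespace ExceptionalFoliation

/-! ### Linear substitutions -/

/-! None of the later centres has to be computed. On the part of 𝕐 where 3f dg − 2g df ≠ 0 the
rational map is already regular, and every centre avoids the points over this part. The blow-ups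
therefore change nothing there, and it remains to show that all points over the orbit lie over this
part and are determined by their value.

`IsTower` records what survives each blow-up: degrees pull back from 𝕐, generic points (those whose
form lies in the orbit) are Zariski dense, and over a point with nonzero pair form there is exactly
one point modulo the torus. It passes to a blow-up (`IsTower.blowup`) once every point with nonzero
pair form has an equation of the centre that does not vanish there. `exists_equation` supplies one:
a coefficient of `valuePoly`, a polynomial version of the quotient by the plane, which vanishes
wherever the pair form does and on the image of every indeterminacy locus.

Density turns identities on generic points into identities on the whole tower. In this way values
are unique and lie in the closure of the orbit, and the preimage of the orbit is dense. Openness of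
that preimage uses that the orbit is open in its closure, which follows from Chevalley's theorem
(`exists_open_subset_image`) and translation by the group.

For injectivity (`normal_of_value`), the contraction of the form with the point p of the flag is
proportional to h·g, an identity that extends by density to points where the pair form might vanish.
When the value is ω₀ in a frame A, the contraction polynomial forces p, then h and g, then ℓ. The
relation with 3f dg − 2g df and the coefficient of dx₂ then give f. So the point of 𝕐 is known, its
pair form is nonzero, and the fibre is a single point.

For the singular locus, a linear map preserving the three curves must preserve the plane of the
conic and send the parametrized twisted cubic into its cone. Comparing degrees in the parameter
shows that the map is triangular (`triangular_of_inCurves`), hence preserves the flag. -/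

lemma eval_lin (a v : Fin 4 → ℂ) : eval v (lin a) = a ⬝ᵥ v := by
  simp [lin, dotProduct]

lemma pderiv_lin (a : Fin 4 → ℂ) (i : Fin 4) : pderiv i (lin a) = C (a i) := by
  simp [lin, pderiv_X, Pi.single_apply]

lemma lin_isHomogeneous (a : Fin 4 → ℂ) : (lin a).IsHomogeneous 1 :=
  IsHomogeneous.sum _ _ _ fun _ _ => isHomogeneous_C_mul_X _ _

lemma lin_injective : Function.Injective lin := by
  intro a b h
  funext i
  have := congrArg (pderiv i) h
  simpa [pderiv_lin] using this

lemma lin_ne_zero {a : Fin 4 → ℂ} (ha : a ≠ 0) : lin a ≠ 0 := fun h =>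
  ha (lin_injective (h.trans (by simp [lin])))

/-- The substitution `Xᵢ ↦ ∑ⱼ Aᵢⱼ Xⱼ`. -/
def sub (A : Matrix (Fin 4) (Fin 4) ℂ) : S →ₐ[ℂ] S := aeval fun k => lin (A k)

@[simp] lemma sub_X (A : Matrix (Fin 4) (Fin 4) ℂ) (i : Fin 4) : sub A (X i) = lin (A i) := by
  simp [sub]

@[simp] lemma sub_C (A : Matrix (Fin 4) (Fin 4) ℂ) (c : ℂ) : sub A (C c) = C c := by
  simp [sub, algebraMap_eq]

lemma eval_sub (A : Matrix (Fin 4) (Fin 4) ℂ) (v : Fin 4 → ℂ) (p : S) :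
    eval v (sub A p) = eval (A.mulVec v) p := by
  induction p using MvPolynomial.induction_on with
  | C c => simp
  | add p q hp hq => simp [hp, hq]
  | mul_X p i hp => simp [hp, eval_lin, Matrix.mulVec]

lemma sub_sub (A B : Matrix (Fin 4) (Fin 4) ℂ) (p : S) : sub A (sub B p) = sub (B * A) p := by
  apply MvPolynomial.funext
  intro v
  simp [eval_sub, Matrix.mulVec_mulVec]

lemma sub_one (p : S) : sub 1 p = p := by
  apply MvPolynomial.funext
  intro v
  simp [eval_sub]

lemma sub_injective (A : GL (Fin 4) ℂ) : Function.Injective (sub A.1) := by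
  intro p q h
  have h2 := congrArg (sub (A⁻¹).1) h
  have hA : (A.1 * (A⁻¹).1 : Matrix (Fin 4) (Fin 4) ℂ) = 1 := A.mul_inv
  rwa [sub_sub, sub_sub, hA, sub_one, sub_one] at h2

lemma sub_isHomogeneous (A : Matrix (Fin 4) (Fin 4) ℂ) {p : S} {n : ℕ} (hp : p.IsHomogeneous n) :
    (sub A p).IsHomogeneous n := by
  have h := hp.aeval (fun k => lin (A k)) (fun k => lin_isHomogeneous (A k))
  rwa [one_mul] at h

lemma pderiv_sub (A : Matrix (Fin 4) (Fin 4) ℂ) (j : Fin 4) (p : S) :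
    pderiv j (sub A p) = ∑ i, C (A i j) * sub A (pderiv i p) := by
  induction p using MvPolynomial.induction_on with
  | C c => simp
  | add p q hp hq => simp [hp, hq, mul_add, Finset.sum_add_distrib]
  | mul_X p i hp =>
    simp only [map_mul, sub_X, pderiv_mul, hp, pderiv_lin, map_add, mul_add, Finset.sum_add_distrib,
      Finset.sum_mul, pderiv_X, Pi.single_apply]
    congr 1
    · exact Finset.sum_congr rfl fun k _ => by ring
    · rw [Finset.sum_eq_single i]
      · simp; ring
      · intro k _ hk
        simp [Ne.symm hk]
      · simp

lemma pullback_apply (A : GL (Fin 4) ℂ) (ω : Fin 4 → S) (j : Fin 4) :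
    pullback A ω j = ∑ i, C (A.1 i j) * sub A.1 (ω i) := rfl

lemma pullback_pullback (A B : GL (Fin 4) ℂ) (ω : Fin 4 → S) :
    pullback A (pullback B ω) = pullback (B * A) ω := by
  funext j
  simp only [pullback_apply, map_sum, map_mul, sub_sub, sub_C, Finset.mul_sum, Units.val_mul,
    Matrix.mul_apply, Finset.sum_mul]
  rw [Finset.sum_comm]
  exact Finset.sum_congr rfl fun i _ => Finset.sum_congr rfl fun k _ => by ring

lemma pullback_one (ω : Fin 4 → S) : pullback 1 ω = ω := by
  funext j
  simp [pullback_apply, sub_one, Matrix.one_apply]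

lemma pullback_smul (A : GL (Fin 4) ℂ) (c : ℂ) (ω : Fin 4 → S) :
    pullback A (c • ω) = c • pullback A ω := by
  funext j
  simp [pullback_apply, Finset.smul_sum]

lemma pullback_mul (A : GL (Fin 4) ℂ) (p : S) (ω : Fin 4 → S) :
    pullback A (fun i => p * ω i) = fun j => sub A.1 p * pullback A ω j := by
  funext j
  simp only [pullback_apply, map_mul, Finset.mul_sum]
  exact Finset.sum_congr rfl fun i _ => by ring

lemma pullback_injective (A : GL (Fin 4) ℂ) : Function.Injective (pullback A) := by
  intro ω η h
  have h2 := congrArg (pullback A⁻¹) h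
  simpa [pullback_pullback, pullback_one] using h2

lemma pullback_zero (A : GL (Fin 4) ℂ) : pullback A 0 = 0 := by
  funext j; simp [pullback_apply]

lemma pairForm_sub (A : GL (Fin 4) ℂ) (g f : S) :
    pairForm (sub A.1 g) (sub A.1 f) = pullback A (pairForm g f) := by
  funext j
  simp only [pairForm, pderiv_sub, pullback_apply, Finset.mul_sum, ← Finset.sum_sub_distrib]
  refine Finset.sum_congr rfl fun i _ => ?_
  simp only [map_sub, map_mul, map_ofNat]
  ring

lemma pullback_mem_Omega14 (A : GL (Fin 4) ℂ) {ω : Fin 4 → S} (hω : ω ∈ Omega14) :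
    pullback A ω ∈ Omega14 := by
  refine ⟨fun j => ?_, ?_⟩
  · refine IsHomogeneous.sum _ _ _ fun i _ => ?_
    exact (sub_isHomogeneous A.1 (hω.1 i)).C_mul _
  · have h := congrArg (sub A.1) hω.2
    simp only [map_sum, map_mul, sub_X, map_zero] at h
    rw [← h]
    simp only [pullback_apply, Finset.mul_sum, lin, Finset.sum_mul]
    rw [Finset.sum_comm]
    exact Finset.sum_congr rfl fun i _ => Finset.sum_congr rfl fun k _ => by ring

/-- Recovering the coefficients in the frame `A` of a pulled back form. -/
lemma dCoeff_pullback (A : GL (Fin 4) ℂ) (ω : Fin 4 → S) (k : Fin 4) :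
    dCoeff A k (pullback A ω) = sub A.1 (ω k) := by
  have hA : (A.1 * (A⁻¹).1 : Matrix (Fin 4) (Fin 4) ℂ) = 1 := A.mul_inv
  simp only [dCoeff, pullback_apply, Finset.mul_sum]
  rw [Finset.sum_comm]
  have : ∀ i, ∑ j, C ((A⁻¹).1 j k) * (C (A.1 i j) * sub A.1 (ω i))
      = C ((A.1 * (A⁻¹).1) i k) * sub A.1 (ω i) := by
    intro i
    rw [Matrix.mul_apply, map_sum, Finset.sum_mul]
    exact Finset.sum_congr rfl fun j _ => by rw [C_mul]; ring
  simp only [this, hA, Matrix.one_apply]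
  simp

lemma dCoeff_mul (A : GL (Fin 4) ℂ) (k : Fin 4) (p : S) (ω : Fin 4 → S) :
    dCoeff A k (fun j => p * ω j) = p * dCoeff A k ω := by
  simp only [dCoeff, Finset.mul_sum]
  exact Finset.sum_congr rfl fun i _ => by ring

lemma dCoeff_neg (A : GL (Fin 4) ℂ) (k : Fin 4) (ω : Fin 4 → S) :
    dCoeff A k (fun j => - ω j) = - dCoeff A k ω := by
  simp only [dCoeff, ← Finset.sum_neg_distrib, mul_neg]

lemma frame_eq_sub (A : GL (Fin 4) ℂ) (i : Fin 4) : frame A i = sub A.1 (X i) := by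
  simp [frame]

lemma frame_ne_zero (A : GL (Fin 4) ℂ) (i : Fin 4) : frame A i ≠ 0 := by
  rw [frame_eq_sub]
  intro h
  exact X_ne_zero i (sub_injective A (h.trans (map_zero _).symm))

/-! ### The form of a flag and a special pair -/

namespace YDatum

/-- The quotient `(3 f dg - 2 g df) / h`. -/
def form (D : YDatum) : Fin 4 → S := fun j =>
  3 * (lin D.a * lin D.m + C (3 * D.t) * lin D.b * (C (D.u 0) * lin D.b + C (D.u 1) * lin D.c))
      * pderiv j D.g
    + C (6 * D.t * D.u 2) * lin D.b ^ 3 * (C (D.s 0) * C (D.a j)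
      + C (D.s 1) * (C (D.u 0) * C (D.b j) + C (D.u 1) * C (D.c j)))
    - 2 * (C (D.s 0) * lin D.a + C (D.s 1) * (C (D.u 0) * lin D.b + C (D.u 1) * lin D.c))
      * pderiv j D.f
    - C (2 * D.s 1 * D.u 2) * lin D.b ^ 2 * (C (D.a j) * lin D.m + lin D.a * C (D.m j)
      + C (3 * D.t) * C (D.b j) * (C (D.u 0) * lin D.b + C (D.u 1) * lin D.c)
      + C (3 * D.t) * lin D.b * (C (D.u 0) * C (D.b j) + C (D.u 1) * C (D.c j)))
    + C (D.a j) * (C (6 * D.t * D.u 2 * D.s 0) * lin D.b ^ 3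
      - C (2 * D.s 1 * D.u 2) * lin D.b ^ 2 * lin D.m)

lemma pderiv_g (D : YDatum) (j : Fin 4) : pderiv j D.g =
    C (D.s 0) * (2 * lin D.a * C (D.a j)) + C (D.s 1) *
      (C (D.u 0) * (C (D.a j) * lin D.b + lin D.a * C (D.b j))
        + C (D.u 1) * (C (D.a j) * lin D.c + lin D.a * C (D.c j))
        + C (D.u 2) * (2 * lin D.b * C (D.b j))) := by
  simp only [g, g', map_add, pderiv_mul, pderiv_C, pderiv_lin, pderiv_pow]
  push_cast
  ring

lemma pderiv_f (D : YDatum) (j : Fin 4) : pderiv j D.f =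
    2 * lin D.a * C (D.a j) * lin D.m + lin D.a ^ 2 * C (D.m j) + C D.t *
      (C (3 * D.u 0) * (C (D.a j) * lin D.b ^ 2 + lin D.a * (2 * lin D.b * C (D.b j)))
        + C (3 * D.u 1) * (C (D.a j) * lin D.b * lin D.c + lin D.a * C (D.b j) * lin D.c
          + lin D.a * lin D.b * C (D.c j))
        + C (2 * D.u 2) * (3 * lin D.b ^ 2 * C (D.b j))) := by
  simp only [f, map_add, pderiv_mul, pderiv_C, pderiv_lin, pderiv_pow]
  push_cast
  ring

/-- Modulo the plane a, what is left of 3f dg − 2g df are multiples of b⁴ db and of b³(u₀b + u₁c)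
da. Both cancel because of the weights 3, 3, 2 in the special cubic; this is what makes the division
possible. -/
lemma lin_mul_form (D : YDatum) (j : Fin 4) : lin D.a * D.form j = pairForm D.g D.f j := by
  simp only [pairForm, form, pderiv_g, pderiv_f]
  simp only [g, g', f, C_mul, map_ofNat]
  ring

lemma g_isHomogeneous (D : YDatum) : D.g.IsHomogeneous 2 := by
  have h := lin_isHomogeneous
  have hg' : D.g'.IsHomogeneous 2 :=
    ((((h _).C_mul _).mul (h _)).add (((h _).C_mul _).mul (h _))).add (((h _).pow 2).C_mul _)
  exact (((h _).pow 2).C_mul _).add (hg'.C_mul _)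

lemma f_isHomogeneous (D : YDatum) : D.f.IsHomogeneous 3 := by
  have h := lin_isHomogeneous
  exact (((h _).pow 2).mul (h _)).add ((((((h _).C_mul _).mul ((h _).pow 2)).add
    ((((h _).C_mul _).mul (h _)).mul (h _))).add (((h _).pow 3).C_mul _)).C_mul _)

lemma a_ne (D : YDatum) : D.a ≠ 0 := by simpa using D.indep.ne_zero 0

end YDatum

/-- Multiplication by a linear form shifts homogeneous components by one and is injective, so every
component of p outside degree n is zero. -/
lemma isHomogeneous_of_lin_mul {a : Fin 4 → ℂ} (ha : a ≠ 0) {p : S} {n : ℕ}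
    (h : (lin a * p).IsHomogeneous (n + 1)) : p.IsHomogeneous n := by
  have hdeg : ∀ k, k ≠ n → homogeneousComponent k p = 0 := by
    intro k hk
    have key : homogeneousComponent (k + 1) (lin a * p) = lin a * homogeneousComponent k p := by
      conv_lhs => rw [← sum_homogeneousComponent p, Finset.mul_sum, map_sum]
      have : ∀ i, homogeneousComponent (k + 1) (lin a * homogeneousComponent i p)
          = if i = k then lin a * homogeneousComponent k p else 0 := by
        intro i
        have hm : lin a * homogeneousComponent i p ∈ homogeneousSubmodule (Fin 4) ℂ (i + 1) := by
          rw [mem_homogeneousSubmodule, add_comm]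
          exact (lin_isHomogeneous a).mul (homogeneousComponent_isHomogeneous _ _)
        rw [homogeneousComponent_of_mem hm]
        by_cases hik : i = k
        · subst hik; simp
        · rw [if_neg hik, if_neg (by omega)]
      simp only [this, Finset.sum_ite_eq', Finset.mem_range]
      split_ifs with hlt
      · rfl
      · rw [homogeneousComponent_eq_zero k p (by omega), mul_zero]
    rw [homogeneousComponent_of_mem (n := n + 1) h, if_neg (by omega)] at key
    exact (mul_eq_zero.1 key.symm).resolve_left (lin_ne_zero ha)
  rw [← sum_homogeneousComponent p]
  refine IsHomogeneous.sum _ _ _ fun i _ => ?_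
  by_cases hi : i = n
  · subst hi; exact homogeneousComponent_isHomogeneous _ _
  · rw [hdeg i hi]; exact isHomogeneous_zero _ _ _

lemma pderiv_isHomogeneous {p : S} {n : ℕ} (hp : p.IsHomogeneous (n + 1)) (i : Fin 4) :
    (pderiv i p).IsHomogeneous n := by
  simpa using hp.pderiv (i := i)

/-- By Euler's formula the contraction of 3f dg − 2g df with the radial field is 3f·2g − 2g·3f = 0;
the weights 3 and 2 are the degrees of f and g. -/
lemma mem_Omega14_of_lin_mul {a : Fin 4 → ℂ} (ha : a ≠ 0) {g f : S} {η : Fin 4 → S}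
    (hg : g.IsHomogeneous 2) (hf : f.IsHomogeneous 3) (k : ℂ)
    (h : ∀ j, lin a * η j = C k * pairForm g f j) : η ∈ Omega14 := by
  refine ⟨fun j => isHomogeneous_of_lin_mul ha ?_, ?_⟩
  · rw [h j]
    have h1 : ((3 : S) * f * pderiv j g).IsHomogeneous 4 := by
      have := (hf.C_mul 3).mul (pderiv_isHomogeneous hg j)
      rwa [map_ofNat] at this
    have h2 : ((2 : S) * g * pderiv j f).IsHomogeneous 4 := by
      have := (hg.C_mul 2).mul (pderiv_isHomogeneous hf j)
      rwa [map_ofNat] at this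
    exact (h1.sub h2).C_mul k
  · apply mul_left_cancel₀ (lin_ne_zero ha)
    have h1 := hg.sum_X_mul_pderiv
    have h2 := hf.sum_X_mul_pderiv
    have : lin a * ∑ i, X i * η i = C k * (3 * f * (∑ i, X i * pderiv i g)
        - 2 * g * ∑ i, X i * pderiv i f) := by
      simp only [Finset.mul_sum, ← Finset.sum_sub_distrib]
      refine Finset.sum_congr rfl fun i _ => ?_
      rw [mul_left_comm, h i, pairForm]; ring
    rw [this, h1, h2]
    simp only [nsmul_eq_mul]
    push_cast
    ring

lemma YDatum.form_mem (D : YDatum) : D.form ∈ Omega14 :=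
  mem_Omega14_of_lin_mul D.a_ne D.g_isHomogeneous D.f_isHomogeneous 1
    fun j => by rw [D.lin_mul_form]; simp

/-! ### Frames and flags -/

/-- The basis of `ℂ⁴` dual to the rows of `A`. -/
def dualVec (A : GL (Fin 4) ℂ) (k : Fin 4) : Fin 4 → ℂ := fun j => (A⁻¹).1 j k

lemma row_dotProduct_dualVec (A : GL (Fin 4) ℂ) (i k : Fin 4) :
    A.1 i ⬝ᵥ dualVec A k = if i = k then 1 else 0 := by
  have hA : (A.1 * (A⁻¹).1 : Matrix (Fin 4) (Fin 4) ℂ) = 1 := A.mul_inv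
  have := congrFun (congrFun hA i) k
  rw [Matrix.mul_apply, Matrix.one_apply] at this
  exact this

lemma eq_sum_rows (A : GL (Fin 4) ℂ) (x : Fin 4 → ℂ) : x = ∑ k, (x ⬝ᵥ dualVec A k) • A.1 k := by
  have hA : ((A⁻¹).1 * A.1 : Matrix (Fin 4) (Fin 4) ℂ) = 1 := A.inv_mul
  have h : x = Matrix.vecMul (Matrix.vecMul x (A⁻¹).1) A.1 := by
    rw [Matrix.vecMul_vecMul, hA, Matrix.vecMul_one]
  conv_lhs => rw [h]
  funext j
  simp only [Finset.sum_apply, Pi.smul_apply, smul_eq_mul]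
  rfl

lemma eq_sum_dualVec (A : GL (Fin 4) ℂ) (v : Fin 4 → ℂ) :
    v = ∑ k, (A.1 k ⬝ᵥ v) • dualVec A k := by
  have hA : ((A⁻¹).1 * A.1 : Matrix (Fin 4) (Fin 4) ℂ) = 1 := A.inv_mul
  have h : v = (A⁻¹).1.mulVec (A.1.mulVec v) := by
    rw [Matrix.mulVec_mulVec, hA, Matrix.one_mulVec]
  conv_lhs => rw [h]
  funext j
  simp only [Finset.sum_apply, Pi.smul_apply, smul_eq_mul, Matrix.mulVec, dotProduct, dualVec]
  exact Finset.sum_congr rfl fun i _ => mul_comm _ _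

lemma row_ne_zero (A : GL (Fin 4) ℂ) (i : Fin 4) : A.1 i ≠ 0 := by
  intro h
  have := row_dotProduct_dualVec A i i
  simp [h] at this

lemma dualVec_ne_zero (A : GL (Fin 4) ℂ) (i : Fin 4) : dualVec A i ≠ 0 := by
  intro h
  have := row_dotProduct_dualVec A i i
  simp [h] at this

lemma exists_mulVec_eq (A : GL (Fin 4) ℂ) (w : Fin 4 → ℂ) : ∃ v, A.1.mulVec v = w := by
  have hA : (A.1 * (A⁻¹).1 : Matrix (Fin 4) (Fin 4) ℂ) = 1 := A.mul_inv
  exact ⟨(A⁻¹).1.mulVec w, by rw [Matrix.mulVec_mulVec, hA, Matrix.one_mulVec]⟩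

lemma exists_GL_of_linearIndependent {a b c d : Fin 4 → ℂ}
    (h : LinearIndependent ℂ ![a, b, c, d]) : ∃ A : GL (Fin 4) ℂ, A.1 = Matrix.of ![a, b, c, d] := by
  have : IsUnit (Matrix.of ![a, b, c, d]) := Matrix.linearIndependent_rows_iff_isUnit.1 h
  exact ⟨this.unit, rfl⟩

lemma linearIndependent_rows (A : GL (Fin 4) ℂ) : LinearIndependent ℂ A.1 :=
  Matrix.linearIndependent_rows_iff_isUnit.2 A.isUnit

lemma YDatum.exists_frame (D : YDatum) :
    ∃ (A : GL (Fin 4) ℂ) (d : Fin 4 → ℂ), A.1 = Matrix.of ![D.a, D.b, D.c, d] := by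
  obtain ⟨d, hd⟩ := exists_linearIndependent_snoc_of_lt_finrank D.indep (by simp)
  have : Fin.snoc (α := fun _ => Fin 4 → ℂ) ![D.a, D.b, D.c] d = ![D.a, D.b, D.c, d] := by
    funext i
    fin_cases i <;> rfl
  rw [this] at hd
  obtain ⟨A, hA⟩ := exists_GL_of_linearIndependent hd
  exact ⟨A, d, hA⟩

/-! ### The polynomials encoded in the coordinates -/

lemma sum_monomial_coeff {p : S} {n : ℕ} (hp : p.IsHomogeneous n) :
    ∑ m ∈ Finset.finsuppAntidiag (Finset.univ : Finset (Fin 4)) n, monomial m (coeff m p) = p := by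
  classical
  ext k
  rw [coeff_sum]
  simp only [coeff_monomial, Finset.sum_ite_eq', Finset.mem_finsuppAntidiag, Finset.subset_univ,
    and_true]
  split_ifs with h
  · rfl
  · refine (hp.coeff_eq_zero ?_).symm
    rwa [Finsupp.degree_eq_sum]

lemma YDatum.planeOf_vec (D : YDatum) : Y.planeOf D.vec = lin D.a := rfl

lemma YDatum.quadricOf_vec (D : YDatum) : Y.quadricOf D.vec = D.g :=
  sum_monomial_coeff D.g_isHomogeneous

lemma YDatum.cubicOf_vec (D : YDatum) : Y.cubicOf D.vec = D.f :=
  sum_monomial_coeff D.f_isHomogeneous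

lemma YDatum.eval_g (D : YDatum) (v : Fin 4 → ℂ) : eval v D.g =
    D.s 0 * (D.a ⬝ᵥ v) ^ 2 + D.s 1 * (D.u 0 * (D.a ⬝ᵥ v) * (D.b ⬝ᵥ v)
      + D.u 1 * (D.a ⬝ᵥ v) * (D.c ⬝ᵥ v) + D.u 2 * (D.b ⬝ᵥ v) ^ 2) := by
  simp [YDatum.g, YDatum.g', eval_lin]

lemma YDatum.eval_f (D : YDatum) (v : Fin 4 → ℂ) : eval v D.f =
    (D.a ⬝ᵥ v) ^ 2 * (D.m ⬝ᵥ v) + D.t * (3 * D.u 0 * (D.a ⬝ᵥ v) * (D.b ⬝ᵥ v) ^ 2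
      + 3 * D.u 1 * (D.a ⬝ᵥ v) * (D.b ⬝ᵥ v) * (D.c ⬝ᵥ v) + 2 * D.u 2 * (D.b ⬝ᵥ v) ^ 3) := by
  simp [YDatum.f, eval_lin]

lemma YDatum.exists_eval (D : YDatum) (x y z : ℂ) :
    ∃ v, D.a ⬝ᵥ v = x ∧ D.b ⬝ᵥ v = y ∧ D.c ⬝ᵥ v = z := by
  obtain ⟨A, d, hA⟩ := D.exists_frame
  obtain ⟨v, hv⟩ := exists_mulVec_eq A ![x, y, z, 0]
  rw [hA] at hv
  exact ⟨v, congrFun hv 0, congrFun hv 1, congrFun hv 2⟩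

lemma YDatum.u_cases (D : YDatum) (h0 : D.u 0 = 0) (h1 : D.u 1 = 0) (h2 : D.u 2 = 0) : False :=
  D.u_ne (by funext i; fin_cases i <;> assumption)

lemma YDatum.s_cases (D : YDatum) (h0 : D.s 0 = 0) (h1 : D.s 1 = 0) : False :=
  D.s_ne (by funext i; fin_cases i <;> assumption)

lemma YDatum.g_ne_zero (D : YDatum) : D.g ≠ 0 := by
  intro hg
  have h : ∀ x y z : ℂ, D.s 0 * x ^ 2 + D.s 1 * (D.u 0 * x * y + D.u 1 * x * z + D.u 2 * y ^ 2)
      = 0 := by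
    intro x y z
    obtain ⟨v, rfl, rfl, rfl⟩ := D.exists_eval x y z
    rw [← D.eval_g, hg, map_zero]
  have h0 : D.s 0 = 0 := by simpa using h 1 0 0
  have hs : D.s 1 ≠ 0 := fun h1 => D.s_cases h0 h1
  have hu2 : D.u 2 = 0 := by simpa [h0, hs] using h 0 1 0
  have hu0 : D.u 0 = 0 := by simpa [h0, hs, hu2] using h 1 1 0
  have hu1 : D.u 1 = 0 := by simpa [h0, hs, hu2] using h 1 0 1
  exact D.u_cases hu0 hu1 hu2

lemma YDatum.f_ne_zero (D : YDatum) : D.f ≠ 0 := by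
  intro hf
  obtain ⟨A, d, hA⟩ := D.exists_frame
  obtain ⟨m, hm⟩ : ∃ m : Fin 4 → ℂ, D.m = m 0 • D.a + m 1 • D.b + m 2 • D.c + m 3 • d := by
    refine ⟨fun k => D.m ⬝ᵥ dualVec A k, ?_⟩
    conv_lhs => rw [eq_sum_rows A D.m]
    rw [Fin.sum_univ_four, hA]
    rfl
  have h : ∀ x y z w : ℂ, x ^ 2 * (m 0 * x + m 1 * y + m 2 * z + m 3 * w)
      + D.t * (3 * D.u 0 * x * y ^ 2 + 3 * D.u 1 * x * y * z + 2 * D.u 2 * y ^ 3) = 0 := by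
    intro x y z w
    obtain ⟨v, hv⟩ := exists_mulVec_eq A ![x, y, z, w]
    rw [hA] at hv
    have hx : D.a ⬝ᵥ v = x := congrFun hv 0
    have hy : D.b ⬝ᵥ v = y := congrFun hv 1
    have hz : D.c ⬝ᵥ v = z := congrFun hv 2
    have hw : d ⬝ᵥ v = w := congrFun hv 3
    have h := D.eval_f v
    rw [hf, map_zero, hm] at h
    simp only [add_dotProduct, smul_dotProduct, smul_eq_mul, hx, hy, hz, hw] at h
    exact h.symm
  have m0 : m 0 = 0 := by simpa using h 1 0 0 0
  have m2 : m 2 = 0 := by simpa [m0] using h 1 0 1 0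
  have m3 : m 3 = 0 := by simpa [m0] using h 1 0 0 1
  have e1 := h 0 1 0 0
  have e2 := h 1 1 0 0
  have e3 := h 1 (-1) 0 0
  have e4 := h 1 1 1 0
  rw [m0] at e2 e3 e4
  rw [m2] at e4
  have m1 : m 1 = 0 := by linear_combination (e2 - e3) / 2 - e1
  have t2 : D.t * D.u 2 = 0 := by linear_combination e1 / 2
  have t0 : D.t * D.u 0 = 0 := by linear_combination (e2 + e3) / 6
  have t1 : D.t * D.u 1 = 0 := by linear_combination (e4 - e2) / 3
  rcases D.mt_ne with h' | h'
  · exact h' (by rw [hm, m0, m1, m2, m3]; simp)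
  · exact D.u_cases ((mul_eq_zero.1 t0).resolve_left h') ((mul_eq_zero.1 t1).resolve_left h')
      ((mul_eq_zero.1 t2).resolve_left h')

/-! ### Flags -/

/-- The flag of `D` is the flag of the frame `A`, in coordinates. -/
structure YDatum.Adapted (D : YDatum) (A : GL (Fin 4) ℂ) : Prop where
  a_eq : ∃ l : ℂ, l ≠ 0 ∧ D.a = l • A.1 0
  b_eq : ∃ μ ν : ℂ, μ ≠ 0 ∧ D.b = μ • A.1 1 + ν • A.1 0
  q_eq : ∃ κ : ℂ, κ ≠ 0 ∧ D.q = κ • dualVec A 3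

/-- The Plücker matrix is abᵀ − baᵀ. For independent a and b its kernel is therefore the common zero
space of both forms, which is how `flagOf` reads off ℓ. -/
lemma lineMatrix_mulVec (a b v : Fin 4 → ℂ) :
    (Matrix.of fun i j => a i * b j - a j * b i).mulVec v
      = (b ⬝ᵥ v) • a - (a ⬝ᵥ v) • b := by
  funext i
  simp only [Matrix.mulVec, dotProduct, Matrix.of_apply, Pi.sub_apply, Pi.smul_apply, smul_eq_mul,
    Finset.sum_mul, ← Finset.sum_sub_distrib]
  exact Finset.sum_congr rfl fun j _ => by ring

lemma YDatum.not_parallel (D : YDatum) {x y : ℂ} (h : x • D.a + y • D.b = 0) : x = 0 ∧ y = 0 := by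
  have h3 := Fintype.linearIndependent_iff.1 D.indep ![x, y, 0]
    (by rw [Fin.sum_univ_three]; simpa using h)
  exact ⟨h3 0, h3 1⟩

lemma YDatum.mem_lineKer (D : YDatum) (v : Fin 4 → ℂ) :
    v ∈ (Y.flagOf D.vec).2.1 ↔ D.a ⬝ᵥ v = 0 ∧ D.b ⬝ᵥ v = 0 := by
  have : v ∈ (Y.flagOf D.vec).2.1 ↔ (Matrix.of fun i j => D.a i * D.b j - D.a j * D.b i).mulVec v
    = 0 := Iff.rfl
  rw [this, lineMatrix_mulVec]
  constructor
  · intro h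
    have := D.not_parallel (x := D.b ⬝ᵥ v) (y := - (D.a ⬝ᵥ v)) (by rw [neg_smul, ← sub_eq_add_neg, h])
    exact ⟨neg_eq_zero.1 this.2, this.1⟩
  · rintro ⟨h1, h2⟩
    simp [h1, h2]

lemma YDatum.mem_planeKer (D : YDatum) (v : Fin 4 → ℂ) :
    v ∈ (Y.flagOf D.vec).2.2 ↔ D.a ⬝ᵥ v = 0 := by
  have : v ∈ (Y.flagOf D.vec).2.2 ↔ (Matrix.of fun (_ : Unit) i => D.a i).mulVec v = 0 := Iff.rfl
  rw [this]
  constructor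
  · intro h; exact congrFun h ()
  · intro h; funext i; exact h

lemma YDatum.mem_point (D : YDatum) (v : Fin 4 → ℂ) :
    v ∈ (Y.flagOf D.vec).1 ↔ ∃ k : ℂ, k • D.q = v := by
  exact Submodule.mem_span_singleton

lemma mem_frameFlag_point (A : GL (Fin 4) ℂ) (v : Fin 4 → ℂ) :
    v ∈ (frameFlag A).1 ↔ A.1 0 ⬝ᵥ v = 0 ∧ A.1 1 ⬝ᵥ v = 0 ∧ A.1 2 ⬝ᵥ v = 0 := by
  have : v ∈ (frameFlag A).1 ↔ (Matrix.of ![A.1 0, A.1 1, A.1 2]).mulVec v = 0 := Iff.rfl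
  rw [this, funext_iff, Fin.forall_fin_succ, Fin.forall_fin_two]
  rfl

lemma mem_frameFlag_line (A : GL (Fin 4) ℂ) (v : Fin 4 → ℂ) :
    v ∈ (frameFlag A).2.1 ↔ A.1 0 ⬝ᵥ v = 0 ∧ A.1 1 ⬝ᵥ v = 0 := by
  have : v ∈ (frameFlag A).2.1 ↔ (Matrix.of ![A.1 0, A.1 1]).mulVec v = 0 := Iff.rfl
  rw [this, funext_iff, Fin.forall_fin_two]
  rfl

lemma mem_frameFlag_plane (A : GL (Fin 4) ℂ) (v : Fin 4 → ℂ) :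
    v ∈ (frameFlag A).2.2 ↔ A.1 0 ⬝ᵥ v = 0 := by
  have : v ∈ (frameFlag A).2.2 ↔ (Matrix.of ![A.1 0]).mulVec v = 0 := Iff.rfl
  rw [this, funext_iff, Fin.forall_fin_one]
  rfl

lemma YDatum.flagOf_eq_iff (D : YDatum) (A : GL (Fin 4) ℂ) :
    Y.flagOf D.vec = frameFlag A ↔ D.Adapted A := by
  constructor
  · intro h
    have h1 : ∀ v, v ∈ (Y.flagOf D.vec).1 ↔ v ∈ (frameFlag A).1 := fun v => by rw [h]
    have h2 : ∀ v, v ∈ (Y.flagOf D.vec).2.1 ↔ v ∈ (frameFlag A).2.1 := fun v => by rw [h]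
    have h3 : ∀ v, v ∈ (Y.flagOf D.vec).2.2 ↔ v ∈ (frameFlag A).2.2 := fun v => by rw [h]
    simp only [D.mem_point, D.mem_lineKer, D.mem_planeKer, mem_frameFlag_point, mem_frameFlag_line,
      mem_frameFlag_plane] at h1 h2 h3
    have ha : ∀ k, k ≠ 0 → D.a ⬝ᵥ dualVec A k = 0 := fun k hk =>
      (h3 _).2 (by rw [row_dotProduct_dualVec, if_neg (Ne.symm hk)])
    have hb : ∀ k, k ≠ 0 → k ≠ 1 → D.b ⬝ᵥ dualVec A k = 0 := fun k hk hk1 =>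
      ((h2 _).2 ⟨by rw [row_dotProduct_dualVec, if_neg (Ne.symm hk)],
        by rw [row_dotProduct_dualVec, if_neg (Ne.symm hk1)]⟩).2
    have ea : D.a = (D.a ⬝ᵥ dualVec A 0) • A.1 0 := by
      conv_lhs => rw [eq_sum_rows A D.a]
      rw [Fin.sum_univ_four, ha 1 (by decide), ha 2 (by decide), ha 3 (by decide)]
      simp
    have eb : D.b = (D.b ⬝ᵥ dualVec A 1) • A.1 1 + (D.b ⬝ᵥ dualVec A 0) • A.1 0 := by
      conv_lhs => rw [eq_sum_rows A D.b]
      rw [Fin.sum_univ_four, hb 2 (by decide) (by decide), hb 3 (by decide) (by decide)]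
      simp [add_comm]
    have hl : D.a ⬝ᵥ dualVec A 0 ≠ 0 := fun h0 => D.a_ne (by rw [ea, h0, zero_smul])
    refine ⟨⟨_, hl, ea⟩, ⟨_, _, ?_, eb⟩, ?_⟩
    · intro h0
      rw [h0, zero_smul, zero_add] at eb
      have key : ∀ l β : ℂ, D.a = l • A.1 0 → D.b = β • A.1 0 → β • D.a + (-l) • D.b = 0 := by
        intro l β h1 h2
        rw [h1, h2]
        simp [smul_smul, mul_comm]
      have := D.not_parallel (key _ _ ea eb)
      exact hl (neg_eq_zero.1 this.2)
    · obtain ⟨h0, h1', h2'⟩ := (h1 D.q).1 ⟨1, one_smul _ _⟩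
      have eq : D.q = (A.1 3 ⬝ᵥ D.q) • dualVec A 3 := by
        conv_lhs => rw [eq_sum_dualVec A D.q]
        rw [Fin.sum_univ_four, h0, h1', h2']
        simp
      exact ⟨_, fun h0 => D.q_ne (by rw [eq, h0, zero_smul]), eq⟩
  · rintro ⟨⟨l, hl, ea⟩, ⟨μ, ν, hμ, eb⟩, ⟨κ, hκ, eq⟩⟩
    refine Prod.ext (SetLike.ext fun v => ?_) (Prod.ext (SetLike.ext fun v => ?_)
      (SetLike.ext fun v => ?_))
    · rw [D.mem_point, mem_frameFlag_point, eq]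
      constructor
      · rintro ⟨k, rfl⟩
        simp [row_dotProduct_dualVec]
      · rintro ⟨h0, h1, h2⟩
        refine ⟨(A.1 3 ⬝ᵥ v) / κ, ?_⟩
        conv_rhs => rw [eq_sum_dualVec A v]
        rw [Fin.sum_univ_four, h0, h1, h2, smul_smul, div_mul_cancel₀ _ hκ]
        simp
    · rw [D.mem_lineKer, mem_frameFlag_line, ea, eb]
      simp only [add_dotProduct, smul_dotProduct, smul_eq_mul]
      constructor
      · rintro ⟨h0, h1⟩
        have h0' := (mul_eq_zero.1 h0).resolve_left hl
        rw [h0', mul_zero, add_zero] at h1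
        exact ⟨h0', (mul_eq_zero.1 h1).resolve_left hμ⟩
      · rintro ⟨h0, h1⟩
        simp [h0, h1]
    · rw [D.mem_planeKer, mem_frameFlag_plane, ea, smul_dotProduct, smul_eq_mul, mul_eq_zero]
      exact or_iff_right hl

/-! ### Charts -/

/-- The quadric `b₀X₀² + b₁X₀X₁ + X₀X₂ + b₃X₁²`. -/
def stdQuadric (b0 b1 b3 : ℂ) : S :=
  C b0 * X 0 ^ 2 + C b1 * X 0 * X 1 + X 0 * X 2 + C b3 * X 1 ^ 2

/-- The cubic paired with `stdQuadric`. -/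
def stdCubic (b1 b3 a0 a1 a2 a3 a5 : ℂ) : S :=
  (C a0 * X 0 + C a1 * X 1 + C a2 * X 2 + C a3 * X 3) * X 0 ^ 2
    + C a5 * (C b1 * X 0 * X 1 ^ 2 + X 0 * X 1 * X 2 + C (2 / 3 * b3) * X 1 ^ 3)

/-- The shape of the coefficient of `dX₂`. -/
def stdCoeff (k0 k1 k2 a2 a5 a3 : ℂ) : S :=
  C k0 * X 0 ^ 3 + C k1 * X 0 ^ 2 * X 1 + C k2 * X 0 * X 1 ^ 2 - C a2 * X 0 ^ 2 * X 2
    - C a5 * X 0 * X 1 * X 2 - C (3 * a3) * X 0 ^ 2 * X 3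

lemma chartQuadric_eq_sub (A : GL (Fin 4) ℂ) (b0 b1 b3 : ℂ) :
    chartQuadric A b0 b1 b3 = sub A.1 (stdQuadric b0 b1 b3) := by
  simp [chartQuadric, stdQuadric, frame]

lemma chartCubic_eq_sub (A : GL (Fin 4) ℂ) (b1 b3 a0 a1 a2 a3 a5 : ℂ) :
    chartCubic A b1 b3 a0 a1 a2 a3 a5 = sub A.1 (stdCubic b1 b3 a0 a1 a2 a3 a5) := by
  simp only [chartCubic, stdCubic, frame, map_add, map_mul, sub_C, sub_X, map_pow]

lemma pairForm_std_three (b0 b1 b3 a0 a1 a2 a3 a5 : ℂ) :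
    pairForm (stdQuadric b0 b1 b3) (stdCubic b1 b3 a0 a1 a2 a3 a5) 3
      = - (X 0 * (C (2 * a3) * X 0 * stdQuadric b0 b1 b3)) := by
  have h1 : pderiv 3 (stdQuadric b0 b1 b3) = 0 := by
    simp [stdQuadric, pderiv_X]
  have h2 : pderiv 3 (stdCubic b1 b3 a0 a1 a2 a3 a5) = C a3 * X 0 ^ 2 := by
    simp [stdCubic, pderiv_X, mul_comm]
  rw [pairForm, h1, h2, C_mul, map_ofNat]
  ring

lemma pairForm_std_two (b0 b1 b3 a0 a1 a2 a3 a5 : ℂ) :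
    pairForm (stdQuadric b0 b1 b3) (stdCubic b1 b3 a0 a1 a2 a3 a5) 2
      = - (X 0 * stdCoeff (2 * a2 * b0 - 3 * a0) (2 * a5 * b0 + 2 * a2 * b1 - 3 * a1)
        (-a5 * b1 + 2 * a2 * b3) a2 a5 a3) := by
  have h1 : pderiv 2 (stdQuadric b0 b1 b3) = X 0 := by
    simp [stdQuadric, pderiv_X]
  have h2 : pderiv 2 (stdCubic b1 b3 a0 a1 a2 a3 a5) = C a2 * X 0 ^ 2 + C a5 * (X 0 * X 1) := by
    simp [stdCubic, pderiv_X, mul_comm]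
  -- The factor 2/3 of the chart cubic makes the two X₀X₁³ terms cancel, so that the coefficient of
  -- dX₂ has no X₁³ term.
  have h3 : (3 : S) * C (2 / 3 * b3) = 2 * C b3 := by
    rw [← map_ofNat (C : ℂ →+* S) 3, ← C_mul, ← map_ofNat (C : ℂ →+* S) 2, ← C_mul]
    congr 1
    ring
  rw [pairForm, h1, h2]
  simp only [stdQuadric, stdCubic, stdCoeff, C_mul, C_add, C_sub, C_neg, map_ofNat]
  rw [C_mul] at h3
  linear_combination (C a5 * X 1 ^ 3 * X 0) * h3

lemma IsChartForm.frame_mul_dCoeff {A : GL (Fin 4) ℂ} {b0 b1 b3 a0 a1 a2 a3 a5 : ℂ}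
    {η : Fin 4 → S} (h : IsChartForm A b0 b1 b3 a0 a1 a2 a3 a5 η) (k : Fin 4) :
    frame A 0 * dCoeff A k η
      = - sub A.1 (pairForm (stdQuadric b0 b1 b3) (stdCubic b1 b3 a0 a1 a2 a3 a5) k) := by
  rw [← dCoeff_mul, funext h, dCoeff_neg, chartQuadric_eq_sub, chartCubic_eq_sub, pairForm_sub,
    dCoeff_pullback]

lemma IsChartForm.dCoeff_three {A : GL (Fin 4) ℂ} {b0 b1 b3 a0 a1 a2 a3 a5 : ℂ}
    {η : Fin 4 → S} (h : IsChartForm A b0 b1 b3 a0 a1 a2 a3 a5 η) :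
    dCoeff A 3 η = sub A.1 (C (2 * a3) * X 0 * stdQuadric b0 b1 b3) := by
  apply mul_left_cancel₀ (frame_ne_zero A 0)
  rw [h.frame_mul_dCoeff, pairForm_std_three, map_neg, neg_neg, map_mul, frame_eq_sub]

lemma IsChartForm.dCoeff_two {A : GL (Fin 4) ℂ} {b0 b1 b3 a0 a1 a2 a3 a5 : ℂ}
    {η : Fin 4 → S} (h : IsChartForm A b0 b1 b3 a0 a1 a2 a3 a5 η) :
    dCoeff A 2 η = sub A.1 (stdCoeff (2 * a2 * b0 - 3 * a0) (2 * a5 * b0 + 2 * a2 * b1 - 3 * a1)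
        (-a5 * b1 + 2 * a2 * b3) a2 a5 a3) := by
  apply mul_left_cancel₀ (frame_ne_zero A 0)
  rw [h.frame_mul_dCoeff, pairForm_std_two, map_neg, neg_neg, map_mul, frame_eq_sub]

lemma stdCoeff_eq {k0 k1 k2 a2 a5 a3 k0' k1' k2' a2' a5' a3' c : ℂ}
    (h : stdCoeff k0' k1' k2' a2' a5' a3' = C c * stdCoeff k0 k1 k2 a2 a5 a3) :
    k0' = c * k0 ∧ k1' = c * k1 ∧ a2' = c * a2 ∧ a5' = c * a5 ∧ a3' = c * a3 := by
  have e : ∀ v : Fin 4 → ℂ, _ := fun v => congrArg (eval v) h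
  simp only [stdCoeff, map_add, map_sub, map_mul, eval_C, eval_X, map_pow] at e
  -- The points with X₁ = ±1 separate the part odd in X₁, so k₁ is isolated without knowing k₂.
  have e1 := e ![1, 0, 0, 0]
  have e2 := e ![1, 0, 0, 1]
  have e3 := e ![1, 0, 1, 0]
  have e4 := e ![1, 1, 0, 0]
  have e5 := e ![1, -1, 0, 0]
  have e6 := e ![1, 1, 1, 0]
  simp only [Matrix.cons_val] at e1 e2 e3 e4 e5 e6
  refine ⟨?_, ?_, ?_, ?_, ?_⟩
  · linear_combination e1
  · linear_combination (e4 - e5) / 2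
  · linear_combination e1 - e3
  · linear_combination e4 - e6 - (e1 - e3)
  · linear_combination (e1 - e2) / 3

lemma stdQuadric_eq {b0 b1 b3 b0' b1' b3' k k' : ℂ} (hk : k' ≠ 0)
    (h : C k' * X 0 * stdQuadric b0' b1' b3' = C k * X 0 * stdQuadric b0 b1 b3) :
    k' = k ∧ b0' = b0 ∧ b1' = b1 ∧ b3' = b3 := by
  have e : ∀ v : Fin 4 → ℂ, _ := fun v => congrArg (eval v) h
  simp only [stdQuadric, map_add, map_mul, eval_C, eval_X, map_pow] at e
  have e1 := e ![1, 0, 0, 0]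
  have e3 := e ![1, 0, 1, 0]
  have e4 := e ![1, 1, 0, 0]
  have e5 := e ![1, -1, 0, 0]
  simp only [Matrix.cons_val] at e1 e3 e4 e5
  -- The coefficient of X₀X₂ in the quadric is normalized to 1, which fixes the scalar.
  have h0 : k' = k := by linear_combination e3 - e1
  subst h0
  refine ⟨rfl, ?_, ?_, ?_⟩ <;> apply mul_left_cancel₀ hk
  · linear_combination e1
  · linear_combination (e4 - e5) / 2
  · linear_combination (e4 + e5) / 2 - e1

theorem IsChartForm.eq_of_dCoeff {A : GL (Fin 4) ℂ}
    {b0 b1 b3 a0 a1 a2 a3 a5 b0' b1' b3' a0' a1' a2' a3' a5' c : ℂ} {η η' : Fin 4 → S}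
    (h3' : a3' ≠ 0) (h : IsChartForm A b0 b1 b3 a0 a1 a2 a3 a5 η)
    (h' : IsChartForm A b0' b1' b3' a0' a1' a2' a3' a5' η')
    (e3 : dCoeff A 3 η' = C c * dCoeff A 3 η) (e2 : dCoeff A 2 η' = C c * dCoeff A 2 η) :
    (b0' = b0 ∧ b1' = b1 ∧ b3' = b3) ∧
      (a0' = c * a0 ∧ a1' = c * a1 ∧ a2' = c * a2 ∧ a3' = c * a3 ∧ a5' = c * a5) := by
  rw [h'.dCoeff_three, h.dCoeff_three, ← sub_C A.1 c, ← map_mul] at e3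
  rw [h'.dCoeff_two, h.dCoeff_two, ← sub_C A.1 c, ← map_mul] at e2
  have q3 := sub_injective A e3
  rw [← mul_assoc, ← mul_assoc, ← C_mul] at q3
  obtain ⟨-, rfl, rfl, rfl⟩ := stdQuadric_eq (by simpa using h3') q3
  obtain ⟨k0, k1, e2, e5, e3⟩ := stdCoeff_eq (sub_injective A e2)
  refine ⟨⟨rfl, rfl, rfl⟩, ?_, ?_, e2, e3, e5⟩
  · rw [e2] at k0; linear_combination - k0 / 3
  · rw [e2, e5] at k1; linear_combination - k1 / 3

lemma pairForm_chart_ne_zero (A : GL (Fin 4) ℂ) {b0 b1 b3 a0 a1 a2 a3 a5 : ℂ}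
    (h : ¬ (a0 = 0 ∧ a1 = 0 ∧ a2 = 0 ∧ a3 = 0 ∧ a5 = 0)) :
    pairForm (chartQuadric A b0 b1 b3) (chartCubic A b1 b3 a0 a1 a2 a3 a5) ≠ 0 := by
  intro h0
  have hη : IsChartForm A b0 b1 b3 a0 a1 a2 a3 a5 0 := fun j => by simp [h0]
  have e2 := hη.dCoeff_two
  -- Zero is written as 0 times a form of the standard shape, so that `stdCoeff_eq` applies with
  -- factor 0. The coefficient of dx₂ alone detects every aᵢ, including when a₃ = 0.
  have hz : dCoeff A 2 0 = sub A.1 (C 0 * stdCoeff 0 0 0 0 0 0) := by simp [dCoeff]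
  rw [hz] at e2
  obtain ⟨k0, k1, e2, e5, e3⟩ := stdCoeff_eq (sub_injective A e2).symm
  rw [zero_mul] at *
  rw [e2] at k0
  rw [e2, e5] at k1
  exact h ⟨by linear_combination - k0 / 3, by linear_combination - k1 / 3, e2, e3, e5⟩

lemma IsChartForm.dCoeff_eq {A : GL (Fin 4) ℂ} {b0 b1 b3 a0 a1 a2 a3 a5 : ℂ}
    {η : Fin 4 → S} (h : IsChartForm A b0 b1 b3 a0 a1 a2 a3 a5 η) :
    dCoeff A 3 η = C (2 * a3) * frame A 0 * chartQuadric A b0 b1 b3 ∧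
    dCoeff A 2 η = C (2 * a2 * b0 - 3 * a0) * frame A 0 ^ 3
      + C (2 * a5 * b0 + 2 * a2 * b1 - 3 * a1) * frame A 0 ^ 2 * frame A 1
      + C (-a5 * b1 + 2 * a2 * b3) * frame A 0 * frame A 1 ^ 2
      - C a2 * frame A 0 ^ 2 * frame A 2 - C a5 * frame A 0 * frame A 1 * frame A 2
      - C (3 * a3) * frame A 0 ^ 2 * frame A 3 := by
  rw [h.dCoeff_three, h.dCoeff_two, chartQuadric_eq_sub]
  simp only [stdCoeff, frame_eq_sub, map_add, map_sub, map_mul, map_pow, sub_C]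
  exact ⟨trivial, trivial⟩

lemma chart_mt_ne (A : GL (Fin 4) ℂ) {a0 a1 a2 a3 a5 : ℂ}
    (h : ¬ (a0 = 0 ∧ a1 = 0 ∧ a2 = 0 ∧ a3 = 0 ∧ a5 = 0)) :
    (a0 • A.1 0 + a1 • A.1 1 + a2 • A.1 2 + a3 • A.1 3) ≠ 0 ∨ a5 / 3 ≠ 0 := by
  by_contra! hc
  obtain ⟨hm, ht⟩ := hc
  have h4 := Fintype.linearIndependent_iff.1 (linearIndependent_rows A) ![a0, a1, a2, a3]
    (by rw [Fin.sum_univ_four]; exact hm)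
  exact h ⟨h4 0, h4 1, h4 2, h4 3, by simpa using ht⟩

/-- The point of `𝕐` with the given chart coordinates. -/
def chartDatum (A : GL (Fin 4) ℂ) (b0 b1 b3 a0 a1 a2 a3 a5 : ℂ)
    (h : ¬ (a0 = 0 ∧ a1 = 0 ∧ a2 = 0 ∧ a3 = 0 ∧ a5 = 0)) : YDatum where
  a := A.1 0
  b := A.1 1
  c := A.1 2
  q := dualVec A 3
  u := ![b1, 1, b3]
  s := ![b0, 1]
  m := a0 • A.1 0 + a1 • A.1 1 + a2 • A.1 2 + a3 • A.1 3
  t := a5 / 3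
  indep := by
    have := (linearIndependent_rows A).comp (Fin.castSucc : Fin 3 → Fin 4)
      (Fin.castSucc_injective 3)
    convert this using 1
    funext i
    fin_cases i <;> rfl
  q_ne := dualVec_ne_zero A 3
  q_mem := by simp [row_dotProduct_dualVec]
  u_ne := fun h0 => one_ne_zero (α := ℂ) (congrFun h0 1)
  s_ne := fun h0 => one_ne_zero (α := ℂ) (congrFun h0 1)
  mt_ne := chart_mt_ne A h

section
variable (A : GL (Fin 4) ℂ) (b0 b1 b3 a0 a1 a2 a3 a5 : ℂ)
  (h : ¬ (a0 = 0 ∧ a1 = 0 ∧ a2 = 0 ∧ a3 = 0 ∧ a5 = 0))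

lemma chartDatum_g : (chartDatum A b0 b1 b3 a0 a1 a2 a3 a5 h).g = chartQuadric A b0 b1 b3 := by
  simp [chartDatum, YDatum.g, YDatum.g', chartQuadric, frame]
  ring

lemma chartDatum_f :
    (chartDatum A b0 b1 b3 a0 a1 a2 a3 a5 h).f = chartCubic A b1 b3 a0 a1 a2 a3 a5 := by
  apply MvPolynomial.funext
  intro v
  rw [YDatum.eval_f]
  simp only [chartDatum, chartCubic, frame, map_add, map_mul, eval_C, map_pow, eval_lin,
    add_dotProduct, smul_dotProduct, smul_eq_mul, Matrix.cons_val]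
  ring

lemma chartDatum_adapted : (chartDatum A b0 b1 b3 a0 a1 a2 a3 a5 h).Adapted A :=
  ⟨⟨1, one_ne_zero, (one_smul _ _).symm⟩, ⟨1, 0, one_ne_zero, by simp [chartDatum]⟩,
    ⟨1, one_ne_zero, (one_smul _ _).symm⟩⟩

lemma chartDatum_isChartForm : IsChartForm A b0 b1 b3 a0 a1 a2 a3 a5
    (- (chartDatum A b0 b1 b3 a0 a1 a2 a3 a5 h).form) := by
  intro j
  have := (chartDatum A b0 b1 b3 a0 a1 a2 a3 a5 h).lin_mul_form j
  rw [chartDatum_g, chartDatum_f] at this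
  rw [Pi.neg_apply, mul_neg, ← this]
  rfl

end

/-! ### Homogeneous coordinates up to the torus -/

/-- The character of `ℤ⁶` with given values on the standard basis. -/
def torus (l : Fin 6 → ℂˣ) : Multiplicative (Fin 6 → ℤ) →* ℂˣ where
  toFun d := ∏ i, l i ^ (Multiplicative.toAdd d i)
  map_one' := by simp
  map_mul' d e := by simp [zpow_add, Finset.prod_mul_distrib]

lemma torus_single (l : Fin 6 → ℂˣ) (i : Fin 6) :
    torus l (Multiplicative.ofAdd (Pi.single i 1)) = l i := by
  simp only [torus, MonoidHom.coe_mk, OneHom.coe_mk, toAdd_ofAdd]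
  rw [Finset.prod_eq_single i]
  · simp
  · intro j _ hj; simp [hj]
  · simp

/-- Two vectors of coordinates on `𝕐` that agree up to the torus. -/
def TorusEquiv (x y : YCoord → ℂ) : Prop :=
  ∃ t : Multiplicative (Fin 6 → ℤ) →* ℂˣ, ∀ k, y k = (t (Multiplicative.ofAdd k.deg) : ℂ) * x k

lemma TorusEquiv.symm {x y : YCoord → ℂ} (h : TorusEquiv x y) : TorusEquiv y x := by
  obtain ⟨t, ht⟩ := h
  exact ⟨t⁻¹, fun s => by simp [ht s]⟩

lemma TorusEquiv.trans {x y z : YCoord → ℂ} (h : TorusEquiv x y) (h' : TorusEquiv y z) :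
    TorusEquiv x z := by
  obtain ⟨t, ht⟩ := h
  obtain ⟨t', ht'⟩ := h'
  exact ⟨t' * t, fun s => by simp [ht s, ht' s, mul_assoc]⟩

/-- The coordinates of the flag of `A` together with a quadric and a cubic. -/
def flagVec (A : GL (Fin 4) ℂ) (g f : S) : YCoord → ℂ
  | .plane i => A.1 0 i
  | .line i j => A.1 0 i * A.1 1 j - A.1 0 j * A.1 1 i
  | .point i => dualVec A 3 i
  | .quadric m => coeff m g
  | .pencil m n => coeff m (lin (A.1 0) ^ 2) * coeff n g - coeff n (lin (A.1 0) ^ 2) * coeff m g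
  | .cubic m => coeff m f

lemma lin_smul (c : ℂ) (a : Fin 4 → ℂ) : lin (c • a) = C c * lin a := by
  apply MvPolynomial.funext; intro v; simp [eval_lin]

/-- When s₁ ≠ 0 the pencil is spanned by h² and g, so g' carries no extra information: h² ∧ g' =
s₁⁻¹ (h² ∧ g). The torus element lists the scale factors of the six blocks. -/
lemma YDatum.torusEquiv_flagVec (D : YDatum) {A : GL (Fin 4) ℂ} (hA : D.Adapted A) {g f : S}
    (hs : D.s 1 ≠ 0) {r k : ℂ} (hr : r ≠ 0) (hk : k ≠ 0) (hg : D.g = C r * g)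
    (hf : D.f = C k * f) : TorusEquiv (flagVec A g f) D.vec := by
  obtain ⟨⟨l, hl, ea⟩, ⟨μ, ν, hμ, eb⟩, ⟨κ, hκ, eq⟩⟩ := hA
  refine ⟨torus ![Units.mk0 l hl, Units.mk0 (l * μ) (mul_ne_zero hl hμ), Units.mk0 κ hκ,
    Units.mk0 r hr, Units.mk0 (l ^ 2 * r / D.s 1) (by positivity), Units.mk0 k hk], ?_⟩
  rintro (i | ⟨i, j⟩ | i | m | ⟨m, n⟩ | m) <;> rw [YCoord.deg, torus_single] <;>
    simp only [vec, flagVec, Units.val_mk0, Matrix.cons_val]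
  · rw [ea]; rfl
  · rw [ea, eb]; simp only [Pi.add_apply, Pi.smul_apply, smul_eq_mul]; ring
  · rw [eq]; rfl
  · rw [hg, coeff_C_mul]
  · have hg' : ∀ p, r * coeff p g = D.s 0 * coeff p (lin D.a ^ 2) + D.s 1 * coeff p D.g' := by
      intro p
      rw [← coeff_C_mul, ← hg, YDatum.g, coeff_add, coeff_C_mul, coeff_C_mul]
    have ha : ∀ p, coeff p (lin D.a ^ 2) = l ^ 2 * coeff p (lin (A.1 0) ^ 2) := by
      intro p
      rw [ea, lin_smul, mul_pow, ← C_pow, coeff_C_mul]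
    have hm := hg' m
    have hn := hg' n
    rw [ha] at hm hn
    rw [ha, ha, div_mul_eq_mul_div, eq_div_iff hs]
    linear_combination l ^ 2 * coeff n (lin (A.1 0) ^ 2) * hm - l ^ 2 * coeff m (lin (A.1 0) ^ 2) * hn
  · rw [hf, coeff_C_mul]

/-- The monomial x₀x₂ of the chart quadric keeps g from being a multiple of h², so the g' component
of g is nonzero. -/
lemma YDatum.chart_data (D : YDatum) {A : GL (Fin 4) ℂ} {l : ℂ} (ea : D.a = l • A.1 0)
    {b0 b1 b3 r : ℂ} (hg : D.g = C r * chartQuadric A b0 b1 b3) : r ≠ 0 ∧ D.s 1 ≠ 0 := by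
  have hr : r ≠ 0 := fun h0 => D.g_ne_zero (by rw [hg, h0]; simp)
  refine ⟨hr, fun hs => ?_⟩
  have h1 : C (D.s 0) * (C l * X 0) ^ 2 = C r * stdQuadric b0 b1 b3 := by
    apply sub_injective A
    rw [map_mul, map_mul, ← chartQuadric_eq_sub, sub_C, sub_C, ← hg, YDatum.g, hs, ea, lin_smul]
    simp
  have e : ∀ v : Fin 4 → ℂ, _ := fun v => congrArg (eval v) h1
  simp only [stdQuadric, map_add, map_mul, eval_C, eval_X, map_pow] at e
  have e1 := e ![1, 0, 0, 0]
  have e3 := e ![1, 0, 1, 0]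
  simp only [Matrix.cons_val] at e1 e3
  exact hr (by linear_combination e1 - e3)

/-- The points of `𝕐` with given chart coordinates are equivalent. -/
lemma YDatum.torusEquiv_chart (D : YDatum) {A : GL (Fin 4) ℂ} (hA : D.Adapted A)
    {b0 b1 b3 a0 a1 a2 a3 a5 r k : ℂ} (hg : D.g = C r * chartQuadric A b0 b1 b3)
    (hf : D.f = C k * chartCubic A b1 b3 a0 a1 a2 a3 a5) :
    TorusEquiv (flagVec A (chartQuadric A b0 b1 b3) (chartCubic A b1 b3 a0 a1 a2 a3 a5)) D.vec := by
  obtain ⟨l, -, ea⟩ := hA.a_eq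
  obtain ⟨hr, hs⟩ := D.chart_data ea hg
  exact D.torusEquiv_flagVec hA hs hr (fun h0 => D.f_ne_zero (by rw [hf, h0]; simp)) hg hf

/-! ### Generic points -/

/-- A flag with a special pair whose form lies in the orbit. -/
structure YDatum.Generic (D : YDatum) : Prop where
  s_ne : D.s 1 ≠ 0
  u_ne : D.u 1 ≠ 0
  u_ne' : D.u 2 ≠ 0
  t_ne : D.t ≠ 0
  indep : LinearIndependent ℂ ![D.a, D.b, D.c, D.m]

/-- Points of `𝕐` given by a generic datum. -/
def GenericPoint (x : YCoord → ℂ) : Prop := ∃ D : YDatum, D.Generic ∧ D.vec = x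

lemma ne_std : ¬ ((0 : ℂ) = 0 ∧ (0 : ℂ) = 0 ∧ (0 : ℂ) = 0 ∧ (1 : ℂ) = 0 ∧ (-1 : ℂ) = 0) := by
  norm_num

/-- The pair of `D` is, in the frame `A`, the pair `(g₀, f₀)` up to scalars. -/
def YDatum.Normal (D : YDatum) (A : GL (Fin 4) ℂ) : Prop :=
  D.Adapted A ∧ (∃ r : ℂ, D.g = C r * chartQuadric A 0 0 (-1 / 2)) ∧
    ∃ k : ℂ, D.f = C k * chartCubic A 0 (-1 / 2) 0 0 0 1 (-1)

lemma YDatum.adapted_of (D : YDatum) (A : GL (Fin 4) ℂ) {l μ ν : ℂ} (hl : l ≠ 0) (hμ : μ ≠ 0)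
    (ha : D.a = l • A.1 0) (hb : D.b = μ • A.1 1 + ν • A.1 0) (hq : A.1 2 ⬝ᵥ D.q = 0) :
    D.Adapted A := by
  refine ⟨⟨l, hl, ha⟩, ⟨μ, ν, hμ, hb⟩, A.1 3 ⬝ᵥ D.q, ?_⟩
  have h0 : A.1 0 ⬝ᵥ D.q = 0 := by
    have := D.q_mem.1
    rw [ha, smul_dotProduct, smul_eq_mul] at this
    exact (mul_eq_zero.1 this).resolve_left hl
  have h1 : A.1 1 ⬝ᵥ D.q = 0 := by
    have := D.q_mem.2.1
    rw [hb, add_dotProduct, smul_dotProduct, smul_dotProduct, h0, smul_zero, add_zero,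
      smul_eq_mul] at this
    exact (mul_eq_zero.1 this).resolve_left hμ
  have eq : D.q = (A.1 3 ⬝ᵥ D.q) • dualVec A 3 := by
    conv_lhs => rw [eq_sum_dualVec A D.q]
    rw [Fin.sum_univ_four, h0, h1, hq]
    simp
  exact ⟨fun h => D.q_ne (by rw [eq, h, zero_smul]), eq⟩

lemma YDatum.Generic.exists_normal {D : YDatum} (hD : D.Generic) :
    ∃ A : GL (Fin 4) ℂ, D.Normal A := by
  obtain ⟨hs, hu1, hu2, ht, hind⟩ := hD
  have hi := Fintype.linearIndependent_iff.1 hind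
  -- With x₀ = a and x₁ = b, the form x₂ = αa + βb + γc is forced by g = −2s₁u₂(x₀x₂ − x₁²/2). Then
  -- x₃ = δm + αb is forced by f = 6tu₂(x₀²x₃ − x₀x₁x₂ + x₁³/3), the summand αb compensating the a²b
  -- term that x₀x₁x₂ produces.
  set α : ℂ := - D.s 0 / (2 * D.s 1 * D.u 2) with hα
  set β : ℂ := - D.u 0 / (2 * D.u 2) with hβ
  set γ : ℂ := - D.u 1 / (2 * D.u 2) with hγ
  set δ : ℂ := 1 / (6 * D.t * D.u 2) with hδ
  have hγ0 : γ ≠ 0 := by rw [hγ]; exact div_ne_zero (neg_ne_zero.2 hu1) (by simpa using hu2)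
  have hδ0 : δ ≠ 0 := by rw [hδ]; exact div_ne_zero one_ne_zero (by simp [ht, hu2])
  have hl : LinearIndependent ℂ
      ![D.a, D.b, α • D.a + β • D.b + γ • D.c, δ • D.m + α • D.b] := by
    rw [Fintype.linearIndependent_iff]
    intro g hg
    have h4 := hi ![g 0 + g 2 * α, g 1 + g 2 * β + g 3 * α, g 2 * γ, g 3 * δ] (by
      rw [← hg]
      simp only [Fin.sum_univ_four, Matrix.cons_val]
      module)
    have e0 := h4 0
    have e1 := h4 1
    have e2 := h4 2
    have e3 := h4 3
    simp only [Matrix.cons_val] at e0 e1 e2 e3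
    have g2 : g 2 = 0 := (mul_eq_zero.1 e2).resolve_right hγ0
    have g3 : g 3 = 0 := (mul_eq_zero.1 e3).resolve_right hδ0
    rw [g2, zero_mul, add_zero] at e0
    rw [g2, g3, zero_mul, zero_mul, add_zero, add_zero] at e1
    intro i
    fin_cases i <;> assumption
  obtain ⟨A, hA⟩ := exists_GL_of_linearIndependent hl
  have h0 : A.1 0 = D.a := by rw [hA]; rfl
  have h1 : A.1 1 = D.b := by rw [hA]; rfl
  have h2 : A.1 2 = α • D.a + β • D.b + γ • D.c := by rw [hA]; rfl
  have h3 : A.1 3 = δ • D.m + α • D.b := by rw [hA]; rfl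
  refine ⟨A, D.adapted_of A one_ne_zero one_ne_zero (ν := 0) (by simp [h0]) (by simp [h1]) ?_,
    ⟨- 2 * D.s 1 * D.u 2, ?_⟩, ⟨6 * D.t * D.u 2, ?_⟩⟩
  · simp [h2, D.q_mem.1, D.q_mem.2.1, D.q_mem.2.2]
  · apply MvPolynomial.funext
    intro v
    rw [D.eval_g]
    simp only [chartQuadric, frame, map_add, map_mul, eval_C, map_pow, eval_lin, h0, h1, h2,
      add_dotProduct, smul_dotProduct, smul_eq_mul, hα, hβ, hγ]
    field_simp
    ring
  · apply MvPolynomial.funext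
    intro v
    rw [D.eval_f]
    simp only [chartCubic, frame, map_add, map_mul, eval_C, map_pow, eval_lin, h0, h1, h2, h3,
      add_dotProduct, smul_dotProduct, smul_eq_mul, hα, hβ, hγ, hδ]
    field_simp
    ring

lemma YDatum.Normal.scalars_ne {D : YDatum} {A : GL (Fin 4) ℂ} {r k : ℂ}
    (hg : D.g = C r * chartQuadric A 0 0 (-1 / 2))
    (hf : D.f = C k * chartCubic A 0 (-1 / 2) 0 0 0 1 (-1)) : r ≠ 0 ∧ k ≠ 0 :=
  ⟨fun h => D.g_ne_zero (by rw [hg, h]; simp), fun h => D.f_ne_zero (by rw [hf, h]; simp)⟩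

lemma pairForm_C_mul (r k : ℂ) (g f : S) (j : Fin 4) :
    pairForm (C r * g) (C k * f) j = C (r * k) * pairForm g f j := by
  simp only [pairForm, pderiv_C_mul, C_mul]
  ring

lemma YDatum.Normal.pairForm_ne_zero {D : YDatum} {A : GL (Fin 4) ℂ} (h : D.Normal A) :
    pairForm D.g D.f ≠ 0 := by
  obtain ⟨-, ⟨r, hg⟩, ⟨k, hf⟩⟩ := h
  obtain ⟨hr, hk⟩ := YDatum.Normal.scalars_ne hg hf
  intro h0
  refine pairForm_chart_ne_zero A ne_std (b0 := 0) (b1 := 0) (b3 := -1 / 2) (funext fun j => ?_)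
  have := congrFun h0 j
  rw [hg, hf, pairForm_C_mul] at this
  exact (mul_eq_zero.1 this).resolve_left (by simpa using ⟨hr, hk⟩)

lemma GenericPoint.pairForm_ne_zero {x : YCoord → ℂ} (h : GenericPoint x) :
    pairForm (Y.quadricOf x) (Y.cubicOf x) ≠ 0 := by
  obtain ⟨D, hD, rfl⟩ := h
  obtain ⟨A, hA⟩ := hD.exists_normal
  rw [D.quadricOf_vec, D.cubicOf_vec]
  exact hA.pairForm_ne_zero

/-! ### Density of the generic points of `𝕐` -/

/-- The coefficients of the polynomial `p τ` depend continuously on `τ`. -/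
def CoeffContinuous (p : ℂ → S) : Prop := ∀ m, Continuous fun τ => coeff m (p τ)

lemma CoeffContinuous.const (p : S) : CoeffContinuous fun _ => p := fun _ => continuous_const

lemma CoeffContinuous.C {f : ℂ → ℂ} (hf : Continuous f) : CoeffContinuous fun τ => C (f τ) := by
  intro m
  classical
  simp only [coeff_C]
  split_ifs
  · exact hf
  · exact continuous_const

lemma CoeffContinuous.add {p q : ℂ → S} (hp : CoeffContinuous p) (hq : CoeffContinuous q) :
    CoeffContinuous fun τ => p τ + q τ := by
  intro m
  simp only [coeff_add]
  exact (hp m).add (hq m)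

lemma CoeffContinuous.mul {p q : ℂ → S} (hp : CoeffContinuous p) (hq : CoeffContinuous q) :
    CoeffContinuous fun τ => p τ * q τ := by
  intro m
  classical
  simp only [coeff_mul]
  exact continuous_finsetSum _ fun x _ => (hp _).mul (hq _)

lemma lin_add (a b : Fin 4 → ℂ) : lin (a + b) = lin a + lin b := by
  apply MvPolynomial.funext; intro v; simp [eval_lin, add_dotProduct]

lemma eventually_add_ne_zero (x : ℂ) : ∀ᶠ τ in nhdsWithin (0 : ℂ) {0}ᶜ, x + τ ≠ 0 := by
  by_cases hx : x = 0
  · filter_upwards [self_mem_nhdsWithin] with τ hτ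
    simpa [hx] using hτ
  · have : ∀ᶠ τ in nhds (0 : ℂ), x + τ ≠ 0 :=
      (continuous_const.add continuous_id).continuousAt.eventually_ne (by simpa using hx)
    exact this.filter_mono nhdsWithin_le_nhds

theorem generic_dense (F : MvPolynomial YCoord ℂ)
    (hF : ∀ x, GenericPoint x → eval x F = 0) (D : YDatum) : eval D.vec F = 0 := by
  obtain ⟨A, d, hA⟩ := D.exists_frame
  have h0 : A.1 0 = D.a := by rw [hA]; rfl
  have h1 : A.1 1 = D.b := by rw [hA]; rfl
  have h2 : A.1 2 = D.c := by rw [hA]; rfl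
  have h3 : A.1 3 = d := by rw [hA]; rfl
  -- The datum is deformed by adding τ to u₁, u₂, s₁, t and τd to m. Each genericity condition
  -- becomes y + τ ≠ 0 for a fixed y, true for small τ ≠ 0, and the coordinates are continuous in τ.
  let P : ℂ → S := fun τ => C (D.u 0) * lin D.a * lin D.b + C (D.u 1 + τ) * lin D.a * lin D.c
    + C (D.u 2 + τ) * lin D.b ^ 2
  let G : ℂ → S := fun τ => C (D.s 0) * lin D.a ^ 2 + C (D.s 1 + τ) * P τ
  let K : ℂ → S := fun τ => lin D.a ^ 2 * (lin D.m + C τ * lin d) + C (D.t + τ) *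
    (C (3 * D.u 0) * lin D.a * lin D.b ^ 2 + C (3 * (D.u 1 + τ)) * lin D.a * lin D.b * lin D.c
      + C (2 * (D.u 2 + τ)) * lin D.b ^ 3)
  let x : ℂ → YCoord → ℂ := fun τ k => match k with
    | .plane i => D.a i
    | .line i j => D.a i * D.b j - D.a j * D.b i
    | .point i => D.q i
    | .quadric m => coeff m (G τ)
    | .pencil m n => coeff m (lin D.a ^ 2) * coeff n (P τ) - coeff n (lin D.a ^ 2) * coeff m (P τ)
    | .cubic m => coeff m (K τ)
  have cc : ∀ y : ℂ, CoeffContinuous fun τ => C (y + τ) := fun y =>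
    .C (continuous_const.add continuous_id)
  have ct : ∀ y z : ℂ, CoeffContinuous fun τ => C (z * (y + τ)) := fun y z =>
    .C (continuous_const.mul (continuous_const.add continuous_id))
  have hP : CoeffContinuous P :=
    ((CoeffContinuous.const _).add (((cc _).mul (.const _)).mul (.const _))).add
      ((cc _).mul (.const _))
  have hG : CoeffContinuous G := (CoeffContinuous.const _).add ((cc _).mul hP)
  have hK : CoeffContinuous K :=
    ((CoeffContinuous.const _).mul ((CoeffContinuous.const _).add
      ((CoeffContinuous.C continuous_id).mul (.const _)))).add
      ((cc _).mul (((CoeffContinuous.const _).add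
        ((((ct _ _).mul (.const _)).mul (.const _)).mul (.const _))).add ((ct _ _).mul (.const _))))
  have hx : Continuous x := by
    refine continuous_pi fun k => ?_
    rcases k with i | ⟨i, j⟩ | i | m | ⟨m, n⟩ | m
    · exact continuous_const
    · exact continuous_const
    · exact continuous_const
    · exact hG m
    · exact (continuous_const.mul (hP n)).sub (continuous_const.mul (hP m))
    · exact hK m
  have hx0 : x 0 = D.vec := by
    have eP : P 0 = D.g' := by simp [P, YDatum.g']
    have eG : G 0 = D.g := by simp [G, eP, YDatum.g]
    have eK : K 0 = D.f := by simp [K, YDatum.f]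
    funext k
    rcases k with i | ⟨i, j⟩ | i | m | ⟨m, n⟩ | m <;> simp only [x, YDatum.vec, eP, eG, eK]
  have hgen : ∀ τ, D.s 1 + τ ≠ 0 → D.u 1 + τ ≠ 0 → D.u 2 + τ ≠ 0 → D.t + τ ≠ 0 →
      D.m ⬝ᵥ dualVec A 3 + τ ≠ 0 → GenericPoint (x τ) := by
    intro τ e1 e2 e3 e4 e5
    refine ⟨⟨D.a, D.b, D.c, D.q, ![D.u 0, D.u 1 + τ, D.u 2 + τ], ![D.s 0, D.s 1 + τ], D.m + τ • d,
      D.t + τ, D.indep, D.q_ne, D.q_mem, fun h => e2 (congrFun h 1), fun h => e1 (congrFun h 1),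
      Or.inr e4⟩, ⟨e1, e2, e3, e4, ?_⟩, ?_⟩
    · rw [Fintype.linearIndependent_iff]
      intro g hg
      rw [Fin.sum_univ_four] at hg
      simp only [Matrix.cons_val] at hg
      rw [← h0, ← h1, ← h2, ← h3] at hg
      have hk : ∀ k, _ := fun k => congrArg (· ⬝ᵥ dualVec A k) hg
      simp only [add_dotProduct, smul_dotProduct, smul_eq_mul, row_dotProduct_dualVec,
        zero_dotProduct] at hk
      have k0 := hk 0
      have k1 := hk 1
      have k2 := hk 2
      have k3 := hk 3
      simp at k0 k1 k2 k3
      have g3 : g 3 = 0 := k3.resolve_right e5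
      rw [g3, zero_mul, add_zero] at k0 k1 k2
      intro i
      fin_cases i <;> assumption
    · funext k
      rcases k with i | ⟨i, j⟩ | i | m | ⟨m, n⟩ | m <;>
        simp only [x, YDatum.vec, YDatum.g, YDatum.g', YDatum.f, G, P, K, lin_add, lin_smul] <;> rfl
  have hev : ∀ᶠ τ in nhdsWithin (0 : ℂ) {0}ᶜ, eval (x τ) F = 0 := by
    filter_upwards [eventually_add_ne_zero (D.s 1), eventually_add_ne_zero (D.u 1),
      eventually_add_ne_zero (D.u 2), eventually_add_ne_zero (D.t),
      eventually_add_ne_zero (D.m ⬝ᵥ dualVec A 3)] with τ e1 e2 e3 e4 e5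
    exact hF _ (hgen τ e1 e2 e3 e4 e5)
  have hc : Continuous fun τ => eval (x τ) F := (continuous_eval F).comp hx
  have l1 : Filter.Tendsto (fun τ => eval (x τ) F) (nhdsWithin (0 : ℂ) {0}ᶜ) (nhds (eval (x 0) F)) :=
    (hc.tendsto 0).mono_left nhdsWithin_le_nhds
  have l2 : Filter.Tendsto (fun τ => eval (x τ) F) (nhdsWithin (0 : ℂ) {0}ᶜ) (nhds 0) :=
    (Filter.tendsto_congr' hev).2 tendsto_const_nhds
  rw [← hx0]
  exact tendsto_nhds_unique l1 l2

/-! ### Towers of blow-ups of `𝕐` -/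

/-- The coordinates pulled back from `𝕐`. -/
def Variety.baseVec (V : Variety) (z : V.Coord → ℂ) : YCoord → ℂ := fun k => z (V.base k)

/-- The properties of `𝕐` and its successive blow-ups that we need. -/
structure IsTower (V : Variety) : Prop where
  deg_base : ∃ φ : (Fin 6 → ℤ) →+ V.Deg, ∀ k, V.deg (V.base k) = φ k.deg
  base_mem : ∀ z ∈ V.cone, V.baseVec z ∈ Y.cone
  dense : ∀ F : MvPolynomial V.Coord ℂ,
    (∀ z ∈ V.cone, GenericPoint (V.baseVec z) → eval z F = 0) → ∀ z ∈ V.cone, eval z F = 0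
  lift : ∀ x ∈ Y.cone, pairForm (Y.quadricOf x) (Y.cubicOf x) ≠ 0 →
    ∃ z ∈ V.cone, V.baseVec z = x
  unique : ∀ z ∈ V.cone, ∀ z' ∈ V.cone, pairForm (V.quadricOf z) (V.cubicOf z) ≠ 0 →
    TorusEquiv (V.baseVec z) (V.baseVec z') →
    ∃ t : Multiplicative V.Deg →* ℂˣ, ∀ s, z' s = (t (Multiplicative.ofAdd (V.deg s)) : ℂ) * z s

lemma isTower_Y : IsTower Y where
  deg_base := ⟨AddMonoidHom.id _, fun _ => rfl⟩
  base_mem _ hz := hz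
  dense F hF z hz := by
    obtain ⟨D, rfl⟩ := hz
    refine generic_dense F (fun x hx => ?_) D
    obtain ⟨D', hD', rfl⟩ := hx
    exact hF _ ⟨D', rfl⟩ ⟨D', hD', rfl⟩
  lift x hx _ := ⟨x, hx, rfl⟩
  unique _ _ _ _ _ h := h

lemma eval_torus {σ M : Type*} [AddCommGroup M] {w : σ → M} {F : MvPolynomial σ ℂ} {d : M}
    (hF : IsWeightedHomogeneous w F d) (t : Multiplicative M →* ℂˣ) (x : σ → ℂ) :
    eval (fun s => (t (Multiplicative.ofAdd (w s)) : ℂ) * x s) F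
      = (t (Multiplicative.ofAdd d) : ℂ) * eval x F := by
  rw [eval_eq, eval_eq, Finset.mul_sum]
  refine Finset.sum_congr rfl fun m hm => ?_
  have hw : Finsupp.weight w m = d := hF (mem_support_iff.1 hm)
  have ht : (t (Multiplicative.ofAdd d) : ℂ)
      = ∏ i ∈ m.support, (t (Multiplicative.ofAdd (w i)) : ℂ) ^ m i := by
    rw [← hw, Finsupp.weight_apply, Finsupp.sum, ofAdd_sum, map_prod]
    push_cast
    exact Finset.prod_congr rfl fun i _ => by rw [ofAdd_nsmul, map_pow, Units.val_pow_eq_pow_val]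
  rw [ht]
  simp only [mul_pow, Finset.prod_mul_distrib]
  ring

/-- A character of `M × ℤ` from a character of `M` and a unit. -/
def prodTorus {M : Type*} [AddCommGroup M] (t : Multiplicative M →* ℂˣ) (u : ℂˣ) :
    Multiplicative (M × ℤ) →* ℂˣ where
  toFun d := t (Multiplicative.ofAdd (Multiplicative.toAdd d).1) * u ^ (Multiplicative.toAdd d).2
  map_one' := by simp
  map_mul' d e := by
    simp only [toAdd_mul, Prod.fst_add, Prod.snd_add, ofAdd_add, map_mul, zpow_add]
    exact mul_mul_mul_comm _ _ _ _

section Blowup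

variable {V : Variety} {Z : Set (V.Coord → ℂ)}

lemma graph_mem_blowup {x : V.Coord → ℂ} (hx : x ∈ V.cone) {F : V.Eqn Z} (hF : eval x F.1 ≠ 0)
    {c : ℂ} (hc : c ≠ 0) :
    (Sum.elim x fun G : V.Eqn Z => c * eval x G.1) ∈ (V.blowup Z).cone :=
  ⟨hx, ⟨F, mul_ne_zero hc hF⟩, fun _ hP => hP x hx (fun h => hF (F.2.2.2 x h)) c⟩

/-- On the graph the relation reads (cF)G = (cG)F, and it is polynomial, so it persists on the
closure. -/
lemma blowup_proportional {z : V.Coord ⊕ V.Eqn Z → ℂ} (hz : z ∈ (V.blowup Z).cone)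
    (F G : V.Eqn Z) :
    z (Sum.inr F) * eval (fun s => z (Sum.inl s)) G.1
      = z (Sum.inr G) * eval (fun s => z (Sum.inl s)) F.1 := by
  have h := hz.2.2 (X (Sum.inr F) * rename Sum.inl G.1 - X (Sum.inr G) * rename Sum.inl F.1)
    (fun x _ _ c => by simp [eval_rename, Function.comp_def]; ring)
  simpa [eval_rename, Function.comp_def, sub_eq_zero] using h

/-- Blowing up changes nothing where some equation of the centre is nonzero: there the new
coordinates are a common nonzero multiple of the values of the equations. Density is inherited
because the cone lies in the closure of the graph. -/
theorem IsTower.blowup (hV : IsTower V)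
    (hZ : ∀ x ∈ V.cone, pairForm (V.quadricOf x) (V.cubicOf x) ≠ 0 →
      ∃ F : V.Eqn Z, eval x F.1 ≠ 0) : IsTower (V.blowup Z) where
  deg_base := by
    obtain ⟨φ, hφ⟩ := hV.deg_base
    exact ⟨(AddMonoidHom.inl V.Deg ℤ).comp φ, fun k => Prod.ext (hφ k) rfl⟩
  base_mem z hz := hV.base_mem _ hz.1
  dense F hF z hz := by
    refine hz.2.2 F fun x hx _ c => ?_
    have hne : ∀ c : ℂ, c ≠ 0 → ∀ x ∈ V.cone,
        eval (Sum.elim x fun G : V.Eqn Z => c * eval x G.1) F = 0 := by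
      intro c hc x hx
      -- Restricting F to the graph with fixed c gives a polynomial on V, to which density on V
      -- applies.
      have hQ : ∀ x, eval x (aeval (Sum.elim X fun G : V.Eqn Z => C c * G.1) F)
          = eval (Sum.elim x fun G : V.Eqn Z => c * eval x G.1) F := by
        intro x
        have : (eval x).comp (aeval (Sum.elim X fun G : V.Eqn Z => C c * G.1) :
            MvPolynomial (V.Coord ⊕ V.Eqn Z) ℂ →ₐ[ℂ] MvPolynomial V.Coord ℂ).toRingHom
            = eval (Sum.elim x fun G : V.Eqn Z => c * eval x G.1) := by
          apply MvPolynomial.ringHom_ext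
          · intro r; simp [algebraMap_eq]
          · rintro (s | G) <;> simp
        exact congrArg (fun φ => φ F) this
      rw [← hQ]
      refine hV.dense _ (fun y hy hgen => ?_) x hx
      rw [hQ]
      obtain ⟨G, hG⟩ := hZ y hy hgen.pairForm_ne_zero
      exact hF _ (graph_mem_blowup hy hG hc) hgen
    -- At c = 0 the graph vector is not in the cone of the blow-up, since all new coordinates
    -- vanish; this value of c is reached by continuity.
    have hcont : Continuous fun c : ℂ => eval (Sum.elim x fun G : V.Eqn Z => c * eval x G.1) F := by
      refine (continuous_eval F).comp (continuous_pi ?_)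
      rintro (s | G)
      · exact continuous_const
      · exact continuous_id.mul continuous_const
    have := Continuous.ext_on (dense_compl_singleton (0 : ℂ)) hcont continuous_const
      (fun c hc => hne c hc x hx)
    exact congrFun this c
  lift x hx h := by
    obtain ⟨z, hz, rfl⟩ := hV.lift x hx h
    obtain ⟨F, hF⟩ := hZ z hz h
    exact ⟨_, graph_mem_blowup hz hF one_ne_zero, rfl⟩
  unique z hz z' hz' h hb := by
    obtain ⟨t, ht⟩ := hV.unique _ hz.1 _ hz'.1 h hb
    obtain ⟨F, hF⟩ := hZ _ hz.1 h
    have hdeg : ∀ G : V.Eqn Z, eval (fun s => z' (Sum.inl s)) G.1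
        = (t (Multiplicative.ofAdd G.2.2.1.choose) : ℂ) * eval (fun s => z (Sum.inl s)) G.1 := by
      intro G
      have : (fun s => z' (Sum.inl s))
          = fun s => (t (Multiplicative.ofAdd (V.deg s)) : ℂ) * z (Sum.inl s) := funext ht
      rw [this]
      exact eval_torus G.2.2.1.choose_spec t _
    have hF' : eval (fun s => z' (Sum.inl s)) F.1 ≠ 0 := by
      rw [hdeg]; exact mul_ne_zero (Units.ne_zero _) hF
    have hne : ∀ w : V.Coord ⊕ V.Eqn Z → ℂ, w ∈ (V.blowup Z).cone →
        eval (fun s => w (Sum.inl s)) F.1 ≠ 0 → w (Sum.inr F) ≠ 0 := by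
      intro w hw hF h0
      obtain ⟨G, hG⟩ := hw.2.1
      have := blowup_proportional hw F G
      rw [h0, zero_mul, eq_comm, mul_eq_zero] at this
      exact this.elim hG hF
    have e1 := hne z hz hF
    have e2 := hne z' hz' hF'
    -- The new coordinates of z are κ times the values of the equations, those of z' are κ' times
    -- theirs. The quotient κ'/κ is the torus component in the additional ℤ-grading.
    let κ : ℂˣ := Units.mk0 _ (div_ne_zero e1 hF)
    let κ' : ℂˣ := Units.mk0 _ (div_ne_zero e2 hF')
    refine ⟨prodTorus t (κ' / κ), ?_⟩
    rintro (s | G)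
    · change z' (Sum.inl s)
        = ((t (Multiplicative.ofAdd (V.deg s)) * (κ' / κ) ^ (0 : ℤ) : ℂˣ) : ℂ) * z (Sum.inl s)
      rw [zpow_zero, mul_one]
      exact ht s
    · change z' (Sum.inr G)
        = ((t (Multiplicative.ofAdd G.2.2.1.choose) * (κ' / κ) ^ (1 : ℤ) : ℂˣ) : ℂ) * z (Sum.inr G)
      have p1 := blowup_proportional hz F G
      have p2 := blowup_proportional hz' F G
      have q1 : z (Sum.inr G) = κ * eval (fun s => z (Sum.inl s)) G.1 := by
        simp only [κ, Units.val_mk0]; field_simp; linear_combination -p1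
      have q2 : z' (Sum.inr G) = κ' * eval (fun s => z' (Sum.inl s)) G.1 := by
        simp only [κ', Units.val_mk0]; field_simp; linear_combination -p2
      rw [q2, q1, hdeg, zpow_one]
      push_cast
      field_simp

end Blowup

/-! ### The form as a polynomial in the coordinates -/

/-- The coefficients of `E` are all homogeneous of degree `d`. -/
def HomCoeff {σ τ M : Type*} [AddCommMonoid M] (w : σ → M)
    (E : MvPolynomial τ (MvPolynomial σ ℂ)) (d : M) : Prop :=
  ∀ m, IsWeightedHomogeneous w (coeff m E) d

section HomCoeff

variable {σ τ M : Type*} [AddCommMonoid M] {w : σ → M} {E E' : MvPolynomial τ (MvPolynomial σ ℂ)}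
  {d d' : M}

lemma HomCoeff.add (h : HomCoeff w E d) (h' : HomCoeff w E' d) : HomCoeff w (E + E') d := by
  intro m
  rw [coeff_add]
  exact (h m).add (h' m)

lemma HomCoeff.sub (h : HomCoeff w E d) (h' : HomCoeff w E' d) : HomCoeff w (E - E') d := by
  intro m
  rw [coeff_sub]
  exact (h m).sub (h' m)

lemma HomCoeff.mul (h : HomCoeff w E d) (h' : HomCoeff w E' d') :
    HomCoeff w (E * E') (d + d') := by
  classical
  intro m
  rw [coeff_mul]
  exact IsWeightedHomogeneous.sum _ _ _ fun x _ => (h _).mul (h' _)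

lemma homCoeff_C {p : MvPolynomial σ ℂ} (hp : IsWeightedHomogeneous w p d) :
    HomCoeff (τ := τ) w (C p) d := by
  classical
  intro m
  rw [coeff_C]
  split_ifs
  · exact hp
  · exact isWeightedHomogeneous_zero _ _ _

lemma homCoeff_CC (c : ℂ) : HomCoeff (τ := τ) w (C (C c)) 0 :=
  homCoeff_C (isWeightedHomogeneous_C _ _)

lemma homCoeff_monomial {p : MvPolynomial σ ℂ} (hp : IsWeightedHomogeneous w p d) (k : τ →₀ ℕ) :
    HomCoeff w (monomial k p) d := by
  classical
  intro m
  rw [coeff_monomial]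
  split_ifs
  · exact hp
  · exact isWeightedHomogeneous_zero _ _ _

lemma HomCoeff.sum {ι : Type*} (s : Finset ι) {f : ι → MvPolynomial τ (MvPolynomial σ ℂ)}
    (h : ∀ i ∈ s, HomCoeff w (f i) d) : HomCoeff w (∑ i ∈ s, f i) d := by
  intro m
  rw [coeff_sum, ← mem_weightedHomogeneousSubmodule ℂ]
  exact Submodule.sum_mem _ fun i hi => h i hi m

lemma HomCoeff.pderiv (h : HomCoeff w E d) (i : τ) : HomCoeff w (pderiv i E) d := by
  intro m
  rw [coeff_pderiv]
  have := (h (m + Finsupp.single i 1)).mul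
    (isWeightedHomogeneous_C w ((m i : ℂ) + 1))
  simpa using this

lemma HomCoeff.pow (h : HomCoeff w E d) (n : ℕ) : HomCoeff w (E ^ n) (n • d) := by
  induction n with
  | zero => simpa using homCoeff_CC (w := w) (τ := τ) 1
  | succ n ih => rw [pow_succ, succ_nsmul]; exact ih.mul h

lemma HomCoeff.const_mul (h : HomCoeff w E d) (c : ℂ) : HomCoeff w (C (C c) * E) d := by
  have := (homCoeff_CC (w := w) (τ := τ) c).mul h
  rwa [zero_add] at this

end HomCoeff

lemma isWeightedHomogeneous_rename {σ σ' M M' : Type*} [AddCommGroup M] [AddCommGroup M']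
    {w : σ → M} {w' : σ' → M'} (f : σ → σ') (φ : M →+ M') (hf : ∀ k, w' (f k) = φ (w k))
    {F : MvPolynomial σ ℂ} {d : M} (hF : IsWeightedHomogeneous w F d) :
    IsWeightedHomogeneous w' (rename f F) (φ d) := by
  rw [← F.support_sum_monomial_coeff, map_sum, ← mem_weightedHomogeneousSubmodule ℂ]
  refine Submodule.sum_mem _ fun m hm => ?_
  rw [rename_monomial, mem_weightedHomogeneousSubmodule]
  apply isWeightedHomogeneous_monomial
  rw [← hF (mem_support_iff.1 hm), Finsupp.weight_apply, Finsupp.weight_apply,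
    Finsupp.sum_mapDomain_index (by simp) (by simp [add_nsmul]), map_finsuppSum]
  exact Finsupp.sum_congr fun i _ => by rw [hf, map_nsmul]

/-- Polynomials in `X₀, …, X₃` whose coefficients are polynomials in the coordinates of `𝕐`. -/
abbrev Gen : Type := MvPolynomial (Fin 4) (MvPolynomial YCoord ℂ)

/-- The universal plane. -/
def genPlane : Gen := ∑ i, C (X (YCoord.plane i)) * X i

/-- The universal quadric. -/
def genQuadric : Gen := ∑ m ∈ Finset.finsuppAntidiag (Finset.univ : Finset (Fin 4)) 2,
  monomial m (X (YCoord.quadric m))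

/-- The universal cubic. -/
def genCubic : Gen := ∑ m ∈ Finset.finsuppAntidiag (Finset.univ : Finset (Fin 4)) 3,
  monomial m (X (YCoord.cubic m))

/-- The universal `3 f dg - 2 g df`. -/
def genPair (j : Fin 4) : Gen :=
  C (C 3) * (genCubic * pderiv j genQuadric) - C (C 2) * (genQuadric * pderiv j genCubic)

/-- `αᵉ⁴` times the quotient of the universal `3 f dg - 2 g df` by the universal plane `h`,
where `αₑ` is the coefficient of `Xₑ` in `h`; by Taylor's formula. -/
def valuePoly (e j : Fin 4) : Gen :=
  C (C 1) * (genPlane ^ 0 * C (X (YCoord.plane e)) ^ 3 * pderiv e (genPair j))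
  - C (C (1 / 2)) * (genPlane ^ 1 * C (X (YCoord.plane e)) ^ 2 * pderiv e (pderiv e (genPair j)))
  + C (C (1 / 6)) * (genPlane ^ 2 * C (X (YCoord.plane e)) ^ 1
      * pderiv e (pderiv e (pderiv e (genPair j))))
  - C (C (1 / 24)) * (genPlane ^ 3 * C (X (YCoord.plane e)) ^ 0
      * pderiv e (pderiv e (pderiv e (pderiv e (genPair j)))))

/-- The degree of `valuePoly`. -/
def valueDeg : Fin 6 → ℤ := 3 • Pi.single 0 1 + (Pi.single 3 1 + Pi.single 5 1)

lemma homCoeff_valuePoly (e j : Fin 4) : HomCoeff YCoord.deg (valuePoly e j) valueDeg := by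
  have hX : ∀ k, IsWeightedHomogeneous YCoord.deg (X k : MvPolynomial YCoord ℂ) k.deg :=
    fun k => isWeightedHomogeneous_X _ _ _
  have h1 : HomCoeff YCoord.deg genPlane (Pi.single 0 1) := by
    refine HomCoeff.sum _ fun i _ => ?_
    rw [C_mul_X_eq_monomial]
    exact homCoeff_monomial (hX _) _
  have h2 : HomCoeff YCoord.deg genQuadric (Pi.single 3 1) :=
    HomCoeff.sum _ fun m _ => homCoeff_monomial (hX _) _
  have h3 : HomCoeff YCoord.deg genCubic (Pi.single 5 1) :=
    HomCoeff.sum _ fun m _ => homCoeff_monomial (hX _) _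
  have h4 : HomCoeff YCoord.deg (genPair j) (Pi.single 3 1 + Pi.single 5 1) := by
    refine HomCoeff.sub (HomCoeff.const_mul ?_ _) (HomCoeff.const_mul ?_ _)
    · rw [add_comm]; exact h3.mul (h2.pderiv _)
    · exact h2.mul (h3.pderiv _)
  have h5 : HomCoeff (τ := Fin 4) YCoord.deg (C (X (YCoord.plane e))) (Pi.single 0 1) :=
    homCoeff_C (hX _)
  have key : ∀ (k l : ℕ) (W : Gen), k + l = 3 →
      HomCoeff YCoord.deg W (Pi.single 3 1 + Pi.single 5 1) →
      HomCoeff YCoord.deg (genPlane ^ k * C (X (YCoord.plane e)) ^ l * W) valueDeg := by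
    intro k l W hkl hW
    have := ((h1.pow k).mul (h5.pow l)).mul hW
    rwa [← add_nsmul, hkl] at this
  refine HomCoeff.sub (HomCoeff.add (HomCoeff.sub ?_ ?_) ?_) ?_ <;>
    refine HomCoeff.const_mul (key _ _ _ rfl ?_) _
  · exact h4.pderiv _
  · exact (h4.pderiv _).pderiv _
  · exact ((h4.pderiv _).pderiv _).pderiv _
  · exact (((h4.pderiv _).pderiv _).pderiv _).pderiv _

/-- Put η = hω, with h the linear form and α its coefficient of Xₑ. Since h vanishes at x −
(h(x)/α)e, Taylor's formula for η at that point has sum zero. Solving for η, dividing by h and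
multiplying by α⁴ gives the identity, which is polynomial and so also valid for α = 0. -/
lemma taylor_quotient (a : Fin 4 → ℂ) (e : Fin 4) {ω : S} (hω : ω.IsHomogeneous 3) :
    C (a e) ^ 3 * pderiv e (lin a * ω)
      - C (1 / 2) * (lin a * C (a e) ^ 2 * pderiv e (pderiv e (lin a * ω)))
      + C (1 / 6) * (lin a ^ 2 * C (a e) * pderiv e (pderiv e (pderiv e (lin a * ω))))
      - C (1 / 24) * (lin a ^ 3 * pderiv e (pderiv e (pderiv e (pderiv e (lin a * ω)))))
      = C (a e) ^ 4 * ω := by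
  have h1 : (pderiv e ω).IsHomogeneous 2 := pderiv_isHomogeneous hω e
  have h2 : (pderiv e (pderiv e ω)).IsHomogeneous 1 := pderiv_isHomogeneous h1 e
  have h3 : (pderiv e (pderiv e (pderiv e ω))).IsHomogeneous 0 := pderiv_isHomogeneous h2 e
  have h4 : pderiv e (pderiv e (pderiv e (pderiv e ω))) = 0 := by
    rw [(totalDegree_eq_zero_iff_eq_C (p := pderiv e (pderiv e (pderiv e ω)))).1
      (Nat.le_zero.1 h3.totalDegree_le), pderiv_C]
  have c2 : (C (1 / 2) : S) * 2 = 1 := by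
    rw [← map_ofNat (C : ℂ →+* S) 2, ← C_mul]; norm_num
  have c6 : (C (1 / 6) : S) * 6 = 1 := by
    rw [← map_ofNat (C : ℂ →+* S) 6, ← C_mul]; norm_num
  have c24 : (C (1 / 24) : S) * 24 = 1 := by
    rw [← map_ofNat (C : ℂ →+* S) 24, ← C_mul]; norm_num
  simp only [pderiv_mul, map_add, pderiv_lin, pderiv_C, h4, zero_mul, zero_add, mul_zero, add_zero]
  generalize pderiv e (pderiv e (pderiv e ω)) = w3
  generalize pderiv e (pderiv e ω) = w2
  generalize pderiv e ω = w1
  have c6' : (C (1 / 6) : S) * 3 = C (1 / 2) := by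
    rw [← map_ofNat (C : ℂ →+* S) 3, ← C_mul]; norm_num
  have c24' : (C (1 / 24) : S) * 4 = C (1 / 6) := by
    rw [← map_ofNat (C : ℂ →+* S) 4, ← C_mul]; norm_num
  linear_combination (- (C (a e)) ^ 3 * lin a * w1) * c2 + (lin a ^ 2 * C (a e) ^ 2 * w2) * c6'
    - (lin a ^ 3 * C (a e) * w3) * c24'

lemma map_genPlane (x : YCoord → ℂ) : map (eval x) genPlane = Y.planeOf x := by
  simp only [genPlane, Variety.planeOf, lin, map_sum, map_mul, map_C, map_X, eval_X]
  rfl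

lemma map_genQuadric (x : YCoord → ℂ) : map (eval x) genQuadric = Y.quadricOf x := by
  simp only [genQuadric, Variety.quadricOf, map_sum, map_monomial, eval_X]
  rfl

lemma map_genCubic (x : YCoord → ℂ) : map (eval x) genCubic = Y.cubicOf x := by
  simp only [genCubic, Variety.cubicOf, map_sum, map_monomial, eval_X]
  rfl

lemma map_genPair (x : YCoord → ℂ) (j : Fin 4) :
    map (eval x) (genPair j) = pairForm (Y.quadricOf x) (Y.cubicOf x) j := by
  simp only [genPair, pairForm, map_sub, map_mul, ← pderiv_map, map_genQuadric, map_genCubic, map_ofNat]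
  ring

lemma map_valuePoly (D : YDatum) (e j : Fin 4) :
    map (eval D.vec) (valuePoly e j) = C (D.a e ^ 4) * D.form j := by
  have h : pairForm (Y.quadricOf D.vec) (Y.cubicOf D.vec) j = lin D.a * D.form j := by
    rw [D.quadricOf_vec, D.cubicOf_vec, D.lin_mul_form]
  have hX : eval D.vec (X (YCoord.plane e)) = D.a e := by rw [eval_X]; rfl
  rw [C_pow, ← taylor_quotient D.a e (D.form_mem.1 j)]
  simp only [valuePoly, map_sub, map_add, map_mul, map_pow, map_C, eval_C, ← pderiv_map,
    map_genPair, map_genPlane, hX, h, D.planeOf_vec, map_one]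
  ring

/-! ### Values of the rational map -/

lemma P44.eq_of_rep {ω η : P44} {c : ℂ}
    (h : (ω.rep : Fin 4 → S) = c • (η.rep : Fin 4 → S)) : ω = η := by
  rw [← ω.mk_rep, ← η.mk_rep, Projectivization.mk_eq_mk_iff']
  exact ⟨c, Subtype.ext h.symm⟩

lemma P44.rep_ne_zero (ω : P44) : (ω.rep : Fin 4 → S) ≠ 0 := fun h =>
  ω.rep_nonzero (Subtype.ext h)

lemma P44.mk_rep_smul {η : Fin 4 → S} (hη : η ∈ Omega14) (h0 : (⟨η, hη⟩ : Omega14) ≠ 0) :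
    ∃ c : ℂ, c ≠ 0 ∧ η = c • ((Projectivization.mk ℂ (⟨η, hη⟩ : Omega14) h0).rep : Fin 4 → S) := by
  obtain ⟨a, ha⟩ := Projectivization.exists_smul_eq_mk_rep ℂ (⟨η, hη⟩ : Omega14) h0
  refine ⟨((a⁻¹ : ℂˣ) : ℂ), Units.ne_zero _, ?_⟩
  rw [← ha]
  change η = ((a⁻¹ : ℂˣ) : ℂ) • ((a : ℂ) • η)
  rw [smul_smul, Units.inv_mul, one_smul]

lemma YDatum.form_eq_zero_iff (D : YDatum) : D.form = 0 ↔ pairForm D.g D.f = 0 := by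
  constructor
  · intro h; funext j; rw [← D.lin_mul_form, h]; simp
  · intro h; funext j
    have := D.lin_mul_form j
    rw [h] at this
    exact (mul_eq_zero.1 this).resolve_left (lin_ne_zero D.a_ne)

variable {V : Variety}

/-- Evaluating forms at constant vectors turns identities between forms into polynomial identities
in the coordinates of the tower, to which density applies. -/
lemma eval_eval_C {σ : Type*} (z : σ → ℂ) (v : Fin 4 → ℂ)
    (p : MvPolynomial (Fin 4) (MvPolynomial σ ℂ)) :
    eval z (eval (fun i => C (v i)) p) = eval v (map (eval z) p) := by
  induction p using MvPolynomial.induction_on with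
  | C c => simp
  | add p q hp hq => simp [hp, hq]
  | mul_X p i hp => simp [hp]

lemma IsTower.exists_datum (hV : IsTower V) {z : V.Coord → ℂ} (hz : z ∈ V.cone) :
    ∃ D : YDatum, V.baseVec z = D.vec ∧ V.planeOf z = lin D.a ∧ V.quadricOf z = D.g ∧
      V.cubicOf z = D.f := by
  obtain ⟨D, hD⟩ := hV.base_mem z hz
  refine ⟨D, hD.symm, ?_, ?_, ?_⟩
  · change Y.planeOf (V.baseVec z) = _
    rw [← hD, D.planeOf_vec]
  · change Y.quadricOf (V.baseVec z) = _
    rw [← hD, D.quadricOf_vec]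
  · change Y.cubicOf (V.baseVec z) = _
    rw [← hD, D.cubicOf_vec]

/-- `P` represents the rational map to `ℙ⁴⁴` in degree `d`. -/
def Represents (V : Variety) (P : Fin 4 → MvPolynomial (Fin 4) (MvPolynomial V.Coord ℂ))
    (d : V.Deg) : Prop :=
  (∀ i m, V.IsHomog (coeff m (P i)) d) ∧
    ∀ z ∈ V.cone, pairForm (V.quadricOf z) (V.cubicOf z) ≠ 0 →
      ∃ c : ℂ, ∀ i, V.planeOf z * V.formAt P z i
        = C c * pairForm (V.quadricOf z) (V.cubicOf z) i

lemma isValue_iff {x : V.Coord → ℂ} {ω : P44} : V.IsValue x ω ↔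
    ∃ P d, Represents V P d ∧ ∃ c : ℂ, c ≠ 0 ∧ V.formAt P x = c • (ω.rep : Fin 4 → S) := by
  constructor
  · rintro ⟨P, d, h1, h2, h3⟩; exact ⟨P, d, ⟨h1, h2⟩, h3⟩
  · rintro ⟨P, d, ⟨h1, h2⟩, h3⟩; exact ⟨P, d, h1, h2, h3⟩

/-- The polynomials `valuePoly` on a tower. -/
def towerPoly (V : Variety) (e : Fin 4) : Fin 4 → MvPolynomial (Fin 4) (MvPolynomial V.Coord ℂ) :=
  fun j => map (rename V.base : MvPolynomial YCoord ℂ →ₐ[ℂ] MvPolynomial V.Coord ℂ).toRingHom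
    (valuePoly e j)

lemma formAt_towerPoly (e : Fin 4) {z : V.Coord → ℂ} {D : YDatum} (hD : V.baseVec z = D.vec) :
    V.formAt (towerPoly V e) z = (D.a e ^ 4) • D.form := by
  funext j
  have : (eval z).comp (rename V.base : MvPolynomial YCoord ℂ →ₐ[ℂ] MvPolynomial V.Coord ℂ).toRingHom
      = eval D.vec := by
    apply MvPolynomial.ringHom_ext
    · intro r; simp
    · intro k; simp [← hD, Variety.baseVec]
  rw [Variety.formAt, towerPoly, map_map, this, map_valuePoly, Pi.smul_apply, smul_eq_C_mul]

lemma IsTower.represents (hV : IsTower V) (e : Fin 4) :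
    ∃ d, Represents V (towerPoly V e) d := by
  obtain ⟨φ, hφ⟩ := hV.deg_base
  refine ⟨φ valueDeg, fun i m => ?_, fun z hz _ ↦ ?_⟩
  · rw [towerPoly, coeff_map]
    exact isWeightedHomogeneous_rename V.base φ hφ (homCoeff_valuePoly e i m)
  · obtain ⟨D, hD, h1, h2, h3⟩ := hV.exists_datum hz
    refine ⟨D.a e ^ 4, fun i => ?_⟩
    rw [formAt_towerPoly e hD, h1, h2, h3, ← D.lin_mul_form, Pi.smul_apply, smul_eq_C_mul]
    ring

/-- Some coefficient of the plane is nonzero, and for that index e the form `towerPoly V e` does not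
vanish at z. Hence the map is regular wherever the quotient form of the base datum is nonzero. -/
lemma IsTower.isValue (hV : IsTower V) {z : V.Coord → ℂ} {D : YDatum}
    (hD : V.baseVec z = D.vec) {ω : P44} {c : ℂ} (hc : c ≠ 0)
    (hω : D.form = c • (ω.rep : Fin 4 → S)) : V.IsValue z ω := by
  obtain ⟨e, he⟩ := Function.ne_iff.1 D.a_ne
  obtain ⟨d, hd⟩ := hV.represents e
  refine isValue_iff.2 ⟨_, d, hd, D.a e ^ 4 * c, mul_ne_zero (pow_ne_zero 4 he) hc, ?_⟩
  rw [formAt_towerPoly e hD, hω, smul_smul]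

lemma pderiv_pair_cube (r k : ℂ) (l : S) : pairForm (C r * l ^ 2) (C k * l ^ 3) = 0 := by
  funext j
  simp only [pairForm, pderiv_mul, pderiv_C, pderiv_pow, Pi.zero_apply]
  push_cast
  ring

/-- An equation on `𝕐` that does not vanish at a given point where `3 f dg ≠ 2 g df`. -/
lemma exists_equation {x : YCoord → ℂ} (hx : x ∈ Y.cone)
    (h : pairForm (Y.quadricOf x) (Y.cubicOf x) ≠ 0) :
    ∃ (F : MvPolynomial YCoord ℂ) (d : Fin 6 → ℤ), IsWeightedHomogeneous YCoord.deg F d ∧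
      eval x F ≠ 0 ∧
      (∀ z ∈ Y.cone, pairForm (Y.quadricOf z) (Y.cubicOf z) = 0 → eval z F = 0) ∧
      ∀ V, IsTower V → ∀ z ∈ V.indet, eval (V.baseVec z) F = 0 := by
  obtain ⟨D, rfl⟩ := hx
  rw [D.quadricOf_vec, D.cubicOf_vec, ne_eq, ← D.form_eq_zero_iff] at h
  obtain ⟨j, hj⟩ := Function.ne_iff.1 h
  obtain ⟨m, hm⟩ := ne_zero_iff.1 hj
  obtain ⟨e, he⟩ := Function.ne_iff.1 D.a_ne
  have ev : ∀ D' : YDatum, eval D'.vec (coeff m (valuePoly e j))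
      = D'.a e ^ 4 * coeff m (D'.form j) := by
    intro D'
    rw [← coeff_map, map_valuePoly, coeff_C_mul]
  refine ⟨coeff m (valuePoly e j), valueDeg, homCoeff_valuePoly e j m, ?_, ?_, ?_⟩
  · rw [ev]; exact mul_ne_zero (pow_ne_zero 4 he) hm
  · rintro _ ⟨D', rfl⟩ h'
    rw [D'.quadricOf_vec, D'.cubicOf_vec, ← D'.form_eq_zero_iff] at h'
    exact (ev D').trans (by rw [h']; simp)
  · intro V hV z hz
    obtain ⟨D', hD', -⟩ := hV.exists_datum hz.1
    rw [hD', ev]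
    -- If the equation did not vanish, the quotient form would be nonzero and the map regular at z,
    -- contradicting indeterminacy.
    by_contra hne
    have hf : (⟨D'.form, D'.form_mem⟩ : Omega14) ≠ 0 := fun h0 =>
      right_ne_zero_of_mul hne (by rw [show D'.form = 0 from congrArg Subtype.val h0]; simp)
    obtain ⟨c, hc, hω⟩ := P44.mk_rep_smul D'.form_mem hf
    exact hz.2 ⟨_, hV.isValue hD' hc hω⟩

/-- A set of points of a tower on which the equations of `exists_equation` vanish. -/
def Avoidable (V : Variety) (Z : Set (V.Coord → ℂ)) : Prop :=
  ∀ F : MvPolynomial YCoord ℂ,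
    (∀ z ∈ Y.cone, pairForm (Y.quadricOf z) (Y.cubicOf z) = 0 → eval z F = 0) →
    (∀ V, IsTower V → ∀ z ∈ V.indet, eval (V.baseVec z) F = 0) →
    ∀ z ∈ Z, eval (V.baseVec z) F = 0

lemma eval_baseVec (z : V.Coord → ℂ) (F : MvPolynomial YCoord ℂ) :
    eval (V.baseVec z) F = eval z (rename V.base F) := by
  rw [eval_rename]; rfl

lemma Avoidable.zcl {Z : Set (V.Coord → ℂ)} (hZ : Avoidable V Z) : Avoidable V (V.zcl Z) := by
  intro F h1 h2 z hz
  rw [eval_baseVec]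
  refine hz.2 _ fun w hw => ?_
  rw [← eval_baseVec]
  exact hZ F h1 h2 w hw

/-- The equations come from 𝕐 and involve only pulled-back coordinates, so they hold on the preimage
of W and then on its closure. -/
lemma Avoidable.strict {Z W : Set (V.Coord → ℂ)} (hW : Avoidable V W) :
    Avoidable (V.blowup Z) (V.strict Z W) := by
  refine Avoidable.zcl (V := V.blowup Z) fun F h1 h2 z hz => ?_
  have h := hW F h1 h2 (fun s => z (Sum.inl s)) hz.2.1
  exact h

lemma IsTower.avoidable_indet (hV : IsTower V) : Avoidable V V.indet :=
  fun _ _ h2 => h2 V hV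

/-- The pull-back of an equation from `exists_equation` is itself an equation of Z, which is the
separation that `IsTower.blowup` asks for. -/
lemma IsTower.blowup_of_avoidable (hV : IsTower V) {Z : Set (V.Coord → ℂ)}
    (hZ : Avoidable V Z) : IsTower (V.blowup Z) := by
  refine hV.blowup fun x hx h => ?_
  obtain ⟨F, d, hF, hne, h1, h2⟩ := exists_equation (hV.base_mem x hx) h
  obtain ⟨φ, hφ⟩ := hV.deg_base
  rw [eval_baseVec] at hne
  refine ⟨⟨rename V.base F, fun h0 => hne (by rw [h0, map_zero]),
    ⟨φ d, isWeightedHomogeneous_rename V.base φ hφ hF⟩, fun z hz => ?_⟩, hne⟩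
  rw [← eval_baseVec]
  exact hZ F h1 h2 z hz

/-! ### The four centres avoid the points with nonzero pair form -/

lemma avoidable_of_pairForm {Z : Set (Y.Coord → ℂ)}
    (h : ∀ z ∈ Z, z ∈ Y.cone ∧ pairForm (Y.quadricOf z) (Y.cubicOf z) = 0) : Avoidable Y Z :=
  fun _ h1 _ z hz => h1 z (h z hz).1 (h z hz).2

lemma avoidable_centreC : Avoidable Y centreC := by
  refine avoidable_of_pairForm ?_
  rintro _ ⟨D, rfl, α, β, r, k, -, hg, hf⟩
  refine ⟨⟨D, rfl⟩, ?_⟩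
  rw [D.quadricOf_vec, D.cubicOf_vec, hg, hf, pderiv_pair_cube]

lemma avoidable_centreE : Avoidable Y centreE := by
  refine avoidable_of_pairForm ?_
  rintro _ ⟨D, rfl, r, k, hg, hf⟩
  refine ⟨⟨D, rfl⟩, ?_⟩
  rw [D.quadricOf_vec, D.cubicOf_vec, hg, hf, pderiv_pair_cube]

lemma isTower_Y1 : IsTower Y1 := isTower_Y.blowup_of_avoidable avoidable_centreC

lemma isTower_Y2 : IsTower Y2 := isTower_Y1.blowup_of_avoidable avoidable_centreE.strict

lemma isTower_Y3 : IsTower Y3 := by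
  refine isTower_Y2.blowup_of_avoidable (Avoidable.strict (Avoidable.zcl ?_))
  exact fun F h1 h2 z hz => isTower_Y1.avoidable_indet F h1 h2 z hz.1

lemma isTower_Y4 : IsTower Y4 := isTower_Y3.blowup_of_avoidable isTower_Y3.avoidable_indet

/-! ### The normal form `ω₀` -/

lemma pairForm_std_zero (j : Fin 4) :
    pairForm (stdQuadric 0 0 (-1 / 2)) (stdCubic 0 (-1 / 2) 0 0 0 1 (-1)) j
      = - (X 0 * omega0 j) := by
  have hh : (C (1 / 2) : S) * 2 = 1 := by
    rw [← map_ofNat (C : ℂ →+* S) 2, ← C_mul]; norm_num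
  have ht : (C (1 / 3) : S) * 3 = 1 := by
    rw [← map_ofNat (C : ℂ →+* S) 3, ← C_mul]; norm_num
  have hg : stdQuadric 0 0 (-1 / 2) = X 0 * X 2 - C (1 / 2) * X 1 ^ 2 := by
    rw [stdQuadric, neg_div, C_neg]; simp; ring
  have hf : stdCubic 0 (-1 / 2) 0 0 0 1 (-1)
      = X 0 ^ 2 * X 3 - X 0 * X 1 * X 2 + C (1 / 3) * X 1 ^ 3 := by
    rw [stdCubic, show (2 / 3 * (-1 / 2) : ℂ) = - (1 / 3) by norm_num, C_neg, C_neg]; simp; ring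
  rw [hg, hf, pairForm]
  fin_cases j
  · have e1 : pderiv 0 (X 0 * X 2 - C (1 / 2) * X 1 ^ 2 : S) = X 2 := by
      simp [pderiv_X]
    have e2 : pderiv 0 (X 0 ^ 2 * X 3 - X 0 * X 1 * X 2 + C (1 / 3) * X 1 ^ 3 : S)
        = 2 * X 0 * X 3 - X 1 * X 2 := by
      simp [pderiv_X]; ring
    simp only [Fin.zero_eta, e1, e2, omega0, Matrix.cons_val]
    linear_combination (2 * X 0 * X 1 ^ 2 * X 3 - X 1 ^ 3 * X 2) * hh + X 1 ^ 3 * X 2 * ht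
  · have e1 : pderiv 1 (X 0 * X 2 - C (1 / 2) * X 1 ^ 2 : S) = - (C (1 / 2) * (2 * X 1)) := by
      simp [pderiv_X]
    have e2 : pderiv 1 (X 0 ^ 2 * X 3 - X 0 * X 1 * X 2 + C (1 / 3) * X 1 ^ 3 : S)
        = - (X 0 * X 2) + C (1 / 3) * (3 * X 1 ^ 2) := by
      simp [pderiv_X]; ring
    simp only [Fin.mk_one, e1, e2, omega0, Matrix.cons_val]
    linear_combination (- 3 * X 1 * (X 0 ^ 2 * X 3 - X 0 * X 1 * X 2 + C (1 / 3) * X 1 ^ 3)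
      - X 0 * X 1 ^ 2 * X 2 + X 1 ^ 4 * C (1 / 3) * 3) * hh - 2 * X 0 * X 2 * X 1 ^ 2 * ht
  · have e1 : pderiv 2 (X 0 * X 2 - C (1 / 2) * X 1 ^ 2 : S) = X 0 := by
      simp [pderiv_X]
    have e2 : pderiv 2 (X 0 ^ 2 * X 3 - X 0 * X 1 * X 2 + C (1 / 3) * X 1 ^ 3 : S)
        = - (X 0 * X 1) := by
      simp [pderiv_X]
    simp only [Fin.reduceFinMk, e1, e2, omega0, Matrix.cons_val]
    linear_combination (- X 0 * X 1 ^ 3) * hh + X 0 * X 1 ^ 3 * ht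
  · have e1 : pderiv 3 (X 0 * X 2 - C (1 / 2) * X 1 ^ 2 : S) = 0 := by
      simp [pderiv_X]
    have e2 : pderiv 3 (X 0 ^ 2 * X 3 - X 0 * X 1 * X 2 + C (1 / 3) * X 1 ^ 3 : S)
        = X 0 ^ 2 := by
      simp [pderiv_X]
    simp only [Fin.reduceFinMk, e1, e2, omega0, Matrix.cons_val]
    linear_combination (X 0 ^ 2 * X 1 ^ 2) * hh

lemma omega0_mem : omega0 ∈ Omega14 := by
  have h := chartDatum_isChartForm 1 0 0 (-1 / 2) 0 0 0 1 (-1) ne_std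
  have hmem := Omega14.neg_mem (chartDatum 1 0 0 (-1 / 2) 0 0 0 1 (-1) ne_std).form_mem
  convert hmem using 1
  funext j
  have hj := h j
  rw [chartQuadric_eq_sub, chartCubic_eq_sub, Units.val_one, sub_one, sub_one, pairForm_std_zero,
    neg_neg, frame_eq_sub, Units.val_one, sub_one] at hj
  exact (mul_left_cancel₀ (X_ne_zero 0) hj).symm

lemma omega0_ne_zero : omega0 ≠ 0 := by
  intro h
  have := congrArg (eval ![1, 0, 1, 0]) (congrFun h 3)
  simp [omega0] at this

lemma pairForm_chart_zero (A : GL (Fin 4) ℂ) (j : Fin 4) :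
    pairForm (chartQuadric A 0 0 (-1 / 2)) (chartCubic A 0 (-1 / 2) 0 0 0 1 (-1)) j
      = - (lin (A.1 0) * pullback A omega0 j) := by
  rw [chartQuadric_eq_sub, chartCubic_eq_sub, pairForm_sub, funext pairForm_std_zero]
  have : (fun j => - (X 0 * omega0 j)) = fun j => (- X 0) * omega0 j := by
    funext j; ring
  rw [this, pullback_mul, map_neg, sub_X]
  ring

lemma YDatum.Normal.form_eq {D : YDatum} {A : GL (Fin 4) ℂ} (h : D.Normal A) :
    ∃ c : ℂ, c ≠ 0 ∧ D.form = c • pullback A omega0 := by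
  obtain ⟨hA, ⟨r, hg⟩, ⟨k, hf⟩⟩ := h
  obtain ⟨hr, hk⟩ := YDatum.Normal.scalars_ne hg hf
  obtain ⟨l, hl, ea⟩ := hA.a_eq
  refine ⟨- (r * k) / l, div_ne_zero (by simpa using ⟨hr, hk⟩) hl, ?_⟩
  funext j
  apply mul_left_cancel₀ (lin_ne_zero D.a_ne)
  rw [D.lin_mul_form, hg, hf, pairForm_C_mul, pairForm_chart_zero, ea, lin_smul, Pi.smul_apply,
    smul_eq_C_mul]
  have : C (r * k) = - (C l * C (- (r * k) / l) : S) := by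
    rw [← C_mul, mul_div_cancel₀ _ hl, C_neg, neg_neg]
  rw [this]
  ring

lemma mem_orbit_of_smul {ω : P44} {A : GL (Fin 4) ℂ} {c c' : ℂ} (hc : c ≠ 0)
    (h : c • (ω.rep : Fin 4 → S) = c' • pullback A omega0) : ω ∈ orbit :=
  ⟨A, c⁻¹ * c', by rw [← smul_smul, ← h, smul_smul, inv_mul_cancel₀ hc, one_smul]⟩

lemma exists_mem_orbit (A : GL (Fin 4) ℂ) :
    ∃ ω ∈ orbit, ∃ c : ℂ, c ≠ 0 ∧ pullback A omega0 = c • (ω.rep : Fin 4 → S) := by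
  have hm := pullback_mem_Omega14 A omega0_mem
  have h0 : (⟨_, hm⟩ : Omega14) ≠ 0 := by
    intro h
    apply omega0_ne_zero
    apply pullback_injective A
    rw [pullback_zero]
    exact congrArg Subtype.val h
  obtain ⟨c, hc, h⟩ := P44.mk_rep_smul hm h0
  exact ⟨_, mem_orbit_of_smul hc (c' := 1) (A := A) (by rw [← h, one_smul]), c, hc, h⟩

/-! ### Consequences of density -/

lemma Represents.formAt_eq
    {P : Fin 4 → MvPolynomial (Fin 4) (MvPolynomial V.Coord ℂ)} {d : V.Deg}
    (hP : Represents V P d) {z : V.Coord → ℂ} (hz : z ∈ V.cone) {D : YDatum}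
    (hD : V.baseVec z = D.vec) (h : pairForm D.g D.f ≠ 0) : ∃ c : ℂ, V.formAt P z = c • D.form := by
  have e1 : V.planeOf z = lin D.a := by
    change Y.planeOf (V.baseVec z) = _; rw [hD, D.planeOf_vec]
  have e2 : V.quadricOf z = D.g := by
    change Y.quadricOf (V.baseVec z) = _; rw [hD, D.quadricOf_vec]
  have e3 : V.cubicOf z = D.f := by
    change Y.cubicOf (V.baseVec z) = _; rw [hD, D.cubicOf_vec]
  obtain ⟨c, hc⟩ := hP.2 z hz (by rwa [e2, e3])
  refine ⟨c, funext fun i => mul_left_cancel₀ (lin_ne_zero D.a_ne) ?_⟩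
  rw [← e1, hc, e2, e3, ← D.lin_mul_form, e1, Pi.smul_apply, smul_eq_C_mul]
  ring

lemma Represents.formAt_generic
    {P : Fin 4 → MvPolynomial (Fin 4) (MvPolynomial V.Coord ℂ)} {d : V.Deg}
    (hP : Represents V P d) {z : V.Coord → ℂ} (hz : z ∈ V.cone)
    (hg : GenericPoint (V.baseVec z)) :
    ∃ (D : YDatum) (A : GL (Fin 4) ℂ) (c : ℂ), V.baseVec z = D.vec ∧ D.Normal A ∧
      V.formAt P z = c • D.form := by
  obtain ⟨D, hD, hDz⟩ := hg
  obtain ⟨A, hA⟩ := hD.exists_normal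
  obtain ⟨c, hc⟩ := hP.formAt_eq hz hDz.symm hA.pairForm_ne_zero
  exact ⟨D, A, c, hDz.symm, hA, hc⟩

lemma IsTower.dense_map (hV : IsTower V) {τ : Type*} (E : MvPolynomial τ (MvPolynomial V.Coord ℂ))
    (hE : ∀ z ∈ V.cone, GenericPoint (V.baseVec z) → map (eval z) E = 0) :
    ∀ z ∈ V.cone, map (eval z) E = 0 := by
  intro z hz
  ext m
  rw [coeff_map, coeff_zero]
  refine hV.dense _ (fun w hw hg => ?_) z hz
  rw [← coeff_map, hE w hw hg, coeff_zero]

/-- Homogeneity and the Euler condition are closed conditions that hold at generic points, where the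
form is a multiple of a quotient form. -/
lemma Represents.formAt_mem (hV : IsTower V)
    {P : Fin 4 → MvPolynomial (Fin 4) (MvPolynomial V.Coord ℂ)} {d : V.Deg}
    (hP : Represents V P d) {z : V.Coord → ℂ} (hz : z ∈ V.cone) : V.formAt P z ∈ Omega14 := by
  have hgen : ∀ w ∈ V.cone, GenericPoint (V.baseVec w) → V.formAt P w ∈ Omega14 := by
    intro w hw hg
    obtain ⟨D, A, c, -, -, hc⟩ := hP.formAt_generic hw hg
    rw [hc]
    exact Omega14.smul_mem c D.form_mem
  refine ⟨fun i m hm => ?_, ?_⟩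
  · by_contra hdeg
    apply hm
    change coeff m (map (eval z) (P i)) = 0
    rw [coeff_map]
    refine hV.dense _ (fun w hw hg => ?_) z hz
    rw [← coeff_map]
    by_contra hne
    exact hdeg ((hgen w hw hg).1 i hne)
  · have := hV.dense_map (∑ i, X i * P i) (fun w hw hg => ?_) z hz
    · simp only [map_sum, map_mul, map_X] at this
      exact this
    · have := (hgen w hw hg).2
      simp only [map_sum, map_mul, map_X]
      exact this

/-- Two representing forms are proportional at generic points, so their 2×2 minors vanish there and
by density everywhere. -/
lemma Represents.value_unique (hV : IsTower V) {z : V.Coord → ℂ} (hz : z ∈ V.cone) {ω η : P44}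
    (hω : V.IsValue z ω) (hη : V.IsValue z η) : ω = η := by
  obtain ⟨P, d, hP, c, hc, hPz⟩ := isValue_iff.1 hω
  obtain ⟨Q, e, hQ, k, hk, hQz⟩ := isValue_iff.1 hη
  have key : ∀ i j (v w : Fin 4 → ℂ), eval v (V.formAt P z i) * eval w (V.formAt Q z j)
      = eval w (V.formAt P z j) * eval v (V.formAt Q z i) := by
    intro i j v w
    have h := hV.dense (eval (fun i => C (v i)) (P i) * eval (fun i => C (w i)) (Q j)
      - eval (fun i => C (w i)) (P j) * eval (fun i => C (v i)) (Q i)) (fun y hy hg => ?_) z hz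
    · simp only [map_sub, map_mul, eval_eval_C] at h
      exact sub_eq_zero.1 h
    · obtain ⟨D, A, c1, hD, hA, h1⟩ := hP.formAt_generic hy hg
      obtain ⟨c2, h2⟩ := hQ.formAt_eq hy hD hA.pairForm_ne_zero
      have e1 : ∀ i, map (eval y) (P i) = C c1 * D.form i := fun i => by
        rw [← smul_eq_C_mul]; exact congrFun h1 i
      have e2 : ∀ i, map (eval y) (Q i) = C c2 * D.form i := fun i => by
        rw [← smul_eq_C_mul]; exact congrFun h2 i
      simp only [map_sub, map_mul, eval_eval_C, e1, e2, eval_C]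
      ring
  obtain ⟨j, hj⟩ := Function.ne_iff.1 η.rep_ne_zero
  obtain ⟨w, hw⟩ : ∃ w, eval w ((η.rep : Fin 4 → S) j) ≠ 0 := by
    by_contra! h
    exact hj (MvPolynomial.funext fun w => by rw [h w]; simp)
  refine P44.eq_of_rep (c := eval w ((ω.rep : Fin 4 → S) j) / eval w ((η.rep : Fin 4 → S) j))
    (funext fun i => MvPolynomial.funext fun v => ?_)
  have := key i j v w
  simp only [hPz, hQz, Pi.smul_apply, smul_eval] at this
  rw [Pi.smul_apply, smul_eval, div_mul_eq_mul_div, eq_div_iff hw]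
  apply mul_left_cancel₀ (mul_ne_zero hc hk)
  linear_combination this

lemma formAt_torus {P : Fin 4 → MvPolynomial (Fin 4) (MvPolynomial V.Coord ℂ)} {d : V.Deg}
    (hP : ∀ i m, V.IsHomog (coeff m (P i)) d) (t : Multiplicative V.Deg →* ℂˣ) (z : V.Coord → ℂ) :
    V.formAt P (fun s => (t (Multiplicative.ofAdd (V.deg s)) : ℂ) * z s)
      = (t (Multiplicative.ofAdd d) : ℂ) • V.formAt P z := by
  funext i
  ext m
  rw [Pi.smul_apply, coeff_smul, Variety.formAt, Variety.formAt, coeff_map, coeff_map]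
  exact eval_torus (hP i m) t z

lemma isValue_torus (t : Multiplicative V.Deg →* ℂˣ) {z : V.Coord → ℂ} {ω : P44}
    (h : V.IsValue z ω) :
    V.IsValue (fun s => (t (Multiplicative.ofAdd (V.deg s)) : ℂ) * z s) ω := by
  obtain ⟨P, d, hP, c, hc, hPz⟩ := isValue_iff.1 h
  refine isValue_iff.2 ⟨P, d, hP, (t (Multiplicative.ofAdd d) : ℂ) * c,
    mul_ne_zero (Units.ne_zero _) hc, ?_⟩
  rw [formAt_torus hP.1, hPz, smul_smul]

lemma coords_mem (y : V.Points) : y.coords ∈ V.cone := (Quotient.out y).2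

/-- The point with given coordinates. -/
def pointOf {z : V.Coord → ℂ} (hz : z ∈ V.cone) : V.Points := Quotient.mk V.setoid ⟨z, hz⟩

lemma pointOf_coords {z : V.Coord → ℂ} (hz : z ∈ V.cone) :
    ∃ t : Multiplicative V.Deg →* ℂˣ,
      (pointOf hz).coords = fun s => (t (Multiplicative.ofAdd (V.deg s)) : ℂ) * z s := by
  obtain ⟨t, ht⟩ := V.setoid.symm (Quotient.mk_out (s := V.setoid) ⟨z, hz⟩)
  exact ⟨t, funext ht⟩

lemma points_ext {y y' : V.Points} (h : ∃ t : Multiplicative V.Deg →* ℂˣ,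
    ∀ s, y'.coords s = (t (Multiplicative.ofAdd (V.deg s)) : ℂ) * y.coords s) : y = y' := by
  rw [← Quotient.out_eq y, ← Quotient.out_eq y']
  exact Quotient.sound h

lemma mem_toP44 (hV : IsTower V) {y : V.Points} {ω : P44} :
    ω ∈ V.toP44 y ↔ V.IsValue y.coords ω := by
  constructor
  · rintro ⟨h, rfl⟩; exact h.choose_spec
  · intro h
    exact ⟨⟨ω, h⟩, Represents.value_unique hV (coords_mem y) (Exists.choose_spec _) h⟩

/-! ### The Zariski topologies -/

lemma eval_smul_of_isHomogeneous {σ : Type*} {F : MvPolynomial σ ℂ} {n : ℕ}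
    (hF : F.IsHomogeneous n) (c : ℂ) (x : σ → ℂ) : eval (c • x) F = c ^ n * eval x F := by
  rw [eval_eq, eval_eq, Finset.mul_sum]
  refine Finset.sum_congr rfl fun m hm => ?_
  have hw : m.degree = n := hF.degree_eq_sum_deg_support hm ▸ rfl
  rw [← hw]
  rw [Finsupp.degree_apply]
  simp only [Pi.smul_apply, smul_eq_mul, mul_pow, Finset.prod_mul_distrib,
    Finset.prod_pow_eq_pow_sum]
  ring

/-- The coefficients of a 1-form. -/
def coeffVec (η : Fin 4 → S) : Fin 4 × (Fin 4 →₀ ℕ) → ℂ := fun k => coeff k.2 (η k.1)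

lemma coeffVec_smul (c : ℂ) (η : Fin 4 → S) : coeffVec (c • η) = c • coeffVec η := by
  funext k; simp [coeffVec]

/-- The basic open sets of `ℙ⁴⁴`. -/
def basicP44 (F : MvPolynomial (Fin 4 × (Fin 4 →₀ ℕ)) ℂ) : Set P44 :=
  {ω : P44 | eval (coeffVec ω.rep) F ≠ 0}

lemma isTopologicalBasis_P44 : TopologicalSpace.IsTopologicalBasis
    {U : Set P44 | ∃ (F : MvPolynomial (Fin 4 × (Fin 4 →₀ ℕ)) ℂ) (n : ℕ), F.IsHomogeneous n ∧
      U = basicP44 F} := by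
  have : insert Set.univ {U : Set P44 | ∃ (F : MvPolynomial (Fin 4 × (Fin 4 →₀ ℕ)) ℂ) (n : ℕ),
      F.IsHomogeneous n ∧ U = basicP44 F} = {U : Set P44 | ∃ (F : MvPolynomial
      (Fin 4 × (Fin 4 →₀ ℕ)) ℂ) (n : ℕ), F.IsHomogeneous n ∧ U = basicP44 F} := by
    apply Set.insert_eq_of_mem
    exact ⟨1, 0, isHomogeneous_one _ _, by simp [basicP44]⟩
  rw [← this]
  refine TopologicalSpace.isTopologicalBasis_of_subbasis_of_inter rfl ?_
  rintro _ ⟨F, n, hF, rfl⟩ _ ⟨G, m, hG, rfl⟩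
  exact ⟨F * G, n + m, hF.mul hG, by ext ω; simp [basicP44]⟩

/-- The basic open sets of a variety. -/
def basicPoints (V : Variety) (F : MvPolynomial V.Coord ℂ) : Set V.Points :=
  {y | eval y.coords F ≠ 0}

lemma isTopologicalBasis_points (V : Variety) : TopologicalSpace.IsTopologicalBasis
    {U : Set V.Points | ∃ (F : MvPolynomial V.Coord ℂ) (d : V.Deg), V.IsHomog F d ∧
      U = basicPoints V F} := by
  have : insert Set.univ {U : Set V.Points | ∃ (F : MvPolynomial V.Coord ℂ) (d : V.Deg),
      V.IsHomog F d ∧ U = basicPoints V F} = {U : Set V.Points | ∃ (F : MvPolynomial V.Coord ℂ)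
      (d : V.Deg), V.IsHomog F d ∧ U = basicPoints V F} := by
    apply Set.insert_eq_of_mem
    exact ⟨1, 0, isWeightedHomogeneous_one _ _, by simp [basicPoints]⟩
  rw [← this]
  refine TopologicalSpace.isTopologicalBasis_of_subbasis_of_inter rfl ?_
  rintro _ ⟨F, n, hF, rfl⟩ _ ⟨G, m, hG, rfl⟩
  exact ⟨F * G, n + m, hF.mul hG, by ext ω; simp [basicPoints]⟩

/-- Substitution of a representing 1-form into a polynomial in the coefficients of 1-forms. -/
def substForm (P : Fin 4 → MvPolynomial (Fin 4) (MvPolynomial V.Coord ℂ))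
    (F : MvPolynomial (Fin 4 × (Fin 4 →₀ ℕ)) ℂ) : MvPolynomial V.Coord ℂ :=
  aeval (fun k => coeff k.2 (P k.1)) F

lemma eval_substForm (P : Fin 4 → MvPolynomial (Fin 4) (MvPolynomial V.Coord ℂ))
    (F : MvPolynomial (Fin 4 × (Fin 4 →₀ ℕ)) ℂ) (z : V.Coord → ℂ) :
    eval z (substForm P F) = eval (coeffVec (V.formAt P z)) F := by
  have : (eval z).comp (aeval (fun k : Fin 4 × (Fin 4 →₀ ℕ) => coeff k.2 (P k.1)) :
      MvPolynomial (Fin 4 × (Fin 4 →₀ ℕ)) ℂ →ₐ[ℂ] MvPolynomial V.Coord ℂ).toRingHom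
      = eval (coeffVec (V.formAt P z)) := by
    apply MvPolynomial.ringHom_ext
    · intro r; simp [algebraMap_eq]
    · intro k; simp [coeffVec, Variety.formAt, coeff_map]
  exact congrArg (fun φ => φ F) this

lemma substForm_isHomog {P : Fin 4 → MvPolynomial (Fin 4) (MvPolynomial V.Coord ℂ)} {d : V.Deg}
    (hP : ∀ i m, V.IsHomog (coeff m (P i)) d) {F : MvPolynomial (Fin 4 × (Fin 4 →₀ ℕ)) ℂ} {n : ℕ}
    (hF : F.IsHomogeneous n) : V.IsHomog (substForm P F) (n • d) := by
  rw [Variety.IsHomog, ← mem_weightedHomogeneousSubmodule ℂ, substForm, aeval_def, eval₂_eq]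
  refine Submodule.sum_mem _ fun m hm => ?_
  rw [mem_weightedHomogeneousSubmodule]
  have h1 : IsWeightedHomogeneous V.deg (∏ i ∈ m.support, (coeff i.2 (P i.1)) ^ m i)
      (∑ i ∈ m.support, m i • d) :=
    IsWeightedHomogeneous.prod _ _ _ fun i _ => (hP i.1 i.2).pow (m i)
  have hw : m.degree = n := hF.degree_eq_sum_deg_support hm ▸ rfl
  rw [← Finset.sum_smul, show ∑ i ∈ m.support, m i = n from hw] at h1
  rw [algebraMap_eq]
  exact h1.C_mul _

/-- A basic open set around the value pulls back, through a representing form, to a nonvanishing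
locus on the tower. This locus contains a generic point, whose form is in the orbit. -/
theorem value_mem_E3 (hV : IsTower V) {z : V.Coord → ℂ} (hz : z ∈ V.cone) {ω : P44}
    (h : V.IsValue z ω) : ω ∈ E3 := by
  obtain ⟨P, d, hP, c, hc, hPz⟩ := isValue_iff.1 h
  rw [E3, isTopologicalBasis_P44.mem_closure_iff]
  rintro _ ⟨F, n, hF, rfl⟩ hω
  have h1 : eval z (substForm P F) ≠ 0 := by
    rw [eval_substForm, hPz, coeffVec_smul, eval_smul_of_isHomogeneous hF]
    exact mul_ne_zero (pow_ne_zero n hc) hω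
  obtain ⟨w, hw, hg, hne⟩ : ∃ w ∈ V.cone, GenericPoint (V.baseVec w) ∧
      eval w (substForm P F) ≠ 0 := by
    by_contra! hall
    exact h1 (hV.dense _ hall z hz)
  obtain ⟨D, A, k, -, hA, hk⟩ := hP.formAt_generic hw hg
  obtain ⟨k', -, hk'⟩ := hA.form_eq
  obtain ⟨η, hη, k'', -, hηA⟩ := exists_mem_orbit A
  rw [eval_substForm, hk, hk', hηA, smul_smul, smul_smul, coeffVec_smul,
    eval_smul_of_isHomogeneous hF] at hne
  exact ⟨η, right_ne_zero_of_mul hne, hη⟩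

theorem dense_preimage_orbit (hV : IsTower V) :
    Dense {y : V.Points | ∃ ω ∈ V.toP44 y, ω ∈ orbit} := by
  rw [(isTopologicalBasis_points V).dense_iff]
  rintro _ ⟨F, d, hF, rfl⟩ ⟨y, hy⟩
  obtain ⟨w, hw, hg, hne⟩ : ∃ w ∈ V.cone, GenericPoint (V.baseVec w) ∧ eval w F ≠ 0 := by
    by_contra! hall
    exact hy (hV.dense _ hall _ (coords_mem y))
  obtain ⟨t, ht⟩ := pointOf_coords hw
  refine ⟨pointOf hw, ?_, ?_⟩
  · change eval (pointOf hw).coords F ≠ 0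
    rw [ht, eval_torus hF]
    exact mul_ne_zero (Units.ne_zero _) hne
  · obtain ⟨D, hD, hDw⟩ := hg
    obtain ⟨A, hA⟩ := hD.exists_normal
    obtain ⟨c, hc, hf⟩ := hA.form_eq
    obtain ⟨ω, hω, c', hc', hωA⟩ := exists_mem_orbit A
    refine ⟨ω, (mem_toP44 hV).2 ?_, hω⟩
    rw [ht]
    exact isValue_torus t (hV.isValue hDw.symm (mul_ne_zero hc hc')
      (by rw [hf, hωA, smul_smul]))

theorem isOpen_preimage_orbit (hV : IsTower V) {O : Set P44} (hO : IsOpen O)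
    (hE : O ∩ E3 = orbit) : IsOpen {y : V.Points | ∃ ω ∈ V.toP44 y, ω ∈ orbit} := by
  rw [(isTopologicalBasis_points V).isOpen_iff]
  rintro y ⟨ω, hωy, hω⟩
  obtain ⟨P, d, hP, c, hc, hPy⟩ := isValue_iff.1 ((mem_toP44 hV).1 hωy)
  rw [← hE] at hω
  obtain ⟨_, ⟨F, n, hF, rfl⟩, hωF, hFO⟩ := isTopologicalBasis_P44.exists_subset_of_mem_open hω.1 hO
  have hne : V.formAt P y.coords ≠ 0 := by
    rw [hPy]; exact smul_ne_zero hc ω.rep_ne_zero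
  obtain ⟨j, hj⟩ := Function.ne_iff.1 hne
  obtain ⟨m, hm⟩ := ne_zero_iff.1 hj
  have hcoeff : ∀ z, eval z (coeff m (P j)) = coeff m (V.formAt P z j) := fun z =>
    (coeff_map _ _ _).symm
  -- The extra factor keeps P nonzero on the neighbourhood: F may be a nonzero constant, so its
  -- nonvanishing alone does not ensure that P defines a value.
  refine ⟨_, ⟨substForm P F * coeff m (P j), _, (substForm_isHomog hP.1 hF).mul (hP.1 j m), rfl⟩,
    ?_, ?_⟩
  · change eval y.coords _ ≠ 0
    rw [map_mul, hcoeff, eval_substForm, hPy, coeffVec_smul, eval_smul_of_isHomogeneous hF, ← hPy]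
    exact mul_ne_zero (mul_ne_zero (pow_ne_zero n hc) hωF) hm
  · intro y' hy'
    change eval y'.coords _ ≠ 0 at hy'
    rw [map_mul, hcoeff, eval_substForm] at hy'
    have hmem := hP.formAt_mem hV (coords_mem y')
    have h0 : (⟨_, hmem⟩ : Omega14) ≠ 0 := by
      intro h
      have h2 : V.formAt P y'.coords = 0 := congrArg Subtype.val h
      rw [h2] at hy'
      simp at hy'
    obtain ⟨c', hc', hω'⟩ := P44.mk_rep_smul hmem h0
    have hval := isValue_iff.2 ⟨P, d, hP, c', hc', hω'⟩
    refine ⟨_, (mem_toP44 hV).2 hval, ?_⟩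
    rw [← hE]
    refine ⟨hFO ?_, value_mem_E3 hV (coords_mem y') hval⟩
    have := left_ne_zero_of_mul hy'
    rw [hω', coeffVec_smul, eval_smul_of_isHomogeneous hF] at this
    exact right_ne_zero_of_mul this

/-! ### Recovering the flag and the pair from the form -/

/-- The contraction of `ω₀` with the constant vector field `q`. -/
def contraction (q x : Fin 4 → ℂ) : ℂ :=
  q 0 * (x 1 * x 2 ^ 2 - 2 * x 1 ^ 2 * x 3 + x 0 * x 2 * x 3)
    + q 1 * (x 0 * (3 * x 1 * x 3 - 2 * x 2 ^ 2)) + q 2 * (x 0 * (x 1 * x 2 - 3 * x 0 * x 3))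
    + q 3 * (x 0 * (2 * x 0 * x 2 - x 1 ^ 2))

lemma contraction_eq (q x : Fin 4 → ℂ) : ∑ i, q i * eval x (omega0 i) = contraction q x := by
  simp [Fin.sum_univ_four, omega0, contraction]

/-- The difference h(x) of the two sides vanishes identically. Its X₂X₃-coefficient at X₀ = X₁ = 0
is q₀². After q₀ = 0 its increment in X₃ yields 3q₁², and after q₁ = 0 its increment in X₁ yields
q₂². -/
lemma eq_zero_of_contraction_invariant {q : Fin 4 → ℂ}
    (h : ∀ x, contraction q (x + q) = contraction q x) : q 0 = 0 ∧ q 1 = 0 ∧ q 2 = 0 := by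
  simp only [contraction, Pi.add_apply] at h
  have d0 := h ![0, 0, 0, 0]
  have d2 := h ![0, 0, 1, 0]
  have d3 := h ![0, 0, 0, 1]
  have d23 := h ![0, 0, 1, 1]
  have c0 := h ![1, 0, 0, 0]
  have c1 := h ![1, 1, 0, 0]
  have c3 := h ![1, 0, 0, 1]
  simp only [Matrix.cons_val] at d0 d2 d3 d23 c0 c1 c3
  have h0 : q 0 = 0 := by
    apply pow_eq_zero_iff (two_ne_zero) |>.1
    linear_combination d23 - d2 - d3 + d0
  rw [h0] at c0 c1 c3
  have h1 : q 1 = 0 := by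
    apply pow_eq_zero_iff (two_ne_zero) |>.1
    linear_combination (c3 - c0) / 3
  rw [h1] at c0 c1
  have h2 : q 2 = 0 := by
    apply pow_eq_zero_iff (two_ne_zero) |>.1
    linear_combination c1 - c0
  exact ⟨h0, h1, h2⟩

/-- A linear form dividing `X₀ (2 X₀ X₂ - X₁²)` is proportional to `X₀`. -/
lemma eq_zero_of_dvd_contraction {a : Fin 4 → ℂ}
    (h : ∀ x : Fin 4 → ℂ, a ⬝ᵥ x = 0 → x 0 * (2 * x 0 * x 2 - x 1 ^ 2) = 0) :
    a 1 = 0 ∧ a 2 = 0 ∧ a 3 = 0 := by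
  simp only [dotProduct, Fin.sum_univ_four] at h
  have h3 : a 3 = 0 := by
    by_contra h3
    have := h ![1, 0, 1, - (a 0 + a 2) / a 3] (by simp only [Matrix.cons_val]; field_simp; ring)
    simp only [Matrix.cons_val] at this
    norm_num at this
  have h2 : a 2 = 0 := by
    by_contra h2
    have e0 := h ![1, 0, - a 0 / a 2, 0] (by simp only [Matrix.cons_val]; field_simp; ring)
    have e1 := h ![1, 1, - (a 0 + a 1) / a 2, 0] (by simp only [Matrix.cons_val]; field_simp; ring)
    have e2 := h ![1, -1, - (a 0 - a 1) / a 2, 0] (by simp only [Matrix.cons_val]; field_simp; ring)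
    simp only [Matrix.cons_val] at e0 e1 e2
    have : (2 : ℂ) = 0 := by
      linear_combination (exp := 1) 2 * e0 - e1 - e2
    exact two_ne_zero this
  refine ⟨?_, h2, h3⟩
  by_contra h1
  have e0 := h ![a 1, - a 0, 0, 0] (by simp only [Matrix.cons_val]; ring)
  have e1 := h ![a 1, - a 0, 1, 0] (by simp only [Matrix.cons_val, h2]; ring)
  simp only [Matrix.cons_val] at e0 e1
  have : a 1 ^ 2 = 0 := by linear_combination (e1 - e0) / 2
  exact h1 (pow_eq_zero_iff two_ne_zero |>.1 this)

/-! ### Contraction of the form of a datum with the point of its flag -/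

namespace YDatum

variable (D : YDatum)

lemma sum_q_mul (x : Fin 4 → ℂ) : ∑ i, C (D.q i) * C (x i) = (C (x ⬝ᵥ D.q) : S) := by
  rw [dotProduct, map_sum]
  exact Finset.sum_congr rfl fun i _ => by rw [C_mul]; ring

lemma sum_q_pderiv_g : ∑ i, C (D.q i) * pderiv i D.g = 0 := by
  have h : ∀ i, C (D.q i) * pderiv i D.g
      = (C (D.s 0) * (2 * lin D.a) + C (D.s 1) * (C (D.u 0) * lin D.b + C (D.u 1) * lin D.c))
        * (C (D.q i) * C (D.a i))
      + (C (D.s 1) * (C (D.u 0) * lin D.a + C (D.u 2) * (2 * lin D.b))) * (C (D.q i) * C (D.b i))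
      + (C (D.s 1) * (C (D.u 1) * lin D.a)) * (C (D.q i) * C (D.c i)) := by
    intro i; rw [D.pderiv_g]; ring
  simp only [h, Finset.sum_add_distrib, ← Finset.mul_sum, D.sum_q_mul, D.q_mem.1, D.q_mem.2.1,
    D.q_mem.2.2, C_0, mul_zero, add_zero]

lemma sum_q_pderiv_f : ∑ i, C (D.q i) * pderiv i D.f = lin D.a ^ 2 * C (D.m ⬝ᵥ D.q) := by
  have h : ∀ i, C (D.q i) * pderiv i D.f
      = (2 * lin D.a * lin D.m + C D.t * (C (3 * D.u 0) * lin D.b ^ 2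
        + C (3 * D.u 1) * (lin D.b * lin D.c))) * (C (D.q i) * C (D.a i))
      + (C D.t * (C (3 * D.u 0) * (lin D.a * (2 * lin D.b)) + C (3 * D.u 1) * (lin D.a * lin D.c)
        + C (2 * D.u 2) * (3 * lin D.b ^ 2))) * (C (D.q i) * C (D.b i))
      + (C D.t * (C (3 * D.u 1) * (lin D.a * lin D.b))) * (C (D.q i) * C (D.c i))
      + lin D.a ^ 2 * (C (D.q i) * C (D.m i)) := by
    intro i; rw [D.pderiv_f]; ring
  simp only [h, Finset.sum_add_distrib, ← Finset.mul_sum, D.sum_q_mul, D.q_mem.1, D.q_mem.2.1,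
    D.q_mem.2.2, C_0, mul_zero, zero_add]

/-- The forms a, b, c vanish at q, so differentiation along q kills g and leaves only the a²m term
of f. The contraction thus displays the plane and the quadric as factors. -/
lemma sum_q_form : ∑ i, C (D.q i) * D.form i = C (-2 * (D.m ⬝ᵥ D.q)) * (lin D.a * D.g) := by
  apply mul_left_cancel₀ (lin_ne_zero D.a_ne)
  have : lin D.a * ∑ i, C (D.q i) * D.form i = 3 * D.f * (∑ i, C (D.q i) * pderiv i D.g)
      - 2 * D.g * ∑ i, C (D.q i) * pderiv i D.f := by
    simp only [Finset.mul_sum, ← Finset.sum_sub_distrib]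
    refine Finset.sum_congr rfl fun i _ => ?_
    rw [mul_left_comm, D.lin_mul_form, pairForm]; ring
  rw [this, D.sum_q_pderiv_g, D.sum_q_pderiv_f, C_mul, C_neg, map_ofNat]
  ring

end YDatum

/-- A universal polynomial on a tower. -/
def liftGen (V : Variety) (E : Gen) : MvPolynomial (Fin 4) (MvPolynomial V.Coord ℂ) :=
  map (rename V.base : MvPolynomial YCoord ℂ →ₐ[ℂ] MvPolynomial V.Coord ℂ).toRingHom E

lemma map_liftGen (E : Gen) (z : V.Coord → ℂ) :
    map (eval z) (liftGen V E) = map (eval (V.baseVec z)) E := by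
  have : (eval z).comp (rename V.base : MvPolynomial YCoord ℂ →ₐ[ℂ] MvPolynomial V.Coord ℂ).toRingHom
      = eval (V.baseVec z) := by
    apply MvPolynomial.ringHom_ext
    · intro r; simp
    · intro k; simp [Variety.baseVec]
  rw [liftGen, map_map, this]

/-! ### Proportionalities extended by density to all points of a tower -/

section Relations

variable {P : Fin 4 → MvPolynomial (Fin 4) (MvPolynomial V.Coord ℂ)} {d : V.Deg}

lemma Represents.contraction_rel (hV : IsTower V) (hP : Represents V P d) {z : V.Coord → ℂ}
    (hz : z ∈ V.cone) {D : YDatum} (hD : V.baseVec z = D.vec) (v w : Fin 4 → ℂ) :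
    (∑ i, D.q i * eval v (V.formAt P z i)) * eval w (lin D.a * D.g)
      = (∑ i, D.q i * eval w (V.formAt P z i)) * eval v (lin D.a * D.g) := by
  let K : (Fin 4 → ℂ) → MvPolynomial V.Coord ℂ := fun v =>
    ∑ i, X (V.base (.point i)) * eval (fun i => C (v i)) (P i)
  let L : (Fin 4 → ℂ) → MvPolynomial V.Coord ℂ := fun v =>
    eval (fun i => C (v i)) (liftGen V (genPlane * genQuadric))
  have hK : ∀ (y : V.Coord → ℂ) (D : YDatum) (v), V.baseVec y = D.vec →
      eval y (K v) = ∑ i, D.q i * eval v (V.formAt P y i) := by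
    intro y D v hy
    simp only [K, map_sum, map_mul, eval_X, eval_eval_C]
    refine Finset.sum_congr rfl fun i _ => ?_
    have : y (V.base (.point i)) = D.q i := congrFun hy (.point i)
    rw [this]; rfl
  have hL : ∀ (y : V.Coord → ℂ) (D : YDatum) (v), V.baseVec y = D.vec →
      eval y (L v) = eval v (lin D.a * D.g) := by
    intro y D v hy
    simp only [L]
    rw [eval_eval_C, map_liftGen, map_mul, map_genPlane, map_genQuadric, hy, D.quadricOf_vec,
      D.planeOf_vec]
  have h := hV.dense (K v * L w - K w * L v) (fun y hy hg => ?_) z hz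
  · rw [map_sub, map_mul, map_mul, hK z D v hD, hK z D w hD, hL z D v hD, hL z D w hD] at h
    exact sub_eq_zero.1 h
  · obtain ⟨E, A, c, hE, hA, hc⟩ := hP.formAt_generic hy hg
    have : ∀ v, ∑ i, E.q i * eval v (V.formAt P y i)
        = c * eval v (C (-2 * (E.m ⬝ᵥ E.q)) * (lin E.a * E.g)) := by
      intro v
      rw [← E.sum_q_form, map_sum, Finset.mul_sum]
      refine Finset.sum_congr rfl fun i _ => ?_
      rw [hc, Pi.smul_apply, smul_eval, map_mul, eval_C]
      ring
    rw [map_sub, map_mul, map_mul, hK y E v hE, hK y E w hE, hL y E v hE, hL y E w hE, this, this,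
      map_mul (eval v) (C _), map_mul (eval w) (C _), eval_C, eval_C]
    ring

/-- Stated as a cross-multiplied relation, it remains meaningful where the pair form vanishes, and
so it can be used before that case is excluded. -/
lemma Represents.pairForm_rel (hV : IsTower V) (hP : Represents V P d) {z : V.Coord → ℂ}
    (hz : z ∈ V.cone) {D : YDatum} (hD : V.baseVec z = D.vec) (i j : Fin 4) (v w : Fin 4 → ℂ) :
    eval v (lin D.a * V.formAt P z i) * eval w (pairForm D.g D.f j)
      = eval w (lin D.a * V.formAt P z j) * eval v (pairForm D.g D.f i) := by
  let K : Fin 4 → (Fin 4 → ℂ) → MvPolynomial V.Coord ℂ := fun i v =>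
    eval (fun i => C (v i)) (liftGen V genPlane * P i)
  let L : Fin 4 → (Fin 4 → ℂ) → MvPolynomial V.Coord ℂ := fun i v =>
    eval (fun i => C (v i)) (liftGen V (genPair i))
  have hK : ∀ (y : V.Coord → ℂ) (D : YDatum) (i v), V.baseVec y = D.vec →
      eval y (K i v) = eval v (lin D.a * V.formAt P y i) := by
    intro y D i v hy
    simp only [K]
    rw [eval_eval_C, map_mul, map_liftGen, map_genPlane, hy, D.planeOf_vec]
    rfl
  have hL : ∀ (y : V.Coord → ℂ) (D : YDatum) (i v), V.baseVec y = D.vec →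
      eval y (L i v) = eval v (pairForm D.g D.f i) := by
    intro y D i v hy
    simp only [L]
    rw [eval_eval_C, map_liftGen, map_genPair, hy, D.quadricOf_vec, D.cubicOf_vec]
  have h := hV.dense (K i v * L j w - K j w * L i v) (fun y hy hg => ?_) z hz
  · rw [map_sub, map_mul, map_mul, hK z D i v hD, hK z D j w hD, hL z D i v hD, hL z D j w hD] at h
    exact sub_eq_zero.1 h
  · obtain ⟨E, A, c, hE, hA, hc⟩ := hP.formAt_generic hy hg
    have : ∀ i v, eval v (lin E.a * V.formAt P y i) = c * eval v (pairForm E.g E.f i) := by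
      intro i v
      rw [← E.lin_mul_form, hc, Pi.smul_apply, smul_eq_C_mul, map_mul, map_mul, map_mul, eval_C]
      ring
    rw [map_sub, map_mul, map_mul, hK y E i v hE, hK y E j w hE, hL y E i v hE, hL y E j w hE, this,
      this]
    ring

end Relations

lemma dotProduct_eq_dual (A : GL (Fin 4) ℂ) (a v : Fin 4 → ℂ) :
    a ⬝ᵥ v = (fun k => a ⬝ᵥ dualVec A k) ⬝ᵥ A.1.mulVec v := by
  conv_lhs => rw [eq_sum_rows A a]
  rw [sum_dotProduct]
  simp only [smul_dotProduct, smul_eq_mul]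
  rfl

lemma eval_sum_pullback (A : GL (Fin 4) ℂ) (q v : Fin 4 → ℂ) (ω : Fin 4 → S) :
    ∑ i, q i * eval v (pullback A ω i) = ∑ k, A.1.mulVec q k * eval (A.1.mulVec v) (ω k) := by
  simp only [pullback_apply, map_sum, map_mul, eval_C, eval_sub, Finset.mul_sum]
  rw [Finset.sum_comm]
  refine Finset.sum_congr rfl fun k _ => ?_
  rw [Matrix.mulVec, dotProduct, Finset.sum_mul]
  exact Finset.sum_congr rfl fun i _ => by ring

/-- The quadric and the flag are determined by the contraction with the point. -/
lemma YDatum.flag_of_contraction (D : YDatum) (A : GL (Fin 4) ℂ) {l : ℂ}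
    (h : ∀ v, ∑ i, D.q i * eval v (pullback A omega0 i) = l * eval v (lin D.a * D.g)) :
    ∃ (x y z r : ℂ), r ≠ 0 ∧ y ≠ 0 ∧ D.a = x • A.1 0 ∧ D.b = y • A.1 1 + z • A.1 0 ∧
      D.g = C r * chartQuadric A 0 0 (-1 / 2) ∧ D.Adapted A := by
  set q := A.1.mulVec D.q with hq
  set a : Fin 4 → ℂ := fun k => D.a ⬝ᵥ dualVec A k with ha
  set b : Fin 4 → ℂ := fun k => D.b ⬝ᵥ dualVec A k with hb
  set c : Fin 4 → ℂ := fun k => D.c ⬝ᵥ dualVec A k with hc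
  have hA := exists_mulVec_eq A
  let G : (Fin 4 → ℂ) → ℂ := fun x => D.s 0 * (a ⬝ᵥ x) ^ 2 + D.s 1 * (D.u 0 * (a ⬝ᵥ x) * (b ⬝ᵥ x)
      + D.u 1 * (a ⬝ᵥ x) * (c ⬝ᵥ x) + D.u 2 * (b ⬝ᵥ x) ^ 2)
  have hG : ∀ v, eval v D.g = G (A.1.mulVec v) := by
    intro v
    rw [D.eval_g, dotProduct_eq_dual A D.a, dotProduct_eq_dual A D.b, dotProduct_eq_dual A D.c]
  have hK : ∀ x, contraction q x = l * ((a ⬝ᵥ x) * G x) := by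
    intro x
    obtain ⟨v, rfl⟩ := hA x
    rw [← contraction_eq, ← eval_sum_pullback, h, map_mul, hG, eval_lin, dotProduct_eq_dual A D.a]
  have qa : a ⬝ᵥ q = 0 := by rw [← D.q_mem.1, dotProduct_eq_dual A D.a]
  have qb : b ⬝ᵥ q = 0 := by rw [← D.q_mem.2.1, dotProduct_eq_dual A D.b]
  have qc : c ⬝ᵥ q = 0 := by rw [← D.q_mem.2.2, dotProduct_eq_dual A D.c]
  -- The product h·g depends only on a, b, c, which vanish at q, so the contraction is invariant
  -- under translation by q.
  obtain ⟨q0, q1, q2⟩ := eq_zero_of_contraction_invariant (q := q) (fun x => by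
    rw [hK, hK]
    simp only [G, dotProduct_add, qa, qb, qc, add_zero])
  have q3 : q 3 ≠ 0 := by
    intro q3
    apply D.q_ne
    rw [eq_sum_dualVec A D.q, Fin.sum_univ_four]
    have : ∀ k, A.1 k ⬝ᵥ D.q = q k := fun k => rfl
    simp [this, q0, q1, q2, q3]
  have hK' : ∀ x, q 3 * (x 0 * (2 * x 0 * x 2 - x 1 ^ 2)) = l * ((a ⬝ᵥ x) * G x) := by
    intro x
    rw [← hK, contraction, q0, q1, q2]
    ring
  obtain ⟨a1, a2, a3⟩ := eq_zero_of_dvd_contraction (a := a) (fun x hx => by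
    have := hK' x
    rw [hx, zero_mul, mul_zero] at this
    exact (mul_eq_zero.1 this).resolve_left q3)
  have hax : ∀ x, a ⬝ᵥ x = a 0 * x 0 := by
    intro x
    rw [dotProduct, Fin.sum_univ_four, a1, a2, a3]
    ring
  have ea : D.a = a 0 • A.1 0 := by
    rw [eq_sum_rows A D.a, Fin.sum_univ_four]
    have : ∀ k, D.a ⬝ᵥ dualVec A k = a k := fun k => rfl
    simp [this, a1, a2, a3]
  have a0 : a 0 ≠ 0 := fun h0 => D.a_ne (by rw [ea, h0, zero_smul])
  -- The scalar l is not assumed nonzero; at (1, 0, 1, 0) the contraction equals 2q₃, which excludes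
  -- zero.
  have la : l * a 0 ≠ 0 := by
    intro h0
    have := hK' ![1, 0, 1, 0]
    rw [hax] at this
    simp only [Matrix.cons_val] at this
    apply q3
    linear_combination this / 2 + G ![1, 0, 1, 0] / 2 * h0
  have hl : l ≠ 0 := left_ne_zero_of_mul la
  have hgp : D.g = C (2 * q 3 / (l * a 0)) * chartQuadric A 0 0 (-1 / 2) := by
    apply mul_left_cancel₀ (lin_ne_zero D.a_ne)
    apply MvPolynomial.funext
    intro v
    have := hK' (A.1.mulVec v)
    rw [hax, ← hG] at this
    have hf : ∀ k, A.1 k ⬝ᵥ v = A.1.mulVec v k := fun k => rfl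
    simp only [map_mul, ea, chartQuadric, frame, map_add, map_pow, eval_C, eval_lin,
      smul_dotProduct, smul_eq_mul, hf]
    field_simp
    linear_combination -this
  have hGx : ∀ x, G x = 2 * q 3 / (l * a 0) * (x 0 * x 2 - 1 / 2 * x 1 ^ 2) := by
    intro x
    obtain ⟨v, rfl⟩ := hA x
    rw [← hG, hgp]
    have hf : ∀ k, A.1 k ⬝ᵥ v = A.1.mulVec v k := fun k => rfl
    simp only [map_mul, chartQuadric, frame, map_add, map_pow, eval_C, eval_lin, hf]
    ring
  have hr : 2 * q 3 / (l * a 0) ≠ 0 := div_ne_zero (mul_ne_zero two_ne_zero q3) la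
  -- On the plane the quadric restricts to s₁u₂b², while it is also a nonzero multiple of x₁². Hence
  -- b vanishes on x₀ = x₁ = 0, and ℓ is recovered.
  have hb2 : ∀ x : Fin 4 → ℂ, x 0 = 0 → x 1 = 0 → b ⬝ᵥ x = 0 := by
    intro x hx0 hx1
    have e1 := hGx x
    have e2 := hGx ![0, 1, 0, 0]
    simp only [G, hax, hx0, hx1] at e1
    simp only [G, hax, Matrix.cons_val] at e2
    have hne : D.s 1 * D.u 2 ≠ 0 := by
      intro h0
      apply hr
      linear_combination 2 * e2 - 2 * (b ⬝ᵥ ![0, 1, 0, 0]) ^ 2 * h0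
    have : D.s 1 * D.u 2 * (b ⬝ᵥ x) ^ 2 = 0 := by linear_combination e1
    exact pow_eq_zero_iff two_ne_zero |>.1 ((mul_eq_zero.1 this).resolve_left hne)
  have b2 : b 2 = 0 := by
    have := hb2 ![0, 0, 1, 0] rfl rfl
    simpa [dotProduct, Fin.sum_univ_four] using this
  have b3 : b 3 = 0 := by
    have := hb2 ![0, 0, 0, 1] rfl rfl
    simpa [dotProduct, Fin.sum_univ_four] using this
  have eb : D.b = b 1 • A.1 1 + b 0 • A.1 0 := by
    rw [eq_sum_rows A D.b, Fin.sum_univ_four]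
    have : ∀ k, D.b ⬝ᵥ dualVec A k = b k := fun k => rfl
    simp [this, b2, b3, add_comm]
  have b1 : b 1 ≠ 0 := by
    intro h0
    have h1 : b 0 • D.a + (- a 0) • D.b = 0 := by
      rw [ea, eb, h0]
      simp [smul_smul, mul_comm]
    exact a0 (neg_eq_zero.1 (D.not_parallel h1).2)
  exact ⟨a 0, b 1, b 0, _, hr, b1, ea, eb, hgp, D.adapted_of A a0 b1 ea eb q2⟩

/-- A special cubic paired with the quadric `g₀` has the shape of a chart. -/
lemma YDatum.exists_chartCubic (D : YDatum) (A : GL (Fin 4) ℂ) {x y z r : ℂ}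
    (ea : D.a = x • A.1 0) (eb : D.b = y • A.1 1 + z • A.1 0)
    (hg : D.g = C r * chartQuadric A 0 0 (-1 / 2)) :
    ∃ a0 a1 a2 a3 a5 : ℂ, D.f = chartCubic A 0 (-1 / 2) a0 a1 a2 a3 a5 := by
  have hs := (D.chart_data ea hg).2
  have hf : ∀ v k, A.1 k ⬝ᵥ v = A.1.mulVec v k := fun v k => rfl
  have hg' : ∀ v, _ := fun v => (D.eval_g v).symm.trans (congrArg (eval v) hg)
  simp only [map_mul, chartQuadric, frame, map_add, map_pow, eval_C, eval_lin, ea, eb,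
    add_dotProduct, smul_dotProduct, smul_eq_mul, hf] at hg'
  have hu : D.s 1 * D.u 2 * y ^ 2 = - r / 2 := by
    obtain ⟨v, hv⟩ := exists_mulVec_eq A ![0, 1, 0, 0]
    have := hg' v
    rw [hv] at this
    simp only [Matrix.cons_val] at this
    linear_combination this
  set m : Fin 4 → ℂ := fun k => D.m ⬝ᵥ dualVec A k
  -- Since g = s₀a² + s₁g', the cubic is f = a²m + 3tb(g − s₀a²)/s₁ − tu₂b³. Substituting b = yx₁ +
  -- zx₀ gives these coefficients; the x₀x₁² terms cancel by `hu`.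
  refine ⟨x ^ 2 * m 0 - 3 * D.t * D.s 0 * x ^ 2 * z / D.s 1 - D.t * D.u 2 * z ^ 3,
    x ^ 2 * m 1 - 3 * D.t * D.s 0 * x ^ 2 * y / D.s 1 - 3 * D.t * D.u 2 * z ^ 2 * y,
    x ^ 2 * m 2 + 3 * r * D.t * z / D.s 1, x ^ 2 * m 3, 3 * r * D.t * y / D.s 1,
    MvPolynomial.funext fun v => ?_⟩
  rw [D.eval_f, dotProduct_eq_dual A D.m]
  have h := hg' v
  simp only [map_mul, chartCubic, frame, map_add, map_pow, eval_C, eval_lin, ea, eb,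
    add_dotProduct, smul_dotProduct, smul_eq_mul, hf]
  rw [dotProduct, Fin.sum_univ_four]
  change _ * (m 0 * _ + m 1 * _ + m 2 * _ + m 3 * _) + _ = _
  generalize A.1.mulVec v = w at *
  generalize D.c ⬝ᵥ v = γ at *
  apply mul_left_cancel₀ hs
  field_simp
  linear_combination 3 * D.t * (y * w 1 + z * w 0) * h
    - D.t * (3 * z * w 0 * w 1 ^ 2 + y * w 1 ^ 3) * hu

lemma isChartForm_pullback (A : GL (Fin 4) ℂ) :
    IsChartForm A 0 0 (-1 / 2) 0 0 0 1 (-1) (pullback A omega0) := by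
  intro j
  rw [pairForm_chart_zero, neg_neg]
  rfl

/-- The form `ω₀` determines the flag and the special pair. -/
theorem normal_of_value (hV : IsTower V) {z : V.Coord → ℂ} (hz : z ∈ V.cone) {D : YDatum}
    (hD : V.baseVec z = D.vec) {ω : P44} (h : V.IsValue z ω) {A : GL (Fin 4) ℂ} {c : ℂ}
    (hω : (ω.rep : Fin 4 → S) = c • pullback A omega0) : D.Normal A := by
  obtain ⟨P, d, hP, k, hk, hPz⟩ := isValue_iff.1 h
  have hc : c ≠ 0 := fun h0 => ω.rep_ne_zero (by rw [hω, h0, zero_smul])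
  rw [hω, smul_smul] at hPz
  have hkc := mul_ne_zero hk hc
  set κ := k * c
  have hag : lin D.a * D.g ≠ 0 := mul_ne_zero (lin_ne_zero D.a_ne) D.g_ne_zero
  obtain ⟨w, hw⟩ : ∃ w, eval w (lin D.a * D.g) ≠ 0 := by
    by_contra! h
    exact hag (MvPolynomial.funext fun w => by rw [h w]; simp)
  -- The proportionality factor is read off at one vector w where h·g does not vanish.
  obtain ⟨x, y, t, r, hr, hy, ea, eb, hg, hA⟩ := D.flag_of_contraction A
    (l := (∑ i, D.q i * eval w (pullback A omega0 i)) / eval w (lin D.a * D.g)) (fun v => by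
      have := hP.contraction_rel hV hz hD v w
      simp only [hPz, Pi.smul_apply, smul_eval, mul_left_comm _ κ, ← Finset.mul_sum] at this
      rw [div_mul_eq_mul_div, eq_div_iff hw]
      apply mul_left_cancel₀ hkc
      linear_combination this)
  refine ⟨hA, ⟨r, hg⟩, ?_⟩
  obtain ⟨a0, a1, a2, a3, a5, hf⟩ := D.exists_chartCubic A ea eb hg
  have hne : (fun j => lin D.a * pullback A omega0 j) ≠ 0 := by
    intro h0
    apply omega0_ne_zero
    apply pullback_injective A
    rw [pullback_zero]
    funext j
    exact (mul_eq_zero.1 (congrFun h0 j)).resolve_left (lin_ne_zero D.a_ne)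
  obtain ⟨j, hj⟩ := Function.ne_iff.1 hne
  obtain ⟨w', hw'⟩ : ∃ w', eval w' (lin D.a * pullback A omega0 j) ≠ 0 := by
    by_contra! h
    exact hj (MvPolynomial.funext fun w => by rw [h w]; simp)
  set μ := eval w' (pairForm D.g D.f j) / eval w' (lin D.a * pullback A omega0 j)
  have hpair : ∀ i, pairForm D.g D.f i = C μ * (lin D.a * pullback A omega0 i) := by
    intro i
    refine MvPolynomial.funext fun v => ?_
    have := hP.pairForm_rel hV hz hD i j v w'
    simp only [hPz, Pi.smul_apply, map_mul, smul_eval] at this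
    rw [map_mul, eval_C]
    simp only [μ]
    rw [div_mul_eq_mul_div, eq_div_iff hw']
    apply mul_left_cancel₀ hkc
    rw [map_mul, map_mul]
    linear_combination -this
  -- With g known, the pair form is linear in f. A multiple of the pulled-back ω₀ is therefore the
  -- chart form of f, and comparing coefficients of dx₂ makes f a multiple of f₀.
  have hη : IsChartForm A 0 0 (-1 / 2) a0 a1 a2 a3 a5
      (fun i => C (- (μ * x / r)) * pullback A omega0 i) := by
    intro i
    have h1 := hpair i
    have h2 := pairForm_C_mul r 1 (chartQuadric A 0 0 (-1 / 2))
      (chartCubic A 0 (-1 / 2) a0 a1 a2 a3 a5) i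
    rw [C_1, one_mul, mul_one, ← hg, ← hf, h1, hf, ea, lin_smul] at h2
    apply mul_left_cancel₀ (C_ne_zero.2 hr)
    rw [mul_neg, ← h2]
    have : C (- (μ * x / r)) * C r = (- (C μ * C x) : S) := by
      rw [← C_mul, ← C_mul, ← C_neg, neg_mul, div_mul_cancel₀ _ hr]
    rw [frame]
    linear_combination lin (A.1 0) * pullback A omega0 i * this
  have e2 := hη.dCoeff_two
  rw [dCoeff_mul, (isChartForm_pullback A).dCoeff_two] at e2
  nth_rewrite 1 [← sub_C A.1] at e2
  rw [← map_mul] at e2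
  obtain ⟨k0, k1, k2, k5, k3⟩ := stdCoeff_eq (sub_injective A e2).symm
  refine ⟨- (μ * x / r), ?_⟩
  have z0 : a0 = 0 := by linear_combination - k0 / 3
  have z1 : a1 = 0 := by linear_combination - k1 / 3
  rw [hf, z0, z1, k2, k5, k3]
  simp only [chartCubic, C_mul, C_0, C_1, C_neg]
  ring

/-- One frame A, taken from the orbit description of ω, normalizes both points, so their base points
agree modulo the torus. The pair form there is nonzero, so the fibre is a single point. -/
theorem value_injective (hV : IsTower V) {y y' : V.Points} {ω : P44} (hω : ω ∈ orbit)
    (h : ω ∈ V.toP44 y) (h' : ω ∈ V.toP44 y') : y = y' := by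
  obtain ⟨A, c, hc⟩ := hω
  obtain ⟨D, hD, -, h2, h3⟩ := hV.exists_datum (coords_mem y)
  obtain ⟨D', hD', -⟩ := hV.exists_datum (coords_mem y')
  have hN := normal_of_value hV (coords_mem y) hD ((mem_toP44 hV).1 h) hc
  have hN' := normal_of_value hV (coords_mem y') hD' ((mem_toP44 hV).1 h') hc
  apply points_ext
  apply hV.unique _ (coords_mem y) _ (coords_mem y')
  · rw [h2, h3]
    exact hN.pairForm_ne_zero
  · obtain ⟨hA, ⟨r, hr⟩, ⟨k, hk⟩⟩ := hN
    obtain ⟨hA', ⟨r', hr'⟩, ⟨k', hk'⟩⟩ := hN'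
    rw [hD, hD']
    exact (D.torusEquiv_chart hA hr hk).symm.trans (D'.torusEquiv_chart hA' hr' hk')

/-! ### The singular locus -/

/-- The affine cone over the union of the conic, the line and the twisted cubic. -/
def InCurves (x : Fin 4 → ℂ) : Prop :=
  (x 0 = 0 ∧ x 2 ^ 2 - 2 * x 1 * x 3 = 0) ∨ (x 0 = 0 ∧ x 1 = 0) ∨
    (2 * x 2 ^ 2 - 3 * x 1 * x 3 = 0 ∧ x 1 * x 2 - 3 * x 0 * x 3 = 0 ∧ x 1 ^ 2 - 2 * x 0 * x 2 = 0)

lemma InCurves.smul {x : Fin 4 → ℂ} (h : InCurves x) (c : ℂ) : InCurves (c • x) := by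
  simp only [InCurves, Pi.smul_apply, smul_eq_mul]
  rcases h with ⟨h1, h2⟩ | ⟨h1, h2⟩ | ⟨h1, h2, h3⟩
  · exact Or.inl ⟨by rw [h1, mul_zero], by linear_combination c ^ 2 * h2⟩
  · exact Or.inr (Or.inl ⟨by rw [h1, mul_zero], by rw [h2, mul_zero]⟩)
  · exact Or.inr (Or.inr ⟨by linear_combination c ^ 2 * h1, by linear_combination c ^ 2 * h2,
      by linear_combination c ^ 2 * h3⟩)

lemma omega0_eval_eq_zero_iff (x : Fin 4 → ℂ) :
    (∀ i, eval x (omega0 i) = 0) ↔ InCurves x := by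
  simp only [Fin.forall_fin_succ, omega0, Matrix.cons_val_zero, Matrix.cons_val_succ, map_add,
    map_sub, map_mul, map_pow, eval_X, map_ofNat, InCurves, IsEmpty.forall_iff, and_true]
  constructor
  · rintro ⟨h0, h1, h2, h3⟩
    by_cases hx : x 0 = 0
    · rw [hx] at h0
      have : x 1 * (x 2 ^ 2 - 2 * x 1 * x 3) = 0 := by linear_combination h0
      rcases mul_eq_zero.1 this with h | h
      · exact Or.inr (Or.inl ⟨hx, h⟩)
      · exact Or.inl ⟨hx, h⟩
    · refine Or.inr (Or.inr ⟨?_, ?_, ?_⟩)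
      · linear_combination -(mul_eq_zero.1 h1).resolve_left hx
      · exact (mul_eq_zero.1 h2).resolve_left hx
      · linear_combination -(mul_eq_zero.1 h3).resolve_left hx
  · rintro (⟨h1, h2⟩ | ⟨h1, h2⟩ | ⟨h1, h2, h3⟩)
    · simp only [h1, zero_mul, and_self, and_true]
      linear_combination x 1 * h2
    · simp [h1, h2]
    · refine ⟨?_, ?_, ?_, ?_⟩
      · linear_combination 2 / 3 * x 1 * h1 - x 2 / 3 * h2
      · linear_combination -x 0 * h1
      · linear_combination x 0 * h2
      · linear_combination -x 0 * h3

/-- Contracting the pull-back with the dual basis of the rows of A isolates each coefficient of ω at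
the image of v. -/
lemma pullback_eval_eq_zero_iff (A : GL (Fin 4) ℂ) (ω : Fin 4 → S) (v : Fin 4 → ℂ) :
    (∀ i, eval v (pullback A ω i) = 0) ↔ ∀ k, eval (A.1.mulVec v) (ω k) = 0 := by
  constructor
  · intro h k
    have := eval_sum_pullback A (dualVec A k) v ω
    simp only [h, mul_zero, Finset.sum_const_zero] at this
    rw [this, Finset.sum_eq_single k]
    · rw [Matrix.mulVec, row_dotProduct_dualVec, if_pos rfl, one_mul]
    · intro b _ hb
      rw [Matrix.mulVec, row_dotProduct_dualVec, if_neg hb, zero_mul]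
    · simp
  · intro h i
    simp only [pullback_apply, map_sum, map_mul, eval_sub, h, mul_zero, Finset.sum_const_zero]

lemma singularLocus_eq {ω : P44} {A : GL (Fin 4) ℂ} {c : ℂ}
    (hω : (ω.rep : Fin 4 → S) = c • pullback A omega0) : singularLocus ω = threeCurves A := by
  have hc : c ≠ 0 := fun h0 => ω.rep_ne_zero (by rw [hω, h0, zero_smul])
  ext v
  change (∀ i, _) ↔ InCurves (A.1.mulVec v.rep)
  rw [← omega0_eval_eq_zero_iff, ← pullback_eval_eq_zero_iff, hω]
  simp only [Pi.smul_apply, smul_eval, mul_eq_zero, hc, false_or]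

lemma mk_mem_threeCurves (A : GL (Fin 4) ℂ) {v : Fin 4 → ℂ} (hv : v ≠ 0) :
    Projectivization.mk ℂ v hv ∈ threeCurves A ↔ InCurves (A.1.mulVec v) := by
  obtain ⟨a, ha⟩ := Projectivization.exists_smul_eq_mk_rep ℂ v hv
  change InCurves (A.1.mulVec _) ↔ _
  rw [← ha, Units.smul_def, Matrix.mulVec_smul]
  refine ⟨fun h => ?_, fun h => h.smul _⟩
  have := h.smul (a⁻¹ : ℂˣ)
  rwa [smul_smul, Units.inv_mul, one_smul] at this

/-! ### Linear maps preserving the conic, the line and the twisted cubic -/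

lemma coeffs_eq_zero {n : ℕ} {c : Fin n → ℂ} 
    (h : ∀ t : ℂ, ∑ i : Fin n, c i * t ^ (i : ℕ) = 0) : c = 0 := by
  have hp : (∑ i : Fin n, Polynomial.monomial (i : ℕ) (c i) : Polynomial ℂ) = 0 :=
    Polynomial.funext fun t => by simpa [Polynomial.eval_finsetSum] using h t
  funext j
  have := congrArg (Polynomial.coeff · (j : ℕ)) hp
  simpa [Polynomial.finsetSum_coeff, Polynomial.coeff_monomial, Fin.val_inj] using this

/-- A quadric that contains the twisted cubic and the conic is zero. -/
lemma quadric_eq_zero {q : Fin 4 → Fin 4 → ℂ} (hq : ∀ i j, q i j = q j i)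
    (hT : ∀ t : ℂ, ∑ i, ∑ j, q i j * ![1, t, t ^ 2 / 2, t ^ 3 / 6] i
      * ![1, t, t ^ 2 / 2, t ^ 3 / 6] j = 0)
    (hQ : ∀ t : ℂ, ∑ i, ∑ j, q i j * ![0, 2, 2 * t, t ^ 2] i * ![0, 2, 2 * t, t ^ 2] j = 0) :
    q = 0 := by
  have h1 := coeffs_eq_zero (c := ![q 0 0, 2 * q 0 1, q 0 2 + q 1 1, q 0 3 / 3 + q 1 2,
    q 1 3 / 3 + q 2 2 / 4, q 2 3 / 6, q 3 3 / 36]) (fun t => by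
      rw [← hT t]
      simp only [Fin.sum_univ_succ]
      simp [Fin.succ, hq 1 0, hq 2 0, hq 3 0, hq 2 1, hq 3 1, hq 3 2]
      ring)
  have h2 := coeffs_eq_zero (c := ![4 * q 1 1, 8 * q 1 2, 4 * q 1 3 + 4 * q 2 2, 4 * q 2 3, q 3 3])
    (fun t => by
      rw [← hQ t]
      simp only [Fin.sum_univ_succ]
      simp [Fin.succ, hq 1 0, hq 2 0, hq 3 0, hq 2 1, hq 3 1, hq 3 2]
      ring)
  have a0 := congrFun h1 0
  have a1 := congrFun h1 1
  have a2 := congrFun h1 2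
  have a3 := congrFun h1 3
  have a4 := congrFun h1 4
  have a5 := congrFun h1 5
  have a6 := congrFun h1 6
  have b0 := congrFun h2 0
  have b1 := congrFun h2 1
  have b2 := congrFun h2 2
  simp only [Matrix.cons_val, Pi.zero_apply] at a0 a1 a2 a3 a4 a5 a6 b0 b1 b2
  have c00 : q 0 0 = 0 := a0
  have c01 : q 0 1 = 0 := by linear_combination a1 / 2
  have c11 : q 1 1 = 0 := by linear_combination b0 / 4
  have c02 : q 0 2 = 0 := by linear_combination a2 - c11
  have c12 : q 1 2 = 0 := by linear_combination b1 / 8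
  have c03 : q 0 3 = 0 := by linear_combination 3 * a3 - 3 * c12
  have c22 : q 2 2 = 0 := by linear_combination b2 - 12 * a4
  have c13 : q 1 3 = 0 := by linear_combination b2 / 4 - c22
  have c23 : q 2 3 = 0 := by linear_combination 6 * a5
  have c33 : q 3 3 = 0 := by linear_combination 36 * a6
  funext i j
  fin_cases i <;> fin_cases j <;> first | assumption | (rw [hq]; assumption)

lemma eval_dot (b : Fin 4 → ℂ) (p : Fin 4 → Polynomial ℂ) (t : ℂ) :
    (∑ j, Polynomial.C (b j) * p j).eval t = b ⬝ᵥ fun j => (p j).eval t := by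
  simp [Polynomial.eval_finsetSum, dotProduct]

/-- A linear map that preserves the three curves maps a parametrized curve in the cone into the
plane or into the cone over the twisted cubic. -/
lemma curve_alternative (B : Matrix (Fin 4) (Fin 4) ℂ) 
    (hB : ∀ x, InCurves x → InCurves (B.mulVec x)) (p : Fin 4 → Polynomial ℂ)
    (hp : ∀ t, InCurves fun j => (p j).eval t) :
    (∑ j, Polynomial.C (B 0 j) * p j) = 0 ∨
      ((∑ j, Polynomial.C (B 1 j) * p j) ^ 2 =
          2 * (∑ j, Polynomial.C (B 0 j) * p j) * (∑ j, Polynomial.C (B 2 j) * p j) ∧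
        (∑ j, Polynomial.C (B 1 j) * p j) * (∑ j, Polynomial.C (B 2 j) * p j) =
          3 * (∑ j, Polynomial.C (B 0 j) * p j) * (∑ j, Polynomial.C (B 3 j) * p j)) := by
  by_cases h0 : (∑ j, Polynomial.C (B 0 j) * p j) = 0
  · exact Or.inl h0
  refine Or.inr ⟨?_, ?_⟩
  all_goals
    -- After multiplication by the nonzero polynomial y₀, the equation holds for every parameter:
    -- the conic and the line have y₀ = 0, and the remaining alternative is the equation itself.
    apply mul_left_cancel₀ h0
    refine Polynomial.funext fun t => ?_
    simp only [Polynomial.eval_mul, Polynomial.eval_pow, eval_dot, Polynomial.eval_ofNat]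
    have h := hB _ (hp t)
    simp only [InCurves, Matrix.mulVec] at h
    rcases h with ⟨h1, h2⟩ | ⟨h1, h2⟩ | ⟨h1, h2, h3⟩
    · rw [h1]; ring
    · rw [h1]; ring
    · first
      | linear_combination (B 0 ⬝ᵥ fun j => (p j).eval t) * h3
      | linear_combination (B 0 ⬝ᵥ fun j => (p j).eval t) * h2

lemma twisted_sum (b : Fin 4 → ℂ) :
    (∑ j, Polynomial.C (b j) * (![1, Polynomial.X, Polynomial.C (1 / 2) * Polynomial.X ^ 2,
      Polynomial.C (1 / 6) * Polynomial.X ^ 3] : Fin 4 → Polynomial ℂ) j)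
      = Polynomial.C (b 3 / 6) * Polynomial.X ^ 3 + Polynomial.C (b 2 / 2) * Polynomial.X ^ 2 + Polynomial.C (b 1) * Polynomial.X
        + Polynomial.C (b 0) := by
  simp only [Fin.sum_univ_four, Matrix.cons_val, ← mul_assoc, ← Polynomial.C_mul, mul_one_div]
  ring

lemma conic_sum (b : Fin 4 → ℂ) :
    (∑ j, Polynomial.C (b j) * (![0, 2, 2 * Polynomial.X, Polynomial.X ^ 2] : Fin 4 → Polynomial ℂ) j)
      = Polynomial.C (b 3) * Polynomial.X ^ 2 + Polynomial.C (2 * b 2) * Polynomial.X + Polynomial.C (2 * b 1) := by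
  simp only [Fin.sum_univ_four, Matrix.cons_val, Polynomial.C_mul, map_ofNat]
  ring

/-- A linear automorphism that preserves the three curves preserves the flag. -/
lemma triangular_of_inCurves (B : GL (Fin 4) ℂ)
    (hB : ∀ x, InCurves x → InCurves (B.1.mulVec x)) :
    (B.1 0 1 = 0 ∧ B.1 0 2 = 0 ∧ B.1 0 3 = 0) ∧ (B.1 1 2 = 0 ∧ B.1 1 3 = 0) ∧ B.1 2 3 = 0 := by
  have hT := curve_alternative B.1 hB ![1, Polynomial.X, Polynomial.C (1 / 2) * Polynomial.X ^ 2,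
      Polynomial.C (1 / 6) * Polynomial.X ^ 3] (fun t => Or.inr (Or.inr (by
        simp only [Matrix.cons_val, Polynomial.eval_mul, Polynomial.eval_pow, Polynomial.eval_X,
          Polynomial.eval_C, Polynomial.eval_one]
        refine ⟨?_, ?_, ?_⟩ <;> ring)))
  have hQ := curve_alternative B.1 hB ![0, 2, 2 * Polynomial.X, Polynomial.X ^ 2] (fun t => Or.inl (by
        simp only [Matrix.cons_val, Polynomial.eval_mul, Polynomial.eval_pow, Polynomial.eval_X,
          Polynomial.eval_ofNat, Polynomial.eval_zero]
        refine ⟨trivial, ?_⟩; ring))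
  -- The twisted cubic spans ℙ³, so its image cannot lie in the plane y₀ = 0 unless the first row of
  -- B is zero.
  replace hT := hT.resolve_left (fun h => by
    rw [twisted_sum] at h
    apply row_ne_zero B 0
    have h0 := congrArg (Polynomial.coeff · 0) h
    have h1 := congrArg (Polynomial.coeff · 1) h
    have h2 := congrArg (Polynomial.coeff · 2) h
    have h3 := congrArg (Polynomial.coeff · 3) h
    simp [Polynomial.coeff_X, Polynomial.coeff_C, Polynomial.coeff_X_pow] at h0 h1 h2 h3
    funext j
    fin_cases j <;> assumption)
  have h0 : B.1 0 1 = 0 ∧ B.1 0 2 = 0 ∧ B.1 0 3 = 0 := by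
    rcases hQ with h | ⟨h, -⟩
    · rw [conic_sum] at h
      have h0 := congrArg (Polynomial.coeff · 0) h
      have h1 := congrArg (Polynomial.coeff · 1) h
      have h2 := congrArg (Polynomial.coeff · 2) h
      simp [Polynomial.coeff_X, Polynomial.coeff_C, Polynomial.coeff_X_pow] at h0 h1 h2
      exact ⟨h0, h1, h2⟩
    · exfalso
      -- If the conic also satisfied y₁² = 2y₀y₂, this quadric pulled back by B would contain both
      -- curves and hence be zero. Yet it takes the value 1 at the preimage of (0, 1, 0, 0).
      have hF : ∀ x : Fin 4 → ℂ, ∑ i, ∑ j, (B.1 1 i * B.1 1 j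
          - (B.1 0 i * B.1 2 j + B.1 2 i * B.1 0 j)) * x i * x j
          = B.1.mulVec x 1 ^ 2 - 2 * B.1.mulVec x 0 * B.1.mulVec x 2 := by
        intro x
        simp only [Matrix.mulVec, dotProduct, Fin.sum_univ_four]
        ring
      have h0 := quadric_eq_zero (q := fun i j => B.1 1 i * B.1 1 j
          - (B.1 0 i * B.1 2 j + B.1 2 i * B.1 0 j)) (fun i j => by ring) (fun t => by
            rw [hF]
            have := congrArg (Polynomial.eval t) hT.1
            rw [twisted_sum, twisted_sum, twisted_sum] at this
            simp at this
            simp [Matrix.mulVec, dotProduct, Fin.sum_univ_four]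
            linear_combination this) (fun t => by
            rw [hF]
            have := congrArg (Polynomial.eval t) h
            rw [conic_sum, conic_sum, conic_sum] at this
            simp at this
            simp [Matrix.mulVec, dotProduct, Fin.sum_univ_four]
            linear_combination this)
      obtain ⟨x, hx⟩ := exists_mulVec_eq B ![0, 1, 0, 0]
      have := hF x
      rw [hx] at this
      simp only [fun i j => congrFun (congrFun h0 i) j] at this
      simp at this
  refine ⟨h0, ?_⟩
  obtain ⟨h1, h2, h3⟩ := h0
  obtain ⟨e, -⟩ := hT
  have hb : B.1 0 0 ≠ 0 := by
    intro h
    apply row_ne_zero B 0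
    funext j
    fin_cases j <;> assumption
  rw [twisted_sum, twisted_sum, twisted_sum, h1, h2, h3] at e
  -- Now y₀ is a nonzero constant on the parametrized cubic, so y₁² = 2y₀y₂ with deg y₂ ≤ 3 forces
  -- deg y₁ ≤ 1 and then deg y₂ ≤ 2. These bounds are the remaining vanishing entries of B.
  have he := coeffs_eq_zero (c := ![B.1 1 0 ^ 2 - 2 * B.1 0 0 * B.1 2 0,
    2 * B.1 1 0 * B.1 1 1 - 2 * B.1 0 0 * B.1 2 1,
    B.1 1 1 ^ 2 + B.1 1 0 * B.1 1 2 - B.1 0 0 * B.1 2 2,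
    B.1 1 0 * B.1 1 3 / 3 + B.1 1 1 * B.1 1 2 - B.1 0 0 * B.1 2 3 / 3,
    B.1 1 1 * B.1 1 3 / 3 + B.1 1 2 ^ 2 / 4, B.1 1 2 * B.1 1 3 / 6, B.1 1 3 ^ 2 / 36]) (fun t => by
      have := congrArg (Polynomial.eval t) e
      simp at this
      simp [Fin.sum_univ_succ, Fin.succ]
      linear_combination this)
  have c3 := congrFun he 3
  have c4 := congrFun he 4
  have c6 := congrFun he 6
  simp only [Matrix.cons_val, Pi.zero_apply] at c3 c4 c6
  have b13 : B.1 1 3 = 0 := pow_eq_zero_iff two_ne_zero |>.1 (by linear_combination 36 * c6)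
  have b12 : B.1 1 2 = 0 := pow_eq_zero_iff two_ne_zero |>.1 (by
    linear_combination 4 * c4 - 4 / 3 * B.1 1 1 * b13)
  refine ⟨⟨b12, b13⟩, (mul_eq_zero.1 ?_).resolve_left hb⟩
  linear_combination -3 * c3 + B.1 1 0 * b13 + 3 * B.1 1 1 * b12

lemma frameFlag_le {A A' : GL (Fin 4) ℂ} (h : threeCurves A ⊆ threeCurves A') :
    (frameFlag A).1 ≤ (frameFlag A').1 ∧ (frameFlag A).2.1 ≤ (frameFlag A').2.1 ∧
      (frameFlag A).2.2 ≤ (frameFlag A').2.2 := by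
  have hm : ∀ v, A'.1.mulVec v = (A' * A⁻¹).1.mulVec (A.1.mulVec v) := by
    intro v
    rw [Matrix.mulVec_mulVec, ← Units.val_mul, inv_mul_cancel_right]
  obtain ⟨⟨b01, b02, b03⟩, ⟨b12, b13⟩, b23⟩ := triangular_of_inCurves (A' * A⁻¹) (fun x hx => by
    obtain ⟨v, rfl⟩ := exists_mulVec_eq A x
    rw [← hm]
    by_cases hv : v = 0
    · rw [hv, Matrix.mulVec_zero]
      exact Or.inr (Or.inl ⟨rfl, rfl⟩)
    · rw [← mk_mem_threeCurves A' hv]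
      exact h ((mk_mem_threeCurves A hv).2 hx))
  have hs : ∀ k v, A'.1 k ⬝ᵥ v = (A' * A⁻¹).1 k 0 * (A.1 0 ⬝ᵥ v)
      + (A' * A⁻¹).1 k 1 * (A.1 1 ⬝ᵥ v) + (A' * A⁻¹).1 k 2 * (A.1 2 ⬝ᵥ v)
      + (A' * A⁻¹).1 k 3 * (A.1 3 ⬝ᵥ v) := by
    intro k v
    refine (congrFun (hm v) k).trans ?_
    rw [Matrix.mulVec, dotProduct, Fin.sum_univ_four]
    rfl
  have h0 : ∀ v, A'.1 0 ⬝ᵥ v = (A' * A⁻¹).1 0 0 * (A.1 0 ⬝ᵥ v) := by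
    intro v
    rw [hs, b01, b02, b03]
    ring
  have h1 : ∀ v, A'.1 1 ⬝ᵥ v
      = (A' * A⁻¹).1 1 0 * (A.1 0 ⬝ᵥ v) + (A' * A⁻¹).1 1 1 * (A.1 1 ⬝ᵥ v) := by
    intro v
    rw [hs, b12, b13]
    ring
  have h2 : ∀ v, A'.1 2 ⬝ᵥ v = (A' * A⁻¹).1 2 0 * (A.1 0 ⬝ᵥ v)
      + (A' * A⁻¹).1 2 1 * (A.1 1 ⬝ᵥ v) + (A' * A⁻¹).1 2 2 * (A.1 2 ⬝ᵥ v) := by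
    intro v
    rw [hs, b23]
    ring
  refine ⟨fun v => ?_, fun v => ?_, fun v => ?_⟩
  · rw [mem_frameFlag_point, mem_frameFlag_point]
    rintro ⟨e0, e1, e2⟩
    rw [h0, h1, h2, e0, e1, e2]
    simp
  · rw [mem_frameFlag_line, mem_frameFlag_line]
    rintro ⟨e0, e1⟩
    rw [h0, h1, e0, e1]
    simp
  · rw [mem_frameFlag_plane, mem_frameFlag_plane]
    intro e0
    rw [h0, e0, mul_zero]

/-- The flag can be recovered from the three curves. -/
theorem frameFlag_eq {A A' : GL (Fin 4) ℂ} (h : threeCurves A = threeCurves A') :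
    frameFlag A = frameFlag A' := by
  obtain ⟨h1, h2, h3⟩ := frameFlag_le h.subset
  obtain ⟨k1, k2, k3⟩ := frameFlag_le h.symm.subset
  exact Prod.ext (le_antisymm h1 k1) (Prod.ext (le_antisymm h2 k2) (le_antisymm h3 k3))

lemma exists_frame_of_value {y : Y4.Points} {ω : P44} (h : ω ∈ Y4.toP44 y) (hω : ω ∈ orbit) :
    ∃ A, Y4.flagOf y.coords = frameFlag A ∧ singularLocus ω = threeCurves A := by
  obtain ⟨A, c, hc⟩ := hω
  obtain ⟨D, hD, -⟩ := isTower_Y4.exists_datum (coords_mem y)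
  have hN := normal_of_value isTower_Y4 (coords_mem y) hD ((mem_toP44 isTower_Y4).1 h) hc
  refine ⟨A, ?_, singularLocus_eq hc⟩
  change Y.flagOf (Y4.baseVec y.coords) = _
  rw [hD, D.flagOf_eq_iff]
  exact hN.1

/-! ### The orbit is open in its closure -/

/-- Chevalley's theorem for closed points: the image of a principal open set under a polynomial map
contains a non-empty principal open subset of the closure of the image. -/
theorem exists_open_subset_image {σ τ : Type} [Finite σ] [Finite τ]
    (φ : MvPolynomial σ ℂ →ₐ[ℂ] MvPolynomial τ ℂ) {δ : MvPolynomial τ ℂ} (hδ : δ ≠ 0) :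
    ∃ f, φ f ≠ 0 ∧ ∀ x : σ → ℂ, (∀ g, φ g = 0 → eval x g = 0) → eval x f ≠ 0 →
      ∃ a, eval a δ ≠ 0 ∧ ∀ k, x k = eval a (φ (X k)) := by
  have hφ : φ.toRingHom.FinitePresentation := by
    rw [← RingHom.FinitePresentation.of_finiteType]
    refine RingHom.FiniteType.of_comp_finiteType (f := algebraMap ℂ (MvPolynomial σ ℂ)) ?_
    rw [AlgHom.toRingHom_eq_coe, φ.comp_algebraMap]
    exact RingHom.finiteType_algebraMap.2 inferInstance
  have hs : Topology.IsConstructible ((PrimeSpectrum.zeroLocus {δ})ᶜ :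
      Set (PrimeSpectrum (MvPolynomial τ ℂ))) := by
    rw [← PrimeSpectrum.basicOpen_eq_zeroLocus_compl]
    exact PrimeSpectrum.isConstructible_basicOpen
  obtain ⟨T, hT⟩ := PrimeSpectrum.exists_constructibleSetData_iff.2
    (PrimeSpectrum.isConstructible_comap_image hφ hs)
  -- The generic point lies in the open set δ ≠ 0, so its image lies in one locally closed piece of
  -- the constructible image. The equations of that piece are in the kernel of φ, and its f is not.
  let η : PrimeSpectrum (MvPolynomial τ ℂ) := ⟨⊥, Ideal.isPrime_bot⟩
  have hη : PrimeSpectrum.comap φ.toRingHom η ∈ T.toSet := by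
    rw [hT]
    exact ⟨η, by simpa [η] using hδ, rfl⟩
  obtain ⟨c, hc, hηc⟩ := Set.mem_iUnion₂.1 hη
  refine ⟨c.f, fun h => hηc.2 ?_, fun x hx hxf => ?_⟩
  · rintro _ rfl
    exact h
  · have hxc : pointToPoint x ∈ T.toSet := by
      refine Set.mem_iUnion₂.2 ⟨c, hc, ?_, fun h => hxf ?_⟩
      · rintro _ ⟨i, rfl⟩
        have : φ (c.g i) = 0 := hηc.1 ⟨i, rfl⟩
        rintro _ rfl
        exact hx _ this
      · exact h rfl x rfl
    rw [hT] at hxc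
    obtain ⟨q, hq, hqx⟩ := hxc
    have hδq : δ ∉ q.asIdeal := fun h => hq (by rintro _ rfl; exact h)
    -- The preimage q of the closed point x need not be closed. The Nullstellensatz replaces it by a
    -- closed point a of its zero locus with δ(a) ≠ 0, and a still maps to x.
    rw [← IsPrime.vanishingIdeal_zeroLocus (K := ℂ) q.asIdeal, mem_vanishingIdeal_iff] at hδq
    push Not at hδq
    obtain ⟨a, ha, haδ⟩ := hδq
    refine ⟨a, haδ, fun k => ?_⟩
    have : X k - C (x k) ∈ (PrimeSpectrum.comap φ.toRingHom q).asIdeal := by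
      rw [hqx]
      rintro _ rfl
      simp
    have h0 := ha _ this
    change eval a (φ (X k - C (x k))) = 0 at h0
    rw [map_sub, ← algebraMap_eq, φ.commutes, map_sub, sub_eq_zero, algebraMap_eq, eval_C] at h0
    exact h0.symm

lemma eval_homogeneousComponent_eq_zero {σ : Type*} {g : MvPolynomial σ ℂ} {x : σ → ℂ}
    (h : ∀ c : ℂ, c ≠ 0 → eval (c • x) g = 0) (n : ℕ) :
    eval x (homogeneousComponent n g) = 0 := by
  -- The hypothesis says nothing at c = 0; the factor X takes care of that value.
  have hp : (Polynomial.X * ∑ i ∈ Finset.range (g.totalDegree + 1),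
      Polynomial.monomial i (eval x (homogeneousComponent i g)) : Polynomial ℂ) = 0 := by
    refine Polynomial.funext fun c => ?_
    rw [Polynomial.eval_mul, Polynomial.eval_X, Polynomial.eval_zero, mul_eq_zero]
    by_cases hc : c = 0
    · exact Or.inl hc
    · right
      rw [← h c hc, Polynomial.eval_finsetSum]
      conv_rhs => rw [← sum_homogeneousComponent g]
      rw [map_sum]
      refine Finset.sum_congr rfl fun i _ => ?_
      rw [Polynomial.eval_monomial,
        eval_smul_of_isHomogeneous (homogeneousComponent_isHomogeneous i g), mul_comm]
  by_cases hn : n ≤ g.totalDegree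
  · have := congrArg (Polynomial.coeff · n) ((mul_eq_zero.1 hp).resolve_left Polynomial.X_ne_zero)
    simpa [Polynomial.finsetSum_coeff, Polynomial.coeff_monomial, hn] using this
  · rw [homogeneousComponent_eq_zero n g (by omega), map_zero]

/-- The indices of the coefficients of a 1-form with cubic coefficients. -/
abbrev CubicIndex : Type :=
  Fin 4 × (Finset.finsuppAntidiag (Finset.univ : Finset (Fin 4)) 3 : Finset (Fin 4 →₀ ℕ))

/-- The coefficients of a 1-form with cubic coefficients. -/
def cubicVec (η : Fin 4 → S) : CubicIndex → ℂ := fun k => coeff k.2.1 (η k.1)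

lemma cubicVec_smul (c : ℂ) (η : Fin 4 → S) : cubicVec (c • η) = c • cubicVec η := by
  funext k; simp [cubicVec]

lemma mem_finsuppAntidiag_of_isHomogeneous {p : S} {n : ℕ} (hp : p.IsHomogeneous n) {m : Fin 4 →₀ ℕ}
    (hm : coeff m p ≠ 0) : m ∈ Finset.finsuppAntidiag (Finset.univ : Finset (Fin 4)) n := by
  rw [Finset.mem_finsuppAntidiag]
  refine ⟨?_, Finset.subset_univ _⟩
  rw [← hp hm, Finsupp.weight_apply, Finsupp.sum_fintype]
  · simp
  · simp

lemma cubicVec_injective {η ξ : Fin 4 → S} (hη : η ∈ Omega14) (hξ : ξ ∈ Omega14)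
    (h : cubicVec η = cubicVec ξ) : η = ξ := by
  funext i
  ext m
  by_cases hm : m ∈ Finset.finsuppAntidiag (Finset.univ : Finset (Fin 4)) 3
  · exact congrFun h (i, ⟨m, hm⟩)
  · rw [not_ne_iff.1 (mt (mem_finsuppAntidiag_of_isHomogeneous (hη.1 i)) hm),
      not_ne_iff.1 (mt (mem_finsuppAntidiag_of_isHomogeneous (hξ.1 i)) hm)]

/-- The pull-back of `ω₀` under the generic matrix. -/
def genPullback (j : Fin 4) : MvPolynomial (Fin 4) (MvPolynomial (Fin 4 × Fin 4) ℂ) :=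
  ∑ i, C (X (i, j)) * aeval (fun k => ∑ l, C (X (k, l)) * X l : Fin 4 → MvPolynomial (Fin 4)
    (MvPolynomial (Fin 4 × Fin 4) ℂ)) (omega0 i)

lemma map_genPullback (A : GL (Fin 4) ℂ) (j : Fin 4) :
    MvPolynomial.map (eval fun k => A.1 k.1 k.2) (genPullback j) = pullback A omega0 j := by
  have : ∀ p : S, MvPolynomial.map (eval fun k : Fin 4 × Fin 4 => A.1 k.1 k.2)
      (aeval (fun k => ∑ l, C (X (k, l)) * X l : Fin 4 → MvPolynomial (Fin 4)
    (MvPolynomial (Fin 4 × Fin 4) ℂ)) p) = aeval (fun k => lin (A.1 k)) p := by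
    intro p
    induction p using MvPolynomial.induction_on with
    | C a => simp [algebraMap_eq, IsScalarTower.algebraMap_apply ℂ (MvPolynomial (Fin 4 × Fin 4) ℂ)
        (MvPolynomial (Fin 4) (MvPolynomial (Fin 4 × Fin 4) ℂ))]
    | add p q hp hq => rw [map_add, map_add, hp, hq, map_add]
    | mul_X p i hp => rw [map_mul, map_mul, hp, map_mul, aeval_X, aeval_X]; simp [lin]
  simp only [genPullback, map_sum, map_mul, this, map_C, eval_X, pullback]

/-- The parametrization of the cone over the orbit. -/
def orbitMap : MvPolynomial CubicIndex ℂ →ₐ[ℂ] MvPolynomial (Fin 4 × Fin 4) ℂ :=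
  aeval fun k => coeff k.2.1 (genPullback k.1)

lemma eval_orbitMap (A : GL (Fin 4) ℂ) (g : MvPolynomial CubicIndex ℂ) :
    eval (fun k => A.1 k.1 k.2) (orbitMap g) = eval (cubicVec (pullback A omega0)) g := by
  have : (eval fun k : Fin 4 × Fin 4 => A.1 k.1 k.2).comp orbitMap.toRingHom
      = eval (cubicVec (pullback A omega0)) := by
    apply MvPolynomial.ringHom_ext
    · intro r; simp [orbitMap, algebraMap_eq]
    · intro k
      simp [cubicVec, orbitMap, ← map_genPullback, coeff_map]
  exact congrArg (fun φ => φ g) this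

lemma exists_pullback_eq_smul (A : GL (Fin 4) ℂ) {c : ℂ} (hc : c ≠ 0) :
    ∃ B, pullback B omega0 = c • pullback A omega0 := by
  -- Scaling the substitution by l multiplies the form by l⁴: three factors from the cubic
  -- coefficients and one from the differentials.
  obtain ⟨l, hl⟩ := IsAlgClosed.exists_pow_nat_eq c (n := 4) (by norm_num)
  have l0 : l ≠ 0 := by
    rintro rfl
    exact hc (by rw [← hl]; norm_num)
  refine ⟨Units.mk0 l l0 • A, ?_⟩
  funext j
  refine MvPolynomial.funext fun v => ?_
  have hv : (Units.mk0 l l0 • A).1.mulVec v = l • A.1.mulVec v := Matrix.smul_mulVec l A.1 v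
  have hA : ∀ i, (Units.mk0 l l0 • A).1 i j = l * A.1 i j := fun i => rfl
  simp only [pullback_apply, map_sum, map_mul, eval_C, eval_sub, hv, hA, Pi.smul_apply, smul_eval,
    eval_smul_of_isHomogeneous (omega0_mem.1 _), Finset.mul_sum]
  refine Finset.sum_congr rfl fun i _ => ?_
  rw [← hl]
  ring

/-- The coefficients of the pull-back of a 1-form, as linear forms in its coefficients. -/
def pullCoeff (B : GL (Fin 4) ℂ) (k : CubicIndex) : MvPolynomial (Fin 4 × (Fin 4 →₀ ℕ)) ℂ :=
  ∑ i, ∑ m ∈ Finset.finsuppAntidiag (Finset.univ : Finset (Fin 4)) 3,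
    C (coeff k.2.1 (C (B.1 i k.1) * sub B.1 (monomial m 1))) * X (i, m)

lemma eval_pullCoeff (B : GL (Fin 4) ℂ) {η : Fin 4 → S} (hη : η ∈ Omega14) (k : CubicIndex) :
    eval (coeffVec η) (pullCoeff B k) = cubicVec (pullback B η) k := by
  have h : ∀ i, η i = ∑ m ∈ Finset.finsuppAntidiag (Finset.univ : Finset (Fin 4)) 3,
      C (coeff m (η i)) * monomial m 1 := by
    intro i
    ext m
    simp only [coeff_sum, coeff_C_mul, coeff_monomial, mul_ite, mul_one, mul_zero,
      Finset.sum_ite_eq']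
    split_ifs with hm
    · rfl
    · exact not_ne_iff.1 (mt (mem_finsuppAntidiag_of_isHomogeneous (hη.1 i)) hm)
  rw [cubicVec, pullback_apply]
  conv_rhs => enter [2, 2, i]; rw [h i, map_sum, Finset.mul_sum]
  simp only [pullCoeff, map_sum, map_mul, eval_C, eval_X, coeffVec, coeff_sum, sub_C]
  refine Finset.sum_congr rfl fun i _ => Finset.sum_congr rfl fun m _ => ?_
  rw [coeff_C_mul, coeff_C_mul, coeff_C_mul]
  ring

lemma eval_aeval_pullCoeff (B : GL (Fin 4) ℂ) {η : Fin 4 → S} (hη : η ∈ Omega14)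
    (g : MvPolynomial CubicIndex ℂ) :
    eval (coeffVec η) (aeval (pullCoeff B) g) = eval (cubicVec (pullback B η)) g := by
  have : (eval (coeffVec η)).comp (aeval (pullCoeff B) : MvPolynomial CubicIndex ℂ →ₐ[ℂ] _).toRingHom
      = eval (cubicVec (pullback B η)) := by
    apply MvPolynomial.ringHom_ext
    · intro r; simp [algebraMap_eq]
    · intro k
      simpa using eval_pullCoeff B hη k
  exact congrArg (fun φ => φ g) this

lemma aeval_pullCoeff_isHomogeneous (B : GL (Fin 4) ℂ) {g : MvPolynomial CubicIndex ℂ} {n : ℕ}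
    (hg : g.IsHomogeneous n) : (aeval (pullCoeff B) g).IsHomogeneous n := by
  have h : ∀ k, (pullCoeff B k).IsHomogeneous 1 := fun k =>
    IsHomogeneous.sum _ _ _ fun i _ => IsHomogeneous.sum _ _ _ fun m _ => isHomogeneous_C_mul_X _ _
  have := hg.aeval (pullCoeff B) h
  rwa [one_mul] at this

/-- The homogeneous equations of the orbit hold on `E(3)`. -/
lemma eval_eq_zero_of_mem_E3 {ω : P44} (hω : ω ∈ E3) (B : GL (Fin 4) ℂ)
    {g : MvPolynomial CubicIndex ℂ} (hg : orbitMap g = 0) (c : ℂ) :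
    eval (c • cubicVec (pullback B ω.rep)) g = 0 := by
  have hn : ∀ n, eval (cubicVec (pullback B ω.rep)) (homogeneousComponent n g) = 0 := by
    intro n
    by_contra hne
    have hh := homogeneousComponent_isHomogeneous n g
    rw [← eval_aeval_pullCoeff B ω.rep.2] at hne
    rw [E3, isTopologicalBasis_P44.mem_closure_iff] at hω
    -- A homogeneous component of g that is nonzero at ω would be nonzero at some orbit element. The
    -- cone over the orbit is stable under scaling, so each component of g vanishes on it.
    obtain ⟨ξ, hξ, A, k, hk⟩ := hω _ ⟨_, n, aeval_pullCoeff_isHomogeneous B hh, rfl⟩ hne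
    apply hξ
    rw [eval_aeval_pullCoeff B ξ.rep.2, hk, pullback_smul, pullback_pullback, cubicVec_smul,
      eval_smul_of_isHomogeneous hh, eval_homogeneousComponent_eq_zero, mul_zero]
    intro c hc
    obtain ⟨A', hA'⟩ := exists_pullback_eq_smul (A * B) hc
    rw [← cubicVec_smul, ← hA', ← eval_orbitMap, hg, map_zero]
  conv_lhs => rw [← sum_homogeneousComponent g]
  rw [map_sum]
  refine Finset.sum_eq_zero fun n _ => ?_
  rw [eval_smul_of_isHomogeneous (homogeneousComponent_isHomogeneous n g), hn, mul_zero]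

/-- The determinant of the generic matrix. -/
def genDet : MvPolynomial (Fin 4 × Fin 4) ℂ := (Matrix.of fun i j => X (i, j)).det

lemma eval_genDet (a : Fin 4 × Fin 4 → ℂ) :
    eval a genDet = (Matrix.of fun i j => a (i, j)).det := by
  rw [genDet, RingHom.map_det]
  congr 1
  ext i j
  simp

lemma exists_GL_of_genDet {a : Fin 4 × Fin 4 → ℂ} (ha : eval a genDet ≠ 0) :
    ∃ A : GL (Fin 4) ℂ, a = fun k => A.1 k.1 k.2 := by
  rw [eval_genDet] at ha
  exact ⟨Matrix.GeneralLinearGroup.mkOfDetNeZero _ ha, rfl⟩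

lemma genDet_ne_zero : genDet ≠ 0 := by
  intro h
  have := eval_genDet fun k => (1 : Matrix (Fin 4) (Fin 4) ℂ) k.1 k.2
  rw [h, map_zero] at this
  exact one_ne_zero (Matrix.det_one.symm.trans this.symm)

/-- The orbit of `ω₀` is open in its closure. -/
theorem exists_isOpen_inter_E3 : ∃ O : Set P44, IsOpen O ∧ O ∩ E3 = orbit := by
  obtain ⟨f, hf, hfx⟩ := exists_open_subset_image orbitMap genDet_ne_zero
  -- The polynomial f need not be homogeneous; one homogeneous component that is not identically
  -- zero on the orbit defines an open set of ℙ⁴⁴.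
  obtain ⟨n, hn⟩ : ∃ n, orbitMap (homogeneousComponent n f) ≠ 0 := by
    by_contra! h
    apply hf
    conv_lhs => rw [← sum_homogeneousComponent f]
    rw [map_sum]
    exact Finset.sum_eq_zero fun n _ => h n
  have hh := homogeneousComponent_isHomogeneous n f
  obtain ⟨a, ha⟩ : ∃ a, eval a (genDet * orbitMap (homogeneousComponent n f)) ≠ 0 := by
    by_contra! h
    exact mul_ne_zero genDet_ne_zero hn (MvPolynomial.funext fun a => by rw [h a, map_zero])
  rw [map_mul] at ha
  obtain ⟨A₀, rfl⟩ := exists_GL_of_genDet (left_ne_zero_of_mul ha)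
  replace ha := right_ne_zero_of_mul ha
  rw [eval_orbitMap] at ha
  -- A single such open set meets the orbit only partially. Its translates by the group cover the
  -- orbit, and each meets the closure only in orbit points.
  refine ⟨⋃ B, basicP44 (aeval (pullCoeff B) (homogeneousComponent n f)), isOpen_iUnion fun B =>
    isTopologicalBasis_P44.isOpen ⟨_, n, aeval_pullCoeff_isHomogeneous B hh, rfl⟩,
    Set.Subset.antisymm ?_ fun ω hω => ⟨?_, subset_closure hω⟩⟩
  · rintro ω ⟨hωO, hωE⟩
    obtain ⟨B, hB⟩ := Set.mem_iUnion.1 hωO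
    change eval _ _ ≠ 0 at hB
    rw [eval_aeval_pullCoeff B ω.rep.2] at hB
    -- A nonzero component does not make f nonzero at this representative, but it does at some
    -- nonzero multiple of it, and the class in ℙ⁴⁴ is the same.
    obtain ⟨c, hc, hcf⟩ : ∃ c : ℂ, c ≠ 0 ∧ eval (c • cubicVec (pullback B ω.rep)) f ≠ 0 := by
      by_contra! h
      exact hB (eval_homogeneousComponent_eq_zero h n)
    obtain ⟨a, ha, hax⟩ := hfx _ (fun g hg => eval_eq_zero_of_mem_E3 hωE B hg c) hcf
    obtain ⟨A, rfl⟩ := exists_GL_of_genDet ha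
    have h : c • pullback B ω.rep = pullback A omega0 := by
      apply cubicVec_injective (Omega14.smul_mem c (pullback_mem_Omega14 B ω.rep.2))
        (pullback_mem_Omega14 A omega0_mem)
      rw [cubicVec_smul]
      funext k
      rw [hax, eval_orbitMap, eval_X]
    refine mem_orbit_of_smul (A := A * B⁻¹) (c' := 1) hc ?_
    rw [one_smul, ← pullback_pullback, ← h, pullback_smul, pullback_pullback, mul_inv_cancel,
      pullback_one]
  · obtain ⟨A, c, hc⟩ := hω
    have hc0 : c ≠ 0 := fun h0 => ω.rep_ne_zero (by rw [hc, h0, zero_smul])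
    refine Set.mem_iUnion.2 ⟨A⁻¹ * A₀, ?_⟩
    change eval _ _ ≠ 0
    rw [eval_aeval_pullCoeff _ ω.rep.2, hc, pullback_smul, pullback_pullback, mul_inv_cancel_left,
      cubicVec_smul, eval_smul_of_isHomogeneous hh]
    exact mul_ne_zero (pow_ne_zero n hc0) ha

/-! ### Points over a flag, a quadric and a cubic -/

lemma IsTower.torusEquiv_baseVec (hV : IsTower V) (t : Multiplicative V.Deg →* ℂˣ)
    (z : V.Coord → ℂ) : TorusEquiv (V.baseVec z)
      (V.baseVec fun s => (t (Multiplicative.ofAdd (V.deg s)) : ℂ) * z s) := by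
  obtain ⟨φ, hφ⟩ := hV.deg_base
  refine ⟨t.comp φ.toMultiplicative, fun k => ?_⟩
  simp only [Variety.baseVec, hφ]
  rfl

lemma ker_mulVecLin_smul {m : Type*} (u : ℂˣ) (M : Matrix m (Fin 4) ℂ) :
    LinearMap.ker (Matrix.mulVecLin ((u : ℂ) • M)) = LinearMap.ker (Matrix.mulVecLin M) := by
  ext v
  simp

lemma TorusEquiv.flagOf_eq {x y : YCoord → ℂ} (h : TorusEquiv x y) : Y.flagOf y = Y.flagOf x := by
  obtain ⟨t, ht⟩ := h
  refine Prod.ext ?_ (Prod.ext ?_ ?_)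
  · have : (fun i => y (.point i)) = t (Multiplicative.ofAdd (Pi.single 2 1)) •
      fun i => x (.point i) := funext fun i => ht (.point i)
    change Submodule.span ℂ {fun i => y (.point i)} = _
    rw [this, Submodule.span_singleton_group_smul_eq]
    rfl
  · have : (Matrix.of fun i j => y (.line i j)) =
        (t (Multiplicative.ofAdd (Pi.single 1 1)) : ℂ) • Matrix.of fun i j => x (.line i j) :=
      Matrix.ext fun i j => ht (.line i j)
    change LinearMap.ker (Matrix.mulVecLin (Matrix.of fun i j => y (.line i j))) = _
    rw [this, ker_mulVecLin_smul]
    rfl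
  · have : (Matrix.of fun (_ : Unit) i => y (.plane i)) =
        (t (Multiplicative.ofAdd (Pi.single 0 1)) : ℂ) • Matrix.of fun (_ : Unit) i => x (.plane i) :=
      Matrix.ext fun _ j => ht (.plane j)
    change LinearMap.ker (Matrix.mulVecLin (Matrix.of fun (_ : Unit) i => y (.plane i))) = _
    rw [this, ker_mulVecLin_smul]
    rfl

lemma TorusEquiv.quadricOf_eq {x y : YCoord → ℂ} (h : TorusEquiv x y) :
    ∃ r : ℂ, Y.quadricOf y = C r * Y.quadricOf x := by
  obtain ⟨t, ht⟩ := h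
  refine ⟨(t (Multiplicative.ofAdd (Pi.single 3 1)) : ℂ), ?_⟩
  simp only [Variety.quadricOf, Finset.mul_sum, C_mul_monomial]
  refine Finset.sum_congr rfl fun m _ => ?_
  exact congrArg _ (ht (.quadric m))

lemma TorusEquiv.cubicOf_eq {x y : YCoord → ℂ} (h : TorusEquiv x y) :
    ∃ r : ℂ, Y.cubicOf y = C r * Y.cubicOf x := by
  obtain ⟨t, ht⟩ := h
  refine ⟨(t (Multiplicative.ofAdd (Pi.single 5 1)) : ℂ), ?_⟩
  simp only [Variety.cubicOf, Finset.mul_sum, C_mul_monomial]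
  refine Finset.sum_congr rfl fun m _ => ?_
  exact congrArg _ (ht (.cubic m))

/-- A point of a tower over a given point of `𝕐` where the rational map is regular. -/
lemma IsTower.exists_point (hV : IsTower V) (D : YDatum) (h : pairForm D.g D.f ≠ 0) :
    ∃ y : V.Points, TorusEquiv D.vec (V.baseVec y.coords) ∧
      ∀ (ω : P44) (c : ℂ), c ≠ 0 → D.form = c • (ω.rep : Fin 4 → S) → ω ∈ V.toP44 y := by
  obtain ⟨z, hz, hzD⟩ := hV.lift D.vec ⟨D, rfl⟩ (by rwa [D.quadricOf_vec, D.cubicOf_vec])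
  obtain ⟨t, ht⟩ := pointOf_coords hz
  refine ⟨pointOf hz, ?_, fun ω c hc hω => (mem_toP44 hV).2 ?_⟩
  · rw [ht, ← hzD]
    exact hV.torusEquiv_baseVec t z
  · rw [ht]
    exact isValue_torus t (hV.isValue hzD hc hω)

theorem existsUnique_of_mem_orbit (hV : IsTower V) {ω : P44} (hω : ω ∈ orbit) :
    ∃! y : V.Points, ω ∈ V.toP44 y := by
  obtain ⟨A, c, hc⟩ := hω
  have hc0 : c ≠ 0 := fun h0 => ω.rep_ne_zero (by rw [hc, h0, zero_smul])
  have hn : ¬ ((0 : ℂ) = 0 ∧ (0 : ℂ) = 0 ∧ (0 : ℂ) = 0 ∧ (1 : ℂ) = 0 ∧ (-1 : ℂ) = 0) := by norm_num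
  obtain ⟨y, -, hy⟩ := hV.exists_point (chartDatum A 0 0 (-1 / 2) 0 0 0 1 (-1) hn)
    (by rw [chartDatum_g, chartDatum_f]; exact pairForm_chart_ne_zero A hn)
  have hf : (chartDatum A 0 0 (-1 / 2) 0 0 0 1 (-1) hn).form = - pullback A omega0 := by
    funext j
    apply mul_left_cancel₀ (frame_ne_zero A 0)
    have h1 := isChartForm_pullback A j
    have h2 := chartDatum_isChartForm A 0 0 (-1 / 2) 0 0 0 1 (-1) hn j
    rw [← h1, Pi.neg_apply] at h2
    rw [Pi.neg_apply, mul_neg, ← h2, mul_neg, neg_neg]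
  have hωy : ω ∈ V.toP44 y := hy ω (- c⁻¹) (neg_ne_zero.2 (inv_ne_zero hc0)) (by
    rw [hf, hc, smul_smul, neg_mul, inv_mul_cancel₀ hc0, neg_smul, one_smul])
  exact ⟨y, hωy, fun y' hy' => value_injective hV ⟨A, c, hc⟩ hy' hωy⟩

/-- There is exactly one point over a flag and a pair in the chart. -/
theorem exists_point_of_chart (A : GL (Fin 4) ℂ) {b0 b1 b3 a0 a1 a2 a3 a5 : ℂ}
    (h : ¬ (a0 = 0 ∧ a1 = 0 ∧ a2 = 0 ∧ a3 = 0 ∧ a5 = 0)) :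
    ∃ (η : Omega14) (hη : η ≠ 0), IsChartForm A b0 b1 b3 a0 a1 a2 a3 a5 η ∧
      ∃ y : Y4.Points, LiesOver A b0 b1 b3 a0 a1 a2 a3 a5 y ∧
        Projectivization.mk ℂ η hη ∈ Y4.toP44 y ∧
        ∀ y₁ : Y4.Points, LiesOver A b0 b1 b3 a0 a1 a2 a3 a5 y₁ → y₁ = y := by
  set D := chartDatum A b0 b1 b3 a0 a1 a2 a3 a5 h
  have hpair : pairForm D.g D.f ≠ 0 := by
    rw [chartDatum_g, chartDatum_f]; exact pairForm_chart_ne_zero A h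
  have hη : (⟨- D.form, Omega14.neg_mem D.form_mem⟩ : Omega14) ≠ 0 := fun h0 =>
    hpair (D.form_eq_zero_iff.1 (neg_eq_zero.1 (congrArg Subtype.val h0)))
  obtain ⟨y, hD, hy⟩ := isTower_Y4.exists_point D hpair
  have lies : LiesOver A b0 b1 b3 a0 a1 a2 a3 a5 y := by
    refine ⟨hD.flagOf_eq.trans ((D.flagOf_eq_iff A).2 (chartDatum_adapted ..)), ?_, ?_⟩
    · obtain ⟨r, hr⟩ := hD.quadricOf_eq
      rw [D.quadricOf_vec, chartDatum_g] at hr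
      exact ⟨r, hr⟩
    · obtain ⟨r, hr⟩ := hD.cubicOf_eq
      rw [D.cubicOf_vec, chartDatum_f] at hr
      exact ⟨r, hr⟩
  -- Flag, quadric and cubic fix all base coordinates, pencil included, up to the torus. The pair
  -- form is nonzero, so the tower has only one point above them.
  have unique : ∀ y₁ : Y4.Points, LiesOver A b0 b1 b3 a0 a1 a2 a3 a5 y₁ → TorusEquiv (flagVec A
      (chartQuadric A b0 b1 b3) (chartCubic A b1 b3 a0 a1 a2 a3 a5)) (Y4.baseVec y₁.coords) ∧
      pairForm (Y4.quadricOf y₁.coords) (Y4.cubicOf y₁.coords) ≠ 0 := by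
    rintro y₁ ⟨hA, ⟨r, hr⟩, ⟨k, hk⟩⟩
    obtain ⟨E, hE, -, hg, hf⟩ := isTower_Y4.exists_datum (coords_mem y₁)
    have hA' : E.Adapted A := by
      rw [← E.flagOf_eq_iff, ← hE]
      exact hA
    rw [hg] at hr
    rw [hf] at hk
    refine ⟨hE ▸ E.torusEquiv_chart hA' hr hk, ?_⟩
    rw [hg, hf, hr, hk]
    intro h0
    apply pairForm_chart_ne_zero A h
    have hr0 : r ≠ 0 := fun h0 => E.g_ne_zero (by rw [hr, h0]; simp)
    have hk0 : k ≠ 0 := fun h0 => E.f_ne_zero (by rw [hk, h0]; simp)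
    funext j
    have := congrFun h0 j
    rw [pairForm_C_mul] at this
    exact (mul_eq_zero.1 this).resolve_left (C_ne_zero.2 (mul_ne_zero hr0 hk0))
  refine ⟨_, hη, chartDatum_isChartForm A b0 b1 b3 a0 a1 a2 a3 a5 h, y, lies, ?_, fun y₁ h₁ => points_ext ?_⟩
  · obtain ⟨c, hc⟩ := Projectivization.exists_smul_eq_mk_rep ℂ _ hη
    refine hy _ (-(c⁻¹ : ℂˣ)) (neg_ne_zero.2 (Units.ne_zero _)) ?_
    rw [← hc]
    change D.form = (-((c⁻¹ : ℂˣ) : ℂ)) • ((c : ℂ) • (- D.form))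
    rw [smul_smul, neg_mul, Units.inv_mul, neg_smul, one_smul, neg_neg]
  · obtain ⟨h1, h2⟩ := unique y₁ h₁
    exact isTower_Y4.unique _ (coords_mem y₁) _ (coords_mem y) h2
      (h1.symm.trans (unique y lies).1)

end ExceptionalFoliation

end

theorem mainTheorem5 :
    -- the values of `Φ` lie in `E(3)`
    (∀ y : ExceptionalFoliation.Y4.Points, ∀ ω ∈ ExceptionalFoliation.Phi y,
      ω ∈ ExceptionalFoliation.E3) ∧
    -- the orbit is open (and dense, by definition) in `E(3)`
    (∃ O : Set ExceptionalFoliation.P44, IsOpen O ∧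
      O ∩ ExceptionalFoliation.E3 = ExceptionalFoliation.orbit) ∧
    -- its inverse image is open and dense in `𝕐₄`
    IsOpen {y : ExceptionalFoliation.Y4.Points |
      ∃ ω ∈ ExceptionalFoliation.Phi y, ω ∈ ExceptionalFoliation.orbit} ∧
    Dense {y : ExceptionalFoliation.Y4.Points |
      ∃ ω ∈ ExceptionalFoliation.Phi y, ω ∈ ExceptionalFoliation.orbit} ∧
    -- every point of the orbit has exactly one inverse image
    (∀ ω ∈ ExceptionalFoliation.orbit,
      ∃! y : ExceptionalFoliation.Y4.Points, ω ∈ ExceptionalFoliation.Phi y) ∧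
    -- the flag can be recovered from the singular locus
    (∀ y : ExceptionalFoliation.Y4.Points, ∀ ω ∈ ExceptionalFoliation.Phi y,
      ω ∈ ExceptionalFoliation.orbit →
        (∃ A : GL (Fin 4) ℂ,
          ExceptionalFoliation.Y4.flagOf y.coords = ExceptionalFoliation.frameFlag A ∧
          ExceptionalFoliation.singularLocus ω = ExceptionalFoliation.threeCurves A) ∧
        ∀ y₁ : ExceptionalFoliation.Y4.Points, ∀ ω₁ ∈ ExceptionalFoliation.Phi y₁,
          ω₁ ∈ ExceptionalFoliation.orbit →
          ExceptionalFoliation.singularLocus ω₁ = ExceptionalFoliation.singularLocus ω →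
          ExceptionalFoliation.Y4.flagOf y₁.coords = ExceptionalFoliation.Y4.flagOf y.coords) ∧
    -- over a fixed flag: the coefficients of `dx₃` and `dx₂` ...
    (∀ (A : GL (Fin 4) ℂ) (b0 b1 b3 a0 a1 a2 a3 a5 : ℂ),
      ¬ (a0 = 0 ∧ a1 = 0 ∧ a2 = 0 ∧ a3 = 0 ∧ a5 = 0) →
      ∃ (η : ExceptionalFoliation.Omega14) (hη : η ≠ 0),
        ExceptionalFoliation.IsChartForm A b0 b1 b3 a0 a1 a2 a3 a5 η ∧
        (∃ y : ExceptionalFoliation.Y4.Points,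
          ExceptionalFoliation.LiesOver A b0 b1 b3 a0 a1 a2 a3 a5 y ∧
          Projectivization.mk ℂ η hη ∈ ExceptionalFoliation.Phi y ∧
          ∀ y₁ : ExceptionalFoliation.Y4.Points,
            ExceptionalFoliation.LiesOver A b0 b1 b3 a0 a1 a2 a3 a5 y₁ → y₁ = y) ∧
        ExceptionalFoliation.dCoeff A 3 η =
          MvPolynomial.C (2 * a3) * ExceptionalFoliation.frame A 0
            * ExceptionalFoliation.chartQuadric A b0 b1 b3 ∧
        ExceptionalFoliation.dCoeff A 2 η =
          MvPolynomial.C (2 * a2 * b0 - 3 * a0) * ExceptionalFoliation.frame A 0 ^ 3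
          + MvPolynomial.C (2 * a5 * b0 + 2 * a2 * b1 - 3 * a1)
            * ExceptionalFoliation.frame A 0 ^ 2 * ExceptionalFoliation.frame A 1
          + MvPolynomial.C (-a5 * b1 + 2 * a2 * b3)
            * ExceptionalFoliation.frame A 0 * ExceptionalFoliation.frame A 1 ^ 2
          - MvPolynomial.C a2
            * ExceptionalFoliation.frame A 0 ^ 2 * ExceptionalFoliation.frame A 2
          - MvPolynomial.C a5 * ExceptionalFoliation.frame A 0
            * ExceptionalFoliation.frame A 1 * ExceptionalFoliation.frame A 2
          - MvPolynomial.C (3 * a3)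
            * ExceptionalFoliation.frame A 0 ^ 2 * ExceptionalFoliation.frame A 3) ∧
    -- ... determine the quadric and, up to the common factor, the cubic, where `a₃ ≠ 0`
    (∀ (A : GL (Fin 4) ℂ) (b0 b1 b3 a0 a1 a2 a3 a5 b0' b1' b3' a0' a1' a2' a3' a5' c : ℂ)
      (η η' : Fin 4 → ExceptionalFoliation.S),
      a3 ≠ 0 → a3' ≠ 0 →
      ExceptionalFoliation.IsChartForm A b0 b1 b3 a0 a1 a2 a3 a5 η →
      ExceptionalFoliation.IsChartForm A b0' b1' b3' a0' a1' a2' a3' a5' η' →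
      ExceptionalFoliation.dCoeff A 3 η' =
        MvPolynomial.C c * ExceptionalFoliation.dCoeff A 3 η →
      ExceptionalFoliation.dCoeff A 2 η' =
        MvPolynomial.C c * ExceptionalFoliation.dCoeff A 2 η →
      (b0' = b0 ∧ b1' = b1 ∧ b3' = b3) ∧
      (a0' = c * a0 ∧ a1' = c * a1 ∧ a2' = c * a2 ∧ a3' = c * a3 ∧ a5' = c * a5)) := by
  obtain ⟨O, hO, hE⟩ := ExceptionalFoliation.exists_isOpen_inter_E3
  refine ⟨fun y ω h => ExceptionalFoliation.value_mem_E3 ExceptionalFoliation.isTower_Y4 (ExceptionalFoliation.coords_mem y) ((ExceptionalFoliation.mem_toP44 ExceptionalFoliation.isTower_Y4).1 h),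
    ⟨O, hO, hE⟩, ExceptionalFoliation.isOpen_preimage_orbit ExceptionalFoliation.isTower_Y4 hO hE, ExceptionalFoliation.dense_preimage_orbit ExceptionalFoliation.isTower_Y4,
    fun ω hω => ExceptionalFoliation.existsUnique_of_mem_orbit ExceptionalFoliation.isTower_Y4 hω, fun y ω h hω => ?_,
    fun A b0 b1 b3 a0 a1 a2 a3 a5 h => ?_,
    fun A b0 b1 b3 a0 a1 a2 a3 a5 b0' b1' b3' a0' a1' a2' a3' a5' c η η' _ h3' hη hη' e3 e2 =>
      hη.eq_of_dCoeff h3' hη' e3 e2⟩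
  · obtain ⟨A, hA, hsing⟩ := ExceptionalFoliation.exists_frame_of_value h hω
    refine ⟨⟨A, hA, hsing⟩, fun y₁ ω₁ h₁ hω₁ hs => ?_⟩
    obtain ⟨A₁, hA₁, hsing₁⟩ := ExceptionalFoliation.exists_frame_of_value h₁ hω₁
    rw [hA, hA₁]
    exact ExceptionalFoliation.frameFlag_eq (by rw [← hsing, ← hsing₁, hs])
  · obtain ⟨η, hη, hform, hy⟩ := ExceptionalFoliation.exists_point_of_chart A h
    exact ⟨η, hη, hform, hy, hform.dCoeff_eq⟩
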